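/- Let $P$ be a simple orthogonal polygon (a closed region bounded by a simple closed polygonal curve whose edges are alternately horizontal and vertical), and let $S=\{s_1,\dots,s_k\}$ be a finite family of non-degenerate axis-parallel line segments contained in $P$. A sliding robot $r_i$ moves on $s_i$. Standing at $q\in s_i$ it sees the set $\ell_i(q)$ of all points $p$ for which the segment $\overline{pq}$ is perpendicular to $s_i$ and contained in $P$. The sliding visibility polygon of $s_i$ is $V_i=\bigcup_{q\in s_i}\ell_i(q)$. Assume that $S$ guards $P$, i.e. $\bigcup_i V_i=P$. Evaders move along arbitrary continuous paths in $P$, with unbounded speed; an evader is detected when some robot sees it. An event point of $r_i$ is a position at which it sees a reflex vertex of $P$, sees a waiting robot, or is at an endpoint of $s_i$. Consider the following motion-planning algorithm. For each robot three subsets of $P$ are stored: $D_i(1)$, the region recorded as cleared by $r_i$; $D_i(2)$, the region that $r_i$ still has to clear; $D_i(3)$, the region for whose clearing $r_i$ is waiting. Initially all of them are empty and all of $P$ is contaminated. At each time one robot is in charge; a robot that moves does so along its segment, at constant speed during each step, and all the others stand still. * Start. The chosen robot $r_i$ is placed at one of the endpoints $q$ of $s_i$, with the other endpoint as its goal, and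 is in charge; $D_i(1)=\ell_i(q)$ and $D_i(2)=P\setminus\ell_i(q)$. * Decision. Let $r_i$ be in charge, not waiting, and $D_i(2)\ne\emptyset$. If some connected component $K$ of $D_i(2)$ contains no point of $V_i$, then $r_i$ stops, waits, sets $D_i(3)=K$ for one such $K$, and sends a signal. If there is no such $K$, it moves on to the next event point in the direction of its goal; the part of $D_i(2)$ that it sees during this move is added to $D_i(1)$ and removed from $D_i(2)$. * Answering a signal. If $r_j$ waits for $D_j(3)=K$ and its signal has not been answered, any robot $r_m$ with $V_m\cap K\neq\emptyset$ may answer and is then in charge. It starts at an endpoint $e$ of $s_m$ and takes the other endpoint as its goal; or, if $s_m$ is disjoint from $K$, it may instead start at a position on $s_m$ from which it sees a point of $\partial P\cap\overline K$ on the line of sight of $r_j$, and such that no point of $K$ can be seen from the positions between $e$ and that position. If $q$ is the starting position, $K\cap\ell_m(q)$ is added to $D_m(1)$, and $D_m(2)=K\setminus\ell_m(q)$. * Moving back and updating. If $r_m$ is in charge and $D_m(2)=\emptyset$, it moves back (away from its goal) until it sees a waiting robot or reaches the endpoint of $s_m$. If it had answered a signal of $r_j$, then $D_j(1)$ is replaced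 by $D_j(1)\cup D_m(1)$, $D_j(2)$ by $D_j(2)\setminus D_m(1)$, $D_j(3)$ by $\emptyset$, and $r_j$ is in charge again. If $r_m$ is the robot with which the algorithm started, the algorithm stops. Then, whatever robot $r_i\in\{r_1,\dots,r_k\}$ and endpoint of $s_i$ the algorithm starts with, wherever on their segments the other robots are initially, and however the choices left open above are made: the algorithm makes only finitely many steps, and it never gets stuck before termination. When no further step is possible, all $D_i(2)$ and all $D_i(3)$ are empty, $\bigcup_i D_i(1)=P$, and $P$ is completely cleared, i.e. every evader has been detected. -/

import Mathlib

open Set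

/-- The plane, with Cartesian coordinates. -/
abbrev Plane := ℝ × ℝ

/-- A simple orthogonal polygon with `n` vertices, listed in counterclockwise order (indices are
cyclic). Edges are axis-parallel and alternate between horizontal and vertical; two different
edges meet at most in a common end point of two consecutive edges. -/
structure SimpleOrthogonalPolygon (n : ℕ) [NeZero n] where
  vertex : Fin n → Plane
  vertex_ne : ∀ k, vertex k ≠ vertex (k + 1)
  orthogonal : ∀ k,
    ((vertex k).2 = (vertex (k + 1)).2 ∧ (vertex (k + 1)).1 = (vertex (k + 1 + 1)).1) ∨
    ((vertex k).1 = (vertex (k + 1)).1 ∧ (vertex (k + 1)).2 = (vertex (k + 1 + 1)).2)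
  simple : ∀ k l, ∀ p, p ∈ segment ℝ (vertex k) (vertex (k + 1)) →
    p ∈ segment ℝ (vertex l) (vertex (l + 1)) →
    k = l ∨ (l = k + 1 ∧ p = vertex l) ∨ (k = l + 1 ∧ p = vertex k)
  /-- The signed area is positive. -/
  counterclockwise :
    0 < ∑ k, ((vertex k).1 * (vertex (k + 1)).2 - (vertex (k + 1)).1 * (vertex k).2)

namespace SimpleOrthogonalPolygon

variable {n : ℕ} [NeZero n] (P : SimpleOrthogonalPolygon n)

def edge (k : Fin n) : Set Plane := segment ℝ (P.vertex k) (P.vertex (k + 1))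

def boundary : Set Plane := ⋃ k, P.edge k

/-- The edges crossed by the open horizontal ray from `p` to the right. A horizontal edge is never
counted; a vertical edge owns its lower end point, but not its upper one. -/
def crossings (p : Plane) : Set (Fin n) :=
  {k | p.1 < (P.vertex k).1 ∧
    min (P.vertex k).2 (P.vertex (k + 1)).2 ≤ p.2 ∧
    p.2 < max (P.vertex k).2 (P.vertex (k + 1)).2}

/-- The polygon as a closed region: its boundary together with the enclosed points (those from
which a ray crosses the boundary an odd number of times). -/
def region : Set Plane := P.boundary ∪ {p | Odd (P.crossings p).ncard}

/-- The vertex `k` is reflex (interior angle `3π/2`): the counterclockwise boundary turns right. -/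
def IsReflex (k : Fin n) : Prop :=
  ((P.vertex k).1 - (P.vertex (k - 1)).1) * ((P.vertex (k + 1)).2 - (P.vertex k).2) -
    ((P.vertex k).2 - (P.vertex (k - 1)).2) * ((P.vertex (k + 1)).1 - (P.vertex k).1) < 0

end SimpleOrthogonalPolygon

/-- A family of axis-parallel line segments inside `P`, with end points `a i` and `b i`. The robot
`i` slides along the segment `i`. -/
structure SlidingRobots {n : ℕ} [NeZero n] (P : SimpleOrthogonalPolygon n) (ι : Type*) where
  a : ι → Plane
  b : ι → Plane
  ne : ∀ i, a i ≠ b i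
  axisParallel : ∀ i, (a i).1 = (b i).1 ∨ (a i).2 = (b i).2
  inside : ∀ i, segment ℝ (a i) (b i) ⊆ P.region

/-- What is stored during the execution of the algorithm. -/
structure PursuitState (ι : Type*) where
  /-- current positions of the robots -/
  pos : ι → Plane
  /-- the end point of its segment towards which a robot sweeps -/
  goal : ι → Plane
  /-- the other end point of its segment, towards which it moves back -/
  back : ι → Plane
  /-- `D1 i`: the part of `P` recorded as cleared by robot `i` -/
  D1 : ι → Set Plane
  /-- `D2 i`: the part of `P` that robot `i` still has to clear -/
  D2 : ι → Set Plane
  /-- `D3 i`: the part of `P` for whose clearing robot `i` is waiting (empty if it is not waiting) -/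
  D3 : ι → Set Plane
  /-- the robots engaged at the moment: the head is in charge, every other one is waiting, having
  sent a signal that was answered by its predecessor in the list -/
  chain : List ι
  /-- the true positions at which an evader that has never been seen may be -/
  contaminated : Set Plane

namespace SlidingRobots

variable {n : ℕ} [NeZero n] {P : SimpleOrthogonalPolygon n} {ι : Type*} (S : SlidingRobots P ι)

def track (i : ι) : Set Plane := segment ℝ (S.a i) (S.b i)

/-- The points seen by robot `i` when it stands at `q`: all `p` such that the line segment `pq` is
perpendicular to the track of `i` and contained in `P`. -/
def sight (i : ι) (q : Plane) : Set Plane :=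
  {p | segment ℝ p q ⊆ P.region ∧
    (p.1 - q.1) * ((S.b i).1 - (S.a i).1) + (p.2 - q.2) * ((S.b i).2 - (S.a i).2) = 0}

/-- The sliding visibility polygon of the segment `i`. -/
def visibilityPolygon (i : ι) : Set Plane := ⋃ q ∈ S.track i, S.sight i q

/-- `e` and `f` are the two end points of the segment `i`, in one of the two orders. -/
def AreEnds (i : ι) (e f : Plane) : Prop :=
  (e = S.a i ∧ f = S.b i) ∨ (e = S.b i ∧ f = S.a i)

/-- From `q`, robot `i` sees a robot that is waiting. -/
def SeesWaiting (s : PursuitState ι) (i : ι) (q : Plane) : Prop :=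
  ∃ w, w ≠ i ∧ s.D3 w ≠ ∅ ∧ s.pos w ∈ S.sight i q

/-- The position `q` on the track of `i` is an event point: robot `i` sees a reflex vertex, sees a
waiting robot, or is at an end point of its track. -/
def IsEventPoint (s : PursuitState ι) (i : ι) (q : Plane) : Prop :=
  (∃ k, P.IsReflex k ∧ P.vertex k ∈ S.sight i q) ∨ S.SeesWaiting s i q ∨ q = S.a i ∨ q = S.b i

/-- `K` is one of the sub-polygons that robot `i` has to have cleared by others before it may move
on: a connected piece of what it still has to clear, cut off from the rest by what it has swept so
far (up to its present line of sight), and of which it can see no point from its track. -/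
def IsPocket (s : PursuitState ι) (i : ι) (K : Set Plane) : Prop :=
  (∃ x ∈ s.D2 i, K = connectedComponentIn (s.D2 i) x) ∧ Disjoint K (S.visibilityPolygon i)

/-- What robot `i` sees while it moves from `q` to `q'`. -/
def swept (i : ι) (q q' : Plane) : Set Plane := ⋃ r ∈ segment ℝ q q', S.sight i r

/-- `q'` is the next event point for robot `i` on its way to its goal. -/
def IsNextEvent (s : PursuitState ι) (i : ι) (q' : Plane) : Prop :=
  q' ∈ segment ℝ (s.pos i) (s.goal i) ∧ q' ≠ s.pos i ∧ S.IsEventPoint s i q' ∧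
    ∀ r ∈ openSegment ℝ (s.pos i) q', ¬ S.IsEventPoint s i r

/-- Robot `i` may move back to `q'`: it moves towards the end `s.back i` of its track until it sees
a waiting robot or reaches that end. -/
def IsMoveBack (s : PursuitState ι) (i : ι) (q' : Plane) : Prop :=
  q' ∈ segment ℝ (s.pos i) (s.back i) ∧ (q' = s.back i ∨ S.SeesWaiting s i q') ∧
    ∀ r ∈ segment ℝ (s.pos i) q', r ≠ q' → ¬ S.SeesWaiting s i r

/-- Robot `m` can answer the signal of the waiting robot `j`, starting at `q` and sweeping from the
side of `e` towards the end `f` of its track. It must be able to see a part of the sub-polygon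
`s.D3 j`. It starts at the end `e` of its track; or, if its track is outside the sub-polygon, at a
position from which it sees a point `c` where the boundary part of the sub-polygon begins or ends
at the line of sight of `j`, and behind which it sees nothing of the sub-polygon. -/
def CanAnswer (s : PursuitState ι) (j m : ι) (q e f : Plane) : Prop :=
  (S.visibilityPolygon m ∩ s.D3 j).Nonempty ∧ S.AreEnds m e f ∧
    (q = e ∨
      (q ∈ S.track m ∧ Disjoint (S.track m) (s.D3 j) ∧
        (∃ c ∈ P.boundary ∩ closure (s.D3 j) ∩ S.sight j (s.pos j), c ∈ S.sight m q) ∧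
        ∀ r ∈ segment ℝ e q, r ≠ q → Disjoint (S.sight m r) (s.D3 j)))

/-- Evaders move continuously in `P` with unbounded speed. While each robot `i` slides at constant
speed from `pos i` to `pos' i`, the possible positions `C` of unseen evaders turn into this set. -/
def evolve (pos pos' : ι → Plane) (C : Set Plane) : Set Plane :=
  {x | ∃ γ : ℝ → Plane, ContinuousOn γ (Icc 0 1) ∧ γ 0 ∈ C ∧ γ 1 = x ∧
    ∀ t ∈ Icc (0 : ℝ) 1, γ t ∈ P.region ∧
      ∀ i, γ t ∉ S.sight i (AffineMap.lineMap (pos i) (pos' i) t)}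

/-- The situations directly after the start step, in which robot `i` has been placed at one of the
ends of its track and has been put in charge of all of `P`. All of `P` is contaminated. -/
def IsStart (i : ι) (s : PursuitState ι) : Prop :=
  (∀ j, s.pos j ∈ S.track j) ∧
  s.pos i = s.back i ∧ S.AreEnds i (s.back i) (s.goal i) ∧
  s.D1 i = S.sight i (s.pos i) ∧ s.D2 i = P.region \ S.sight i (s.pos i) ∧
  (∀ j, j ≠ i → s.D1 j = ∅ ∧ s.D2 j = ∅) ∧ (∀ j, s.D3 j = ∅) ∧
  s.chain = [i] ∧ s.contaminated = P.region

/-- One step of the algorithm. -/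
inductive Step [DecidableEq ι] : PursuitState ι → PursuitState ι → Prop
  /-- Decision step: some sub-polygon has to be cleared by others first. Robot `i` stops, waits and
  sends a signal. -/
  | wait (s : PursuitState ι) (i : ι) (rest : List ι) (K : Set Plane)
      (hchain : s.chain = i :: rest) (hD3 : s.D3 i = ∅) (hK : S.IsPocket s i K) :
      Step s { s with
        D3 := Function.update s.D3 i K
        contaminated := S.evolve s.pos s.pos s.contaminated }
  /-- A robot `m` answers the signal of the waiting robot `j` and takes charge. -/
  | answer (s : PursuitState ι) (j m : ι) (rest : List ι) (q e f : Plane)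
      (hchain : s.chain = j :: rest) (hD3 : s.D3 j ≠ ∅) (hm : S.CanAnswer s j m q e f) :
      Step s { s with
        pos := Function.update s.pos m q
        goal := Function.update s.goal m f
        back := Function.update s.back m e
        D1 := Function.update s.D1 m (s.D1 m ∪ (s.D3 j ∩ S.sight m q))
        D2 := Function.update s.D2 m (s.D3 j \ S.sight m q)
        chain := m :: j :: rest
        contaminated := S.evolve s.pos (Function.update s.pos m q) s.contaminated }
  /-- Decision step: nothing has to be cleared by others at present. Robot `i` moves on to the next
  event point and updates its cleared part and its remaining part. -/
  | advance (s : PursuitState ι) (i : ι) (rest : List ι) (q' : Plane)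
      (hchain : s.chain = i :: rest) (hD3 : s.D3 i = ∅) (hD2 : s.D2 i ≠ ∅)
      (hK : ∀ K, ¬ S.IsPocket s i K) (hq : S.IsNextEvent s i q') :
      Step s { s with
        pos := Function.update s.pos i q'
        D1 := Function.update s.D1 i (s.D1 i ∪ (s.D2 i ∩ S.swept i (s.pos i) q'))
        D2 := Function.update s.D2 i (s.D2 i \ S.swept i (s.pos i) q')
        contaminated := S.evolve s.pos (Function.update s.pos i q') s.contaminated }
  /-- Move back-and-update step: robot `m` has finished. It moves back and updates the stored
  information of the robot `j` whose signal it had answered; `j` is in charge again. -/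
  | report (s : PursuitState ι) (m j : ι) (rest : List ι) (q' : Plane)
      (hchain : s.chain = m :: j :: rest) (hD2 : s.D2 m = ∅) (hq : S.IsMoveBack s m q') :
      Step s { s with
        pos := Function.update s.pos m q'
        D1 := Function.update s.D1 j (s.D1 j ∪ s.D1 m)
        D2 := Function.update s.D2 j (s.D2 j \ s.D1 m)
        D3 := Function.update s.D3 j ∅
        chain := j :: rest
        contaminated := S.evolve s.pos (Function.update s.pos m q') s.contaminated }
  /-- The robot with which the algorithm started has finished and moves back. -/
  | finish (s : PursuitState ι) (i : ι) (q' : Plane)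
      (hchain : s.chain = [i]) (hD2 : s.D2 i = ∅) (hq : S.IsMoveBack s i q') :
      Step s { s with
        pos := Function.update s.pos i q'
        chain := []
        contaminated := S.evolve s.pos (Function.update s.pos i q') s.contaminated }

/-- The condition of the termination step: no robot is waiting, all robots have cleared what they
had to clear, and the regions recorded as cleared make up all of `P`. -/
def Terminated (s : PursuitState ι) : Prop :=
  (∀ i, s.D3 i = ∅) ∧ (∀ i, s.D2 i = ∅) ∧ ⋃ i, s.D1 i = P.region

end SlidingRobots

/-!
Why the algorithm is correct. The difficulty is geometric: when a robot reports that it has cleared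
a region, no evader may have slipped back behind its line of sight.

A set `D` is called separated at a point `z` of the polygon if near `z` the polygon is contained in
`D` or disjoint from it (`Separated`). An unseen evader whose path avoids all points at which `D` is
not separated cannot enter or leave `D`. The invariant of the algorithm (`Invariant`) says that the
set `D2` of each engaged robot is separated off the present lines of sight of this robot and of
those waiting below it, and that all unseen evaders are in the region that is still to be cleared
(`uncleared`). The pockets are components of `D2`, and components inherit separation
(`IsRegion.separated_connectedComponentIn`), so waiting, answering and reporting preserve the
invariant, by set algebra.

The essential step is the move to the next event point (`IsRegion.separated_diff_sweep`). When the
line of sight leaves its old position, a remaining point just beside it could fail to be swept for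
two reasons. A gap between the point and the track would begin at a reflex vertex in sight, which
would have been an event. Or the point is on the wrong side, or behind an obstacle; but since no
component of `D2` is a pocket, it is joined within `D2` to a point visible from the track ahead.
This path, closed up along the track and the old line of sight, is a closed curve in the polygon; it
would wind around points outside, which is impossible as the polygon has no holes
(`IsRegion.chord`). During the move the same statement holds at all intermediate positions, and a
connectedness argument in time shows that no evader escapes (`mem_diff_swept_of_path`).

The facts about polygons that are used (`IsRegion`) follow from the structure of the winding number
of the boundary, the signed count of crossings of a ray. It is constant on the right sides of all
edges, because these are joined by a path along the boundary that does not meet it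
(`IsGap.joined_cornerStart`), and it grows by one across each edge from right to left. As the signed
area is positive, it takes only the values `0` and `1` (`wind_eq_zero_or_one`), the region is where
it is `1` together with the boundary, and the complement is connected to infinity along the right
sides of the edges.

Progress (`Invariant.exists_step`) holds because the events on a track are finitely many, and the
robots together see the whole polygon. For termination (`Invariant.totalProgress_lt`), each engaged
robot is given the triple of the number of events ahead, the number of components of its `D2`, and a
flag for not waiting. Each step but the last lowers the sequence of these triples, from the bottom of the chain to
the top, in the lexicographic order. Robots do not occur twice in the chain, since the engaged
robots see nothing of the pocket of the head; so these sequences have bounded length, and the order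
is well-founded.
-/

namespace OrthoPlane

/-! ### Crossing numbers of closed orthogonal curves -/

/-- The segment from `a` to `b` is horizontal or vertical (or degenerate). -/
def AxisParallel (a b : Plane) : Prop := a.1 = b.1 ∨ a.2 = b.2

lemma AxisParallel.symm {a b : Plane} (h : AxisParallel a b) : AxisParallel b a :=
  h.imp Eq.symm Eq.symm

lemma AxisParallel.mem_segment_iff {a b p : Plane} (h : AxisParallel a b) :
    p ∈ segment ℝ a b ↔ p.1 ∈ uIcc a.1 b.1 ∧ p.2 ∈ uIcc a.2 b.2 := by
  obtain ⟨a1, a2⟩ := a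
  obtain ⟨b1, b2⟩ := b
  obtain ⟨p1, p2⟩ := p
  rcases h with h | h
  · obtain rfl : a1 = b1 := h
    rw [← Prod.image_mk_segment_right, segment_eq_uIcc]
    simp only [mem_image, Prod.mk.injEq, uIcc_self, mem_singleton_iff]
    constructor
    · rintro ⟨y, hy, rfl, rfl⟩; exact ⟨rfl, hy⟩
    · rintro ⟨rfl, hy⟩; exact ⟨_, hy, rfl, rfl⟩
  · obtain rfl : a2 = b2 := h
    rw [← Prod.image_mk_segment_left, segment_eq_uIcc]
    simp only [mem_image, Prod.mk.injEq, uIcc_self, mem_singleton_iff]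
    constructor
    · rintro ⟨y, hy, rfl, rfl⟩; exact ⟨hy, rfl⟩
    · rintro ⟨hy, rfl⟩; exact ⟨_, hy, rfl, rfl⟩

/-- Indicator of `a` lying strictly to the right of `p`. -/
noncomputable def rightOf (p a : Plane) : ℤ := if p.1 < a.1 then 1 else 0

/-- Indicator of `a` lying strictly above `p`. -/
noncomputable def above (p a : Plane) : ℤ := if p.2 < a.2 then 1 else 0

/-- A finite family of directed segments is a cycle if every point is the start of as many of them
as it is the end. -/
def IsCycle (E : Multiset (Plane × Plane)) : Prop :=
  ∀ f : Plane → ℤ, (E.map fun e => f e.2 - f e.1).sum = 0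

/-- The signed number of crossings of the ray from `p` to the right with the axis-parallel segments
of `E`; upward crossings count `1`. If `E` is a cycle and `p` is off its segments, this is the
winding number of `E` around `p`. On the segments it takes the value at nearby points to the upper
right. -/
noncomputable def winding (E : Multiset (Plane × Plane)) (p : Plane) : ℤ :=
  (E.map fun e => rightOf p e.1 * (above p e.2 - above p e.1)).sum

/-- Counting crossings with the upward ray gives the same number: for an axis-parallel segment from
`a` to `b`, the two counts add up to the change of the indicator of the quadrant at the upper
right. -/
lemma winding_eq_neg_sum {E : Multiset (Plane × Plane)} (hE : IsCycle E)
    (hax : ∀ e ∈ E, AxisParallel e.1 e.2) (p : Plane) :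
    winding E p = -(E.map fun e => above p e.1 * (rightOf p e.2 - rightOf p e.1)).sum := by
  rw [eq_neg_iff_add_eq_zero, winding, ← Multiset.sum_map_add,
    ← hE fun a => rightOf p a * above p a]
  refine congrArg _ (Multiset.map_congr rfl fun e he => ?_)
  rcases hax e he with h | h
  · have : rightOf p e.1 = rightOf p e.2 := by simp [rightOf, h]
    rw [this]; ring
  · have : above p e.1 = above p e.2 := by simp [above, h]
    rw [this]; ring

lemma winding_sub_of_fst_eq {E : Multiset (Plane × Plane)} (hE : IsCycle E)
    (hax : ∀ e ∈ E, AxisParallel e.1 e.2) {p p' : Plane} (h : p.1 = p'.1) :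
    winding E p' - winding E p =
      (E.map fun e => (above p e.1 - above p' e.1) * (rightOf p e.2 - rightOf p e.1)).sum := by
  rw [winding_eq_neg_sum hE hax, winding_eq_neg_sum hE hax, neg_sub_neg, ← Multiset.sum_map_sub]
  refine congrArg _ (Multiset.map_congr rfl fun e _ => ?_)
  have : ∀ a, rightOf p' a = rightOf p a := fun a => by simp [rightOf, h]
  rw [this, this]; ring

lemma above_sub_above_eq_zero {p p' a : Plane} (hp : p.2 ≤ p'.2)
    (h : ¬ (p.2 < a.2 ∧ a.2 ≤ p'.2)) : above p a - above p' a = 0 := by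
  unfold above
  split_ifs with h1 h2 h2
  · rfl
  · exact absurd ⟨h1, not_lt.1 h2⟩ h
  · linarith
  · rfl

lemma rightOf_sub_rightOf_eq_zero {p a b : Plane} (h : p.1 ∉ uIcc a.1 b.1) :
    rightOf p b - rightOf p a = 0 := by
  rw [mem_uIcc] at h
  unfold rightOf
  split_ifs with h1 h2 h2
  · rfl
  · exact absurd (Or.inl ⟨not_lt.1 h2, h1.le⟩) h
  · exact absurd (Or.inr ⟨not_lt.1 h1, h2.le⟩) h
  · rfl

lemma above_sub_above_eq_zero' {p a b : Plane} (h : p.2 ∉ uIcc a.2 b.2) :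
    above p b - above p a = 0 := by
  rw [mem_uIcc] at h
  unfold above
  split_ifs with h1 h2 h2
  · rfl
  · exact absurd (Or.inl ⟨not_lt.1 h2, h1.le⟩) h
  · exact absurd (Or.inr ⟨not_lt.1 h1, h2.le⟩) h
  · rfl

/-- A segment contributes equally to the upward crossing counts at two points of a vertical line if
it does not cross the part of the line between them. -/
lemma vertical_term_eq_zero {a b p p' : Plane} (hab : AxisParallel a b) (hp : p.2 ≤ p'.2)
    (h : ∀ y, p.2 < y → y ≤ p'.2 → (p.1, y) ∉ segment ℝ a b) :
    (above p a - above p' a) * (rightOf p b - rightOf p a) = 0 := by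
  by_cases h1 : p.2 < a.2 ∧ a.2 ≤ p'.2
  · by_cases h2 : p.1 ∈ uIcc a.1 b.1
    · refine absurd ?_ (h a.2 h1.1 h1.2)
      exact hab.mem_segment_iff.2 ⟨h2, left_mem_uIcc⟩
    · rw [rightOf_sub_rightOf_eq_zero h2, mul_zero]
  · rw [above_sub_above_eq_zero hp h1, zero_mul]

/-- A segment contributes equally to the crossing counts of the rightward rays at two points of a
horizontal line if it does not cross the part of the line between them. -/
lemma horizontal_term_eq {a b p p' : Plane} (hab : AxisParallel a b) (h2 : p.2 = p'.2)
    (hp : p.1 ≤ p'.1) (h : ∀ x, p.1 < x → x ≤ p'.1 → (x, p.2) ∉ segment ℝ a b) :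
    rightOf p a * (above p b - above p a) = rightOf p' a * (above p' b - above p' a) := by
  have hab' : ∀ c, above p' c = above p c := fun c => by simp [above, h2]
  rw [hab', hab']
  by_cases h1 : p.2 ∈ uIcc a.2 b.2
  · by_cases h3 : p.1 < a.1 ∧ a.1 ≤ p'.1
    · refine absurd ?_ (h a.1 h3.1 h3.2)
      exact hab.mem_segment_iff.2 ⟨left_mem_uIcc, h1⟩
    · congr 1
      unfold rightOf
      split_ifs with h4 h5 h5
      · rfl
      · exact absurd ⟨h4, not_lt.1 h5⟩ h3
      · linarith
      · rfl
  · rw [above_sub_above_eq_zero' h1, mul_zero, mul_zero]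

lemma winding_eq_of_horizontal {E : Multiset (Plane × Plane)}
    (hax : ∀ e ∈ E, AxisParallel e.1 e.2) {p p' : Plane} (h2 : p.2 = p'.2) (hp : p.1 ≤ p'.1)
    (h : ∀ e ∈ E, ∀ x, p.1 < x → x ≤ p'.1 → (x, p.2) ∉ segment ℝ e.1 e.2) :
    winding E p = winding E p' :=
  congrArg Multiset.sum (Multiset.map_congr rfl fun e he => horizontal_term_eq (hax e he) h2 hp (h e he))

lemma winding_eq_of_vertical {E : Multiset (Plane × Plane)} (hE : IsCycle E)
    (hax : ∀ e ∈ E, AxisParallel e.1 e.2) {p p' : Plane} (h1 : p.1 = p'.1) (hp : p.2 ≤ p'.2)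
    (h : ∀ e ∈ E, ∀ y, p.2 < y → y ≤ p'.2 → (p.1, y) ∉ segment ℝ e.1 e.2) :
    winding E p = winding E p' := by
  rw [← sub_eq_zero, ← neg_eq_zero, neg_sub, winding_sub_of_fst_eq hE hax h1]
  refine Multiset.sum_eq_zero fun x hx => ?_
  obtain ⟨e, he, rfl⟩ := Multiset.mem_map.1 hx
  exact vertical_term_eq_zero (hax e he) hp (h e he)

lemma winding_eq_of_segment {E : Multiset (Plane × Plane)} (hE : IsCycle E)
    (hax : ∀ e ∈ E, AxisParallel e.1 e.2) {p p' : Plane} (hpp : AxisParallel p p')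
    (h : ∀ e ∈ E, Disjoint (segment ℝ p p') (segment ℝ e.1 e.2)) :
    winding E p = winding E p' := by
  have key : ∀ e ∈ E, ∀ x y, x ∈ uIcc p.1 p'.1 → y ∈ uIcc p.2 p'.2 →
      (x, y) ∉ segment ℝ e.1 e.2 := fun e he x y hx hy =>
    Set.disjoint_left.1 (h e he) (hpp.mem_segment_iff.2 ⟨hx, hy⟩)
  rcases hpp with h1 | h2
  · rcases le_total p.2 p'.2 with hp | hp
    · exact winding_eq_of_vertical hE hax h1 hp fun e he y hy hy' =>
        key e he _ _ left_mem_uIcc (mem_uIcc.2 (Or.inl ⟨hy.le, hy'⟩))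
    · exact (winding_eq_of_vertical hE hax h1.symm hp fun e he y hy hy' =>
        key e he _ _ right_mem_uIcc (mem_uIcc.2 (Or.inr ⟨hy.le, hy'⟩))).symm
  · rcases le_total p.1 p'.1 with hp | hp
    · exact winding_eq_of_horizontal hax h2 hp fun e he y hy hy' =>
        key e he _ _ (mem_uIcc.2 (Or.inl ⟨hy.le, hy'⟩)) left_mem_uIcc
    · exact (winding_eq_of_horizontal hax h2.symm hp fun e he y hy hy' =>
        key e he _ _ (mem_uIcc.2 (Or.inr ⟨hy.le, hy'⟩)) right_mem_uIcc).symm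

/-- The winding number vanishes far away. -/
lemma winding_eq_zero_of_far {E : Multiset (Plane × Plane)} (hE : IsCycle E)
    {M : ℝ} (hM : ∀ e ∈ E, ‖e.1‖ ≤ M ∧ ‖e.2‖ ≤ M)
    {p : Plane} (hp : M < ‖p‖) : winding E p = 0 := by
  have hM' : ∀ e ∈ E, (|e.1.1| ≤ M ∧ |e.1.2| ≤ M) ∧ (|e.2.1| ≤ M ∧ |e.2.2| ≤ M) := by
    intro e he
    have := hM e he
    simpa [Prod.norm_def] using this
  have hp' : (M < p.1 ∨ p.1 < -M) ∨ (M < p.2 ∨ p.2 < -M) := by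
    rw [Prod.norm_def, lt_sup_iff] at hp
    rcases hp with h | h
    · left; rw [Real.norm_eq_abs, lt_abs] at h; rcases h with h | h <;> [left; right] <;> linarith
    · right; rw [Real.norm_eq_abs, lt_abs] at h; rcases h with h | h <;> [left; right] <;> linarith
  rcases hp' with (h | h) | (h | h)
  · refine Multiset.sum_eq_zero fun x hx => ?_
    obtain ⟨e, he, rfl⟩ := Multiset.mem_map.1 hx
    have := (abs_le.1 (hM' e he).1.1).2
    simp [rightOf, not_lt.2 (this.trans h.le)]
  · rw [← hE (above p)]
    refine congrArg _ (Multiset.map_congr rfl fun e he => ?_)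
    have := (abs_le.1 (hM' e he).1.1).1
    simp [rightOf, h.trans_le this]
  · refine Multiset.sum_eq_zero fun x hx => ?_
    obtain ⟨e, he, rfl⟩ := Multiset.mem_map.1 hx
    have h1 := (abs_le.1 (hM' e he).1.2).2
    have h2 := (abs_le.1 (hM' e he).2.2).2
    simp [above, not_lt.2 (h1.trans h.le), not_lt.2 (h2.trans h.le)]
  · refine Multiset.sum_eq_zero fun x hx => ?_
    obtain ⟨e, he, rfl⟩ := Multiset.mem_map.1 hx
    have h1 := (abs_le.1 (hM' e he).1.2).1
    have h2 := (abs_le.1 (hM' e he).2.2).1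
    simp [above, h.trans_le h1, h.trans_le h2]

/-! ### Orthogonal paths -/

/-- `a` and `b` are joined by a path in `O` that consists of axis-parallel segments. -/
def OrthoJoined (O : Set Plane) : Plane → Plane → Prop :=
  Relation.ReflTransGen fun a b => AxisParallel a b ∧ segment ℝ a b ⊆ O

lemma OrthoJoined.single {O : Set Plane} {a b : Plane} (h : AxisParallel a b)
    (h' : segment ℝ a b ⊆ O) : OrthoJoined O a b := Relation.ReflTransGen.single ⟨h, h'⟩

lemma OrthoJoined.trans {O : Set Plane} {a b c : Plane} (h : OrthoJoined O a b) (h' : OrthoJoined O b c) :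
    OrthoJoined O a c := Relation.ReflTransGen.trans h h'

lemma OrthoJoined.symm {O : Set Plane} {a b : Plane} (h : OrthoJoined O a b) : OrthoJoined O b a := by
  induction h with
  | refl => exact Relation.ReflTransGen.refl
  | tail _ h ih => exact Relation.ReflTransGen.head ⟨h.1.symm, by rw [segment_symm]; exact h.2⟩ ih

/-- A winding number does not change along an orthogonal path that avoids the curve. -/
lemma OrthoJoined.winding_eq {O : Set Plane} {E : Multiset (Plane × Plane)} (hE : IsCycle E)
    (hax : ∀ e ∈ E, AxisParallel e.1 e.2) (hO : ∀ e ∈ E, Disjoint O (segment ℝ e.1 e.2))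
    {p p' : Plane} (h : OrthoJoined O p p') : winding E p = winding E p' := by
  induction h with
  | refl => rfl
  | tail _ h ih =>
    exact ih.trans (winding_eq_of_segment hE hax h.1 fun e he => (hO e he).mono_left h.2)

/-- The segments of an orthogonal path from `a` to `b`. -/
lemma OrthoJoined.exists_edges {O : Set Plane} {a b : Plane} (h : OrthoJoined O a b) :
    ∃ E : Multiset (Plane × Plane), (∀ e ∈ E, AxisParallel e.1 e.2 ∧ segment ℝ e.1 e.2 ⊆ O) ∧
      ∀ f : Plane → ℤ, (E.map fun e => f e.2 - f e.1).sum = f b - f a := by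
  induction h with
  | refl => exact ⟨0, by simp, by simp⟩
  | @tail b c _ h ih =>
    obtain ⟨E, h1, h2⟩ := ih
    refine ⟨(b, c) ::ₘ E, ?_, fun f => ?_⟩
    · simp only [Multiset.mem_cons, forall_eq_or_imp]
      exact ⟨h, h1⟩
    · rw [Multiset.map_cons, Multiset.sum_cons, h2]; ring

end OrthoPlane

namespace OrthoPlane

/-! ### Sets that are finite unions of grid cells -/

/-- `s` and `t` lie in the same cell of the subdivision of the line by the points of `X`. -/
def SameCell (X : Finset ℝ) (s t : ℝ) : Prop := ∀ c ∈ X, (c < s ↔ c < t) ∧ (s < c ↔ t < c)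

/-- A set is tame if it is a union of cells of some finite grid of horizontal and vertical lines
(open rectangles, open segments and grid points). -/
def IsTame (A : Set Plane) : Prop :=
  ∃ X Y : Finset ℝ, ∀ p p' : Plane, SameCell X p.1 p'.1 → SameCell Y p.2 p'.2 → (p ∈ A ↔ p' ∈ A)

lemma SameCell.mono {X X' : Finset ℝ} (h : X ⊆ X') {s t : ℝ} (h' : SameCell X' s t) :
    SameCell X s t := fun c hc => h' c (h hc)

lemma SameCell.symm {X : Finset ℝ} {s t : ℝ} (h : SameCell X s t) : SameCell X t s :=
  fun c hc => ⟨(h c hc).1.symm, (h c hc).2.symm⟩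

lemma IsTame.compl {A : Set Plane} (hA : IsTame A) : IsTame Aᶜ := by
  obtain ⟨X, Y, h⟩ := hA
  exact ⟨X, Y, fun p p' h1 h2 => not_congr (h p p' h1 h2)⟩

lemma IsTame.union {A B : Set Plane} (hA : IsTame A) (hB : IsTame B) : IsTame (A ∪ B) := by
  classical
  obtain ⟨X, Y, h⟩ := hA
  obtain ⟨X', Y', h'⟩ := hB
  refine ⟨X ∪ X', Y ∪ Y', fun p p' h1 h2 => or_congr ?_ ?_⟩
  · exact h p p' (h1.mono Finset.subset_union_left) (h2.mono Finset.subset_union_left)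
  · exact h' p p' (h1.mono Finset.subset_union_right) (h2.mono Finset.subset_union_right)

lemma isTame_empty : IsTame (∅ : Set Plane) := ⟨∅, ∅, by simp⟩

lemma IsTame.diff {A B : Set Plane} (hA : IsTame A) (hB : IsTame B) : IsTame (A \ B) := by
  have := (hA.compl.union hB).compl
  rwa [compl_union, compl_compl] at this

lemma exists_gap (X : Finset ℝ) (x : ℝ) : ∃ ε > 0, ∀ c ∈ X, c ≠ x → ε ≤ |c - x| := by
  classical
  induction X using Finset.induction with
  | empty => exact ⟨1, one_pos, by simp⟩
  | insert a X _ ih =>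
    obtain ⟨ε, hε, h⟩ := ih
    by_cases hax : a = x
    · refine ⟨ε, hε, fun c hc hcx => ?_⟩
      rcases Finset.mem_insert.1 hc with rfl | hc
      · exact absurd hax hcx
      · exact h c hc hcx
    · refine ⟨min ε |a - x|, lt_min hε (abs_pos.2 (sub_ne_zero.2 hax)), fun c hc hcx => ?_⟩
      rcases Finset.mem_insert.1 hc with rfl | hc
      · exact min_le_right _ _
      · exact (min_le_left _ _).trans (h c hc hcx)

lemma sameCell_of_gap {X : Finset ℝ} {x ε s t : ℝ} (h : ∀ c ∈ X, c ≠ x → ε ≤ |c - x|)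
    (hs : |s - x| < ε) (ht : |t - x| < ε) (h1 : x < s ↔ x < t) (h2 : s < x ↔ t < x) :
    SameCell X s t := by
  intro c hc
  by_cases hcx : c = x
  · subst hcx; exact ⟨h1, h2⟩
  · have := h c hc hcx
    rw [abs_lt] at hs ht
    rcases le_abs.1 this with h | h
    · constructor <;> constructor <;> intro <;> linarith
    · constructor <;> constructor <;> intro <;> linarith

/-- On either side of a vertical line, a tame set meets all sufficiently close vertical lines at the
same heights. -/
lemma IsTame.exists_column {A : Set Plane} (hA : IsTame A) (x : ℝ) :
    ∃ ε > 0, ∀ s t y, |s - x| < ε → |t - x| < ε → (x < s ↔ x < t) → (s < x ↔ t < x) →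
      ((s, y) ∈ A ↔ (t, y) ∈ A) := by
  obtain ⟨X, Y, h⟩ := hA
  obtain ⟨ε, hε, hX⟩ := exists_gap X x
  exact ⟨ε, hε, fun s t y hs ht h1 h2 => h _ _ (sameCell_of_gap hX hs ht h1 h2)
    fun _ _ => ⟨Iff.rfl, Iff.rfl⟩⟩

/-- Near each of its points, a closed tame set is a union of axis-parallel rectangles with that
point as a corner. -/
lemma IsTame.exists_rectangle {A : Set Plane} (hA : IsTame A) (hc : IsClosed A) (z : Plane) :
    ∃ ε > 0, ∀ p ∈ A, |p.1 - z.1| < ε → |p.2 - z.2| < ε →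
      ∀ x ∈ uIcc z.1 p.1, ∀ y ∈ uIcc z.2 p.2, (x, y) ∈ A := by
  obtain ⟨X, Y, h⟩ := hA
  obtain ⟨ε₁, hε₁, hX⟩ := exists_gap X z.1
  obtain ⟨ε₂, hε₂, hY⟩ := exists_gap Y z.2
  refine ⟨min ε₁ ε₂, lt_min hε₁ hε₂, fun p hp h1 h2 x hx y hy => ?_⟩
  rw [lt_min_iff] at h1 h2
  have key : ∀ (a b c ε : ℝ), |b - a| < ε → c ∈ uIcc a b → ∀ t ∈ Ioc (0 : ℝ) 1,
      |c + t * (b - c) - a| < ε ∧ (a < b ↔ a < c + t * (b - c)) ∧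
        (b < a ↔ c + t * (b - c) < a) := by
    intro a b c ε hab hc t ht
    rcases mem_uIcc.1 hc with ⟨h1, h2⟩ | ⟨h1, h2⟩
    · have h3 : 0 ≤ t * (b - c) := mul_nonneg ht.1.le (by linarith)
      have h4 : t * (b - c) ≤ b - c := by nlinarith [ht.2]
      rw [abs_lt] at hab ⊢
      refine ⟨⟨by linarith, by linarith⟩, ⟨fun h => ?_, fun h => by linarith⟩,
        ⟨fun h => by linarith, fun h => by linarith⟩⟩
      rcases h1.lt_or_eq with h5 | h5
      · linarith
      · subst h5; have := mul_pos ht.1 (sub_pos.2 h); linarith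
    · have h3 : t * (b - c) ≤ 0 := mul_nonpos_of_nonneg_of_nonpos ht.1.le (by linarith)
      have h4 : b - c ≤ t * (b - c) := by nlinarith [ht.2]
      rw [abs_lt] at hab ⊢
      refine ⟨⟨by linarith, by linarith⟩, ⟨fun h => by linarith, fun h => by linarith⟩,
        ⟨fun h => ?_, fun h => by linarith⟩⟩
      rcases h2.lt_or_eq with h5 | h5
      · linarith
      · subst h5; have := mul_neg_of_pos_of_neg ht.1 (sub_neg.2 h); linarith
  have hmem : ∀ t ∈ Ioc (0 : ℝ) 1, (x + t * (p.1 - x), y + t * (p.2 - y)) ∈ A := by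
    intro t ht
    obtain ⟨a1, a2, a3⟩ := key z.1 p.1 x ε₁ h1.1 hx t ht
    obtain ⟨b1, b2, b3⟩ := key z.2 p.2 y ε₂ h2.2 hy t ht
    exact (h p _ (sameCell_of_gap hX h1.1 a1 a2 a3) (sameCell_of_gap hY h2.2 b1 b2 b3)).1 hp
  have hcont : Filter.Tendsto (fun t : ℝ => (x + t * (p.1 - x), y + t * (p.2 - y)))
      (nhdsWithin 0 (Ioi 0)) (nhds (x, y)) := by
    have : Continuous fun t : ℝ => ((x + t * (p.1 - x), y + t * (p.2 - y)) : Plane) := by fun_prop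
    have h0 := this.tendsto 0
    simp only [zero_mul, add_zero] at h0
    exact h0.mono_left nhdsWithin_le_nhds
  refine hc.mem_of_tendsto hcont ?_
  filter_upwards [Ioc_mem_nhdsGT (zero_lt_one' ℝ)] with t ht using hmem t ht

/-! ### The geometric properties of a simple orthogonal polygon -/

/-- The properties of a simple orthogonal polygon `R` and its set `V` of reflex vertices on which
the correctness of the sweeps rests. They are invariant under the symmetries of the coordinate
axes. -/
structure IsRegion (R V : Set Plane) : Prop where
  isClosed : IsClosed R
  isTame : IsTame R
  bounded : ∃ M, ∀ p ∈ R, ‖p‖ ≤ M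
  /-- `R` has no holes. -/
  exterior : ∀ o ∉ R, ∀ M, ∃ o', M < ‖o'‖ ∧ OrthoJoined Rᶜ o o'
  /-- Where an open quadrant is locally outside `R`, but both its sides are in `R`, there is a reflex
  vertex. -/
  reflex : ∀ (z : Plane) (s t : ℝ), s = 1 ∨ s = -1 → t = 1 ∨ t = -1 → ∀ δ > 0,
    (∀ a ∈ Icc 0 δ, (z.1, z.2 + t * a) ∈ R) → (∀ a ∈ Icc 0 δ, (z.1 + s * a, z.2) ∈ R) →
    (∀ a ∈ Ioc 0 δ, ∀ b ∈ Ioc 0 δ, (z.1 + s * a, z.2 + t * b) ∉ R) → z ∈ V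

/-- The points `p` vertically above or below `q` such that the segment `pq` is contained in `R`. -/
def verticalSight (R : Set Plane) (q : Plane) : Set Plane :=
  {p | p.1 = q.1 ∧ ∀ y ∈ uIcc p.2 q.2, (q.1, y) ∈ R}

variable {R V : Set Plane}

/-- A closed curve in `R` does not wind around points outside `R`. -/
lemma IsRegion.winding_eq_zero (hR : IsRegion R V) {E : Multiset (Plane × Plane)} (hE : IsCycle E)
    (hER : ∀ e ∈ E, AxisParallel e.1 e.2 ∧ segment ℝ e.1 e.2 ⊆ R) {o : Plane} (ho : o ∉ R) :
    winding E o = 0 := by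
  obtain ⟨M, hM⟩ := hR.bounded
  obtain ⟨o', ho', hJ⟩ := hR.exterior o ho M
  rw [hJ.winding_eq hE (fun e he => (hER e he).1) fun e he =>
    disjoint_compl_left.mono_right (hER e he).2]
  exact winding_eq_zero_of_far hE (fun e he =>
    ⟨hM _ ((hER e he).2 (left_mem_segment ℝ _ _)), hM _ ((hER e he).2 (right_mem_segment ℝ _ _))⟩) ho'

/-- Just above the top of the component of `h` in a bounded closed set of reals, there is a point
outside the set. -/
lemma exists_beyond {A : Set ℝ} (hA : IsClosed A) (hb : BddAbove A)
    (hloc : ∀ T, ∃ ε > 0, ∀ y ∈ A, |y - T| < ε → uIcc T y ⊆ A) {h : ℝ} (hh : h ∈ A) :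
    ∃ t, h < t ∧ t ∉ A ∧ ∀ y ∈ Icc h t, y ∈ A → Icc h y ⊆ A := by
  set B := {y | h ≤ y ∧ Icc h y ⊆ A} with hB
  have hBA : B ⊆ A := fun y hy => hy.2 (right_mem_Icc.2 hy.1)
  have hhB : h ∈ B := ⟨le_rfl, by simpa using hh⟩
  have hbB : BddAbove B := hb.mono hBA
  have hT : sSup B ∈ A := hA.closure_subset_iff.2 hBA (csSup_mem_closure ⟨h, hhB⟩ hbB)
  have hTB : sSup B ∈ B := by
    refine ⟨le_csSup hbB hhB, fun y hy => ?_⟩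
    rcases hy.2.lt_or_eq with h1 | h1
    · obtain ⟨b, hb, hyb⟩ := exists_lt_of_lt_csSup ⟨h, hhB⟩ h1
      exact hb.2 ⟨hy.1, hyb.le⟩
    · rwa [h1]
  obtain ⟨ε, hε, hεA⟩ := hloc (sSup B)
  have hout : ∀ y, sSup B < y → y < sSup B + ε → y ∉ A := by
    intro y h1 h2 hy
    have h3 := hεA y hy (abs_lt.2 ⟨by linarith, by linarith⟩)
    rw [uIcc_of_le h1.le] at h3
    have : y ∈ B := by
      refine ⟨hTB.1.trans h1.le, fun w hw => ?_⟩
      rcases le_total w (sSup B) with h4 | h4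
      · exact hTB.2 ⟨hw.1, h4⟩
      · exact h3 ⟨h4, hw.2⟩
    exact h1.not_ge (le_csSup hbB this)
  refine ⟨sSup B + ε / 2, by linarith [hTB.1], hout _ (by linarith) (by linarith), fun y hy hyA => ?_⟩
  have h1 : y ≤ sSup B := by
    by_contra h1
    exact hout y (not_le.1 h1) (by linarith [hy.2]) hyA
  exact fun w hw => hTB.2 ⟨hw.1, hw.2.trans h1⟩

lemma IsRegion.exists_above (hR : IsRegion R V) {c h : ℝ} (hq : (c, h) ∈ R) :
    ∃ t, (c, t) ∉ R ∧ (∀ y, (c, y) ∈ verticalSight R (c, h) → y < t) ∧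
      ∀ y, h ≤ y → y ≤ t → (c, y) ∈ R → (c, y) ∈ verticalSight R (c, h) := by
  obtain ⟨M, hM⟩ := hR.bounded
  obtain ⟨t, ht, htA, ht'⟩ := exists_beyond (A := {y | (c, y) ∈ R}) (h := h)
    (hR.isClosed.preimage (by fun_prop))
    ⟨M, fun y hy => (le_abs_self y).trans ((norm_snd_le (c, y)).trans (hM _ hy))⟩
    (fun T => by
      obtain ⟨ε, hε, h⟩ := hR.isTame.exists_rectangle hR.isClosed (c, T)
      exact ⟨ε, hε, fun y hy hyT w hw => h (c, y) hy (by simpa using hε) hyT c (by simp) w hw⟩) hq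
  refine ⟨t, htA, fun y hy => ?_, fun y h1 h2 hy => ⟨rfl, fun w hw => ?_⟩⟩
  · by_contra hty
    have hty := not_lt.1 hty
    exact htA (hy.2 t (mem_uIcc.2 (Or.inr ⟨ht.le, hty⟩)))
  · rw [uIcc_of_ge h1] at hw
    exact ht' y ⟨h1, h2⟩ hy hw

lemma IsRegion.exists_below (hR : IsRegion R V) {c h : ℝ} (hq : (c, h) ∈ R) :
    ∃ t, (c, t) ∉ R ∧ (∀ y, (c, y) ∈ verticalSight R (c, h) → t < y) ∧
      ∀ y, t ≤ y → y ≤ h → (c, y) ∈ R → (c, y) ∈ verticalSight R (c, h) := by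
  obtain ⟨M, hM⟩ := hR.bounded
  obtain ⟨t, ht, htA, ht'⟩ := exists_beyond (A := {y | (c, -y) ∈ R}) (h := -h)
    (hR.isClosed.preimage (by fun_prop))
    ⟨M, fun y hy => (neg_le_abs (-y)).trans' (by simp) |>.trans
      ((norm_snd_le (c, -y)).trans (hM _ hy))⟩
    (fun T => by
      obtain ⟨ε, hε, h⟩ := hR.isTame.exists_rectangle hR.isClosed (c, -T)
      refine ⟨ε, hε, fun y hy hyT w hw => h (c, -y) hy (by simpa using hε) ?_ c (by simp) (-w) ?_⟩
      · simpa [abs_sub_comm, neg_add_eq_sub] using hyT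
      · rw [mem_uIcc] at hw ⊢
        rcases hw with hw | hw
        · right; constructor <;> simp only <;> linarith
        · left; constructor <;> simp only <;> linarith) (by simpa using hq)
  refine ⟨-t, htA, fun y hy => ?_, fun y h1 h2 hy => ⟨rfl, fun w hw => ?_⟩⟩
  · by_contra hty
    have hty := not_lt.1 hty
    exact htA (hy.2 (-t) (mem_uIcc.2 (Or.inl ⟨hty, by simp only; linarith⟩)))
  · rw [uIcc_of_le h2] at hw
    have := ht' (-y) ⟨by linarith, by linarith⟩ (by simpa using hy) (a := -w)
      ⟨by linarith [hw.2], by linarith [hw.1]⟩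
    simpa using this

/-- Let `c` be the abscissa of a robot on a horizontal track at height `h`, and let the segment from
`(x', z)` to `(c, z)` end on its line of sight. If `(x', z)` is connected to a track position to the
right of `c` by a path that avoids the line of sight, then `x'` is to the right as well, and
`(x', z)` is visible from the track if `x'` is close to `c`.

The path is closed up to a cycle in `R` along the track, the line of sight, and the segment. Its
winding number vanishes at all points outside `R`, and on the vertical line through `c` it changes
only where the track and the segment arrive at the line of sight. -/
lemma IsRegion.chord (hR : IsRegion R V) {c h x' z xp : ℝ} (hxp : c < xp)
    (htrack : ∀ x ∈ Icc c xp, (x, h) ∈ R) (hz : (c, z) ∈ verticalSight R (c, h))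
    (hx' : ∀ x ∈ uIcc c x', (x, z) ∈ R)
    (hJ : OrthoJoined (R \ verticalSight R (c, h)) (x', z) (xp, h)) :
    c < x' ∧ ((∀ x ∈ Ioc c x', ∀ y, (x, y) ∈ R → (x', y) ∈ R) → (x', h) ∈ R →
      ∀ y ∈ uIcc z h, (x', y) ∈ R) := by
  obtain ⟨L, hL, hL'⟩ := hJ.exists_edges
  set E : Multiset (Plane × Plane) :=
    L + {((xp, h), (c, h)), ((c, h), (c, z)), ((c, z), (x', z))} with hE
  have hcyc : IsCycle E := fun f => by
    simp only [hE, Multiset.map_add, Multiset.sum_add, hL', Multiset.insert_eq_cons,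
      Multiset.map_cons, Multiset.map_singleton, Multiset.sum_cons, Multiset.sum_singleton]
    ring
  have hER : ∀ e ∈ E, AxisParallel e.1 e.2 ∧ segment ℝ e.1 e.2 ⊆ R := by
    intro e he
    simp only [hE, Multiset.mem_add, Multiset.insert_eq_cons, Multiset.mem_cons,
      Multiset.mem_singleton] at he
    rcases he with he | rfl | rfl | rfl
    · exact ⟨(hL e he).1, (hL e he).2.trans sdiff_subset⟩
    · have hax : AxisParallel (xp, h) (c, h) := Or.inr rfl
      refine ⟨hax, fun p hp => ?_⟩
      rw [hax.mem_segment_iff, uIcc_of_ge hxp.le, uIcc_self] at hp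
      have := htrack p.1 hp.1
      rwa [← (show p.2 = h from hp.2)] at this
    · have hax : AxisParallel (c, h) (c, z) := Or.inl rfl
      refine ⟨hax, fun p hp => ?_⟩
      rw [hax.mem_segment_iff, uIcc_self, uIcc_comm] at hp
      have := hz.2 p.2 hp.2
      rwa [← (show p.1 = c from hp.1)] at this
    · have hax : AxisParallel (c, z) (x', z) := Or.inr rfl
      refine ⟨hax, fun p hp => ?_⟩
      rw [hax.mem_segment_iff, uIcc_self] at hp
      have := hx' p.1 hp.1
      rwa [← (show p.2 = z from hp.2)] at this
  have hax : ∀ e ∈ E, AxisParallel e.1 e.2 := fun e he => (hER e he).1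
  have hq : (c, h) ∈ R := htrack c ⟨le_rfl, hxp.le⟩
  have hqs : (c, h) ∈ verticalSight R (c, h) := ⟨rfl, by simpa using hq⟩
  obtain ⟨t, htR, ht, ht'⟩ := hR.exists_above hq
  obtain ⟨b, hbR, hb, hb'⟩ := hR.exists_below hq
  have key : ∀ lo, lo ≤ t → b ≤ lo → winding E (c, t) - winding E (c, lo) =
      -(if lo < h then 1 else 0) + (if lo < z then 1 else 0) * (if c < x' then 1 else 0) := by
    intro lo hlo hblo
    rw [winding_sub_of_fst_eq hcyc hax (p := (c, lo)) (p' := (c, t)) rfl, hE, Multiset.map_add,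
      Multiset.sum_add, Multiset.sum_eq_zero (s := Multiset.map _ L), zero_add]
    · simp only [Multiset.insert_eq_cons, Multiset.map_cons, Multiset.map_singleton,
        Multiset.sum_cons, Multiset.sum_singleton, above, rightOf, lt_irrefl, hxp, if_true,
        if_false, not_lt.2 (ht h hqs).le, not_lt.2 (ht z hz).le]
      ring
    · intro x hx
      obtain ⟨e, he, rfl⟩ := Multiset.mem_map.1 hx
      refine vertical_term_eq_zero (hL e he).1 hlo fun y hy hy' hye => ?_
      have h1 := (hL e he).2 hye
      rcases le_total h y with h2 | h2
      · exact h1.2 (ht' y h2 hy' h1.1)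
      · exact h1.2 (hb' y (hblo.trans (le_of_lt hy)) h2 h1.1)
  have hbh := hb h hqs
  have hth := ht h hqs
  have htz := ht z hz
  have hbz := hb z hz
  have ht0 : winding E (c, t) = 0 := hR.winding_eq_zero hcyc hER htR
  have hb0 : winding E (c, b) = 0 := hR.winding_eq_zero hcyc hER hbR
  have hx0 : c < x' := by
    by_contra hc
    have := key b (by linarith) le_rfl
    rw [ht0, hb0] at this
    simp [hbh, hc] at this
  refine ⟨hx0, fun hcol hx'h y hy => ?_⟩
  by_contra hyR
  have hyz : y ≠ z := by
    rintro rfl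
    exact hyR (hx' x' right_mem_uIcc)
  have hyh : y ≠ h := by
    rintro rfl
    exact hyR hx'h
  have hy0 : winding E (c, y) = 0 := by
    rw [winding_eq_of_horizontal hax (p := (c, y)) (p' := (x', y)) rfl hx0.le]
    · exact hR.winding_eq_zero hcyc hER hyR
    · intro e he x hx hx1 hxe
      exact hyR (hcol x ⟨hx, hx1⟩ y ((hER e he).2 hxe))
  rcases mem_uIcc.1 hy with ⟨h1, h2⟩ | ⟨h1, h2⟩
  · have := key y (by linarith) (by linarith)
    have h3 : y < h := lt_of_le_of_ne h2 hyh
    rw [ht0, hy0] at this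
    simp [hx0, not_lt.2 h1, h3] at this
  · have := key y (by linarith) (by linarith)
    have h3 : y < z := lt_of_le_of_ne h2 hyz
    rw [ht0, hy0] at this
    simp [hx0, not_lt.2 h1, h3] at this

end OrthoPlane

namespace OrthoPlane

/-! ### Separated subsets of a region -/

/-- Near `z`, either all or no points of `R` belong to `D`. If this holds for all `z ∈ R \ F`, then
`D` is a union of connected components of `R \ F`, up to points of `F`. -/
def Separated (R D : Set Plane) (z : Plane) : Prop :=
  (∀ᶠ p in nhdsWithin z R, p ∈ D) ∨ ∀ᶠ p in nhdsWithin z R, p ∉ D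

variable {R V : Set Plane}

lemma Separated.eventually_iff {D : Set Plane} {z : Plane} (h : Separated R D z) (hz : z ∈ R) :
    ∀ᶠ p in nhdsWithin z R, (p ∈ D ↔ z ∈ D) := by
  rcases h with h | h
  · have := h.self_of_nhdsWithin hz
    filter_upwards [h] with p hp using ⟨fun _ => this, fun _ => hp⟩
  · have := h.self_of_nhdsWithin hz
    filter_upwards [h] with p hp using ⟨fun h => absurd h hp, fun h => absurd h this⟩

lemma Separated.diff {D D' : Set Plane} {z : Plane} (h : Separated R D z) (h' : Separated R D' z) :
    Separated R (D \ D') z := by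
  rcases h with h | h
  · rcases h' with h' | h'
    · right; filter_upwards [h'] with p hp using fun h => h.2 hp
    · left; filter_upwards [h, h'] with p hp hp' using ⟨hp, hp'⟩
  · right; filter_upwards [h] with p hp using fun h => hp h.1

lemma separated_of_isClosed {F : Set Plane} (hF : IsClosed F) {z : Plane} (hz : z ∉ F) :
    Separated R F z :=
  Or.inr (nhdsWithin_le_nhds (hF.isOpen_compl.mem_nhds hz))

lemma Separated.diff_isClosed {D F : Set Plane} {z : Plane} (h : Separated R D z)
    (hF : IsClosed F) (hz : z ∉ F) : Separated R (D \ F) z := h.diff (separated_of_isClosed hF hz)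

/-- A connected set that avoids the points where `D` is not separated is contained in `D` or
disjoint from it. -/
lemma mem_iff_mem_of_isPreconnected {C D : Set Plane} (hC : IsPreconnected C) (hCR : C ⊆ R)
    (h : ∀ z ∈ C, Separated R D z) {x y : Plane} (hx : x ∈ C) (hy : y ∈ C) : x ∈ D ↔ y ∈ D :=
  hC.induction₂ (fun x y => x ∈ D ↔ y ∈ D)
    (fun z hz => nhdsWithin_mono z hCR (((h z hz).eventually_iff (hCR hz)).mono fun _ h => h.symm))
    (fun _ _ _ _ _ _ h h' => h.trans h') (fun _ _ _ _ h => h.symm) hx hy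

/-- Near `z`, the rectangles with corner `z` spanned by points of the region are contained in the
region, and in any given neighbourhood. -/
lemma IsRegion.eventually_rectangle (hR : IsRegion R V) {U : Set Plane} {z : Plane}
    (hU : U ∈ nhds z) : ∀ᶠ p in nhdsWithin z R,
      ∀ x ∈ uIcc z.1 p.1, ∀ y ∈ uIcc z.2 p.2, (x, y) ∈ R ∧ (x, y) ∈ U := by
  obtain ⟨ε, hε, h⟩ := hR.isTame.exists_rectangle hR.isClosed z
  obtain ⟨ε', hε', hU⟩ := Metric.mem_nhds_iff.1 hU
  have hb : Metric.ball z (min ε ε') ∈ nhds z := Metric.ball_mem_nhds z (lt_min hε hε')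
  filter_upwards [nhdsWithin_le_nhds hb, self_mem_nhdsWithin] with p hp hpR x hx y hy
  rw [Metric.mem_ball, Prod.dist_eq, max_lt_iff, lt_min_iff, lt_min_iff, Real.dist_eq,
    Real.dist_eq] at hp
  refine ⟨h p hpR hp.1.1 hp.2.1 x hx y hy, hU ?_⟩
  rw [Metric.mem_ball, Prod.dist_eq, max_lt_iff, Real.dist_eq, Real.dist_eq]
  exact ⟨(abs_sub_left_of_mem_uIcc hx).trans_lt hp.1.2,
    (abs_sub_left_of_mem_uIcc hy).trans_lt hp.2.2⟩

/-- Points of a connected subset of `R` minus a closed set are joined by orthogonal paths. -/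
lemma IsRegion.joined_of_isPreconnected (hR : IsRegion R V) {F C : Set Plane} (hF : IsClosed F)
    (hC : IsPreconnected C) (hCF : C ⊆ R \ F) {a b : Plane} (ha : a ∈ C) (hb : b ∈ C) :
    OrthoJoined (R \ F) a b := by
  refine hC.induction₂ (OrthoJoined (R \ F)) (fun z hz => ?_) (fun _ _ _ _ _ _ h h' => h.trans h')
    (fun _ _ _ _ h => h.symm) ha hb
  have := hR.eventually_rectangle (hF.isOpen_compl.mem_nhds (hCF hz).2)
  filter_upwards [nhdsWithin_mono z (hCF.trans sdiff_subset) this] with p hp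
  have h1 : AxisParallel z (p.1, z.2) := Or.inr rfl
  have h2 : AxisParallel (p.1, z.2) p := Or.inl rfl
  refine (OrthoJoined.single h1 fun w hw => ?_).trans (OrthoJoined.single h2 fun w hw => ?_)
  · rw [h1.mem_segment_iff, uIcc_self] at hw
    have := hp w.1 hw.1 w.2 (by rw [hw.2]; exact left_mem_uIcc)
    exact this
  · rw [h2.mem_segment_iff, uIcc_self] at hw
    have := hp w.1 (by rw [hw.1]; exact right_mem_uIcc) w.2 hw.2
    exact this

/-- If `D` is a neighbourhood of `z` in a region, so is the component of `z` in `D`. -/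
lemma IsRegion.eventually_mem_connectedComponentIn (hR : IsRegion R V) {D : Set Plane} {z : Plane}
    (h : ∀ᶠ p in nhdsWithin z R, p ∈ D) :
    ∀ᶠ p in nhdsWithin z R, p ∈ connectedComponentIn D z := by
  obtain ⟨U, hU, hUD⟩ := mem_nhdsWithin_iff_exists_mem_nhds_inter.1 h
  filter_upwards [hR.eventually_rectangle hU] with p hp
  refine (convex_segment z p).isPreconnected.subset_connectedComponentIn (left_mem_segment ℝ z p)
    (fun w hw => ?_) (right_mem_segment ℝ z p)
  have h1 : w.1 ∈ uIcc z.1 p.1 := by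
    rw [← segment_eq_uIcc]; exact (Prod.segment_subset (𝕜 := ℝ) z p hw).1
  have h2 : w.2 ∈ uIcc z.2 p.2 := by
    rw [← segment_eq_uIcc]; exact (Prod.segment_subset (𝕜 := ℝ) z p hw).2
  exact hUD (hp w.1 h1 w.2 h2).symm

/-- The components of a separated set are separated. -/
lemma IsRegion.separated_connectedComponentIn (hR : IsRegion R V) {D : Set Plane} {x z : Plane}
    (hz : z ∈ R) (h : Separated R D z) : Separated R (connectedComponentIn D x) z := by
  rcases h with h | h
  · have h' := hR.eventually_mem_connectedComponentIn h
    by_cases hxz : z ∈ connectedComponentIn D x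
    · left
      rwa [← connectedComponentIn_eq hxz] at h'
    · right
      filter_upwards [h'] with p hp hpx
      rw [connectedComponentIn_eq hpx, ← connectedComponentIn_eq hp] at hxz
      exact hxz (mem_connectedComponentIn (h.self_of_nhdsWithin hz))
  · right
    filter_upwards [h] with p hp hpx using hp (connectedComponentIn_subset _ _ hpx)

/-- A set that is separated off a tame set has finitely many components. -/
lemma finite_components {F D : Set Plane} (hR : IsTame R) (hF : IsTame F) (hD : D ⊆ R \ F)
    (h : ∀ z ∈ R \ F, Separated R D z) :
    {K | ∃ x ∈ D, K = connectedComponentIn D x}.Finite := by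
  classical
  obtain ⟨X, Y, hXY⟩ := hR.diff hF
  let key : Plane → (X.powerset × X.powerset) × (Y.powerset × Y.powerset) := fun p =>
    ((⟨X.filter (· < p.1), by simp⟩, ⟨X.filter (p.1 < ·), by simp⟩),
      (⟨Y.filter (· < p.2), by simp⟩, ⟨Y.filter (p.2 < ·), by simp⟩))
  have hkey : ∀ p ∈ D, ∀ p' ∈ D, key p = key p' →
      connectedComponentIn D p = connectedComponentIn D p' := by
    intro p hp p' hp' hpp
    simp only [key, Prod.mk.injEq, Subtype.mk.injEq] at hpp
    have hX : SameCell X p.1 p'.1 := fun c hc =>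
      ⟨by simpa [hc] using Finset.ext_iff.1 hpp.1.1 c, by simpa [hc] using Finset.ext_iff.1 hpp.1.2 c⟩
    have hY : SameCell Y p.2 p'.2 := fun c hc =>
      ⟨by simpa [hc] using Finset.ext_iff.1 hpp.2.1 c, by simpa [hc] using Finset.ext_iff.1 hpp.2.2 c⟩
    have hcell : ∀ (Z : Finset ℝ) (s t w : ℝ), SameCell Z s t → w ∈ uIcc s t → SameCell Z s w := by
      intro Z s t w hst hw c hc
      have := hst c hc
      rcases mem_uIcc.1 hw with ⟨h1, h2⟩ | ⟨h1, h2⟩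
      · exact ⟨⟨fun h => h.trans_le h1, fun h => this.1.2 (h.trans_le h2)⟩,
          ⟨fun h => h2.trans_lt (this.2.1 h), fun h => h1.trans_lt h⟩⟩
      · exact ⟨⟨fun h => (this.1.1 h).trans_le h1, fun h => h.trans_le h2⟩,
          ⟨fun h => h2.trans_lt h, fun h => this.2.2 (h1.trans_lt h)⟩⟩
    have hseg : segment ℝ p p' ⊆ R \ F := by
      intro w hw
      have h1 : w.1 ∈ uIcc p.1 p'.1 := by
        rw [← segment_eq_uIcc]; exact (Prod.segment_subset (𝕜 := ℝ) p p' hw).1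
      have h2 : w.2 ∈ uIcc p.2 p'.2 := by
        rw [← segment_eq_uIcc]; exact (Prod.segment_subset (𝕜 := ℝ) p p' hw).2
      exact (hXY p w (hcell X _ _ _ hX h1) (hcell Y _ _ _ hY h2)).1 (hD hp)
    have hpre := (convex_segment (𝕜 := ℝ) p p').isPreconnected
    have hsD : segment ℝ p p' ⊆ D := fun w hw =>
      (mem_iff_mem_of_isPreconnected hpre (hseg.trans sdiff_subset)
        (fun z hz => h z (hseg hz)) (left_mem_segment ℝ p p') hw).1 hp
    exact connectedComponentIn_eq
      (hpre.subset_connectedComponentIn (left_mem_segment ℝ p p') hsD (right_mem_segment ℝ p p'))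
  let rep : (X.powerset × X.powerset) × (Y.powerset × Y.powerset) → Set Plane := fun k =>
    if hk : ∃ p ∈ D, key p = k then connectedComponentIn D hk.choose else ∅
  refine (Set.finite_range rep).subset ?_
  rintro K ⟨x, hx, rfl⟩
  refine ⟨key x, ?_⟩
  have hk : ∃ p ∈ D, key p = key x := ⟨x, hx, rfl⟩
  simp only [rep, dif_pos hk]
  exact hkey _ hk.choose_spec.1 _ hx hk.choose_spec.2

/-! ### Sweeping along a horizontal track -/

/-- The points that are visible from the point of the horizontal line at height `h` that is
vertically above or below them. -/
def lineSight (R : Set Plane) (h : ℝ) : Set Plane := {p | ∀ y ∈ uIcc p.2 h, (p.1, y) ∈ R}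

lemma isClosed_lineSight (hR : IsClosed R) (h : ℝ) : IsClosed (lineSight R h) := by
  have : lineSight R h = ⋂ t ∈ Icc (0 : ℝ) 1, {p : Plane | (p.1, AffineMap.lineMap p.2 h t) ∈ R} := by
    ext p
    simp only [lineSight, mem_ofPred_eq, mem_iInter]
    rw [← segment_eq_uIcc, segment_eq_image_lineMap, forall_mem_image]
  rw [this]
  refine isClosed_biInter fun t _ => hR.preimage ?_
  simp only [AffineMap.lineMap_apply]
  fun_prop

lemma mem_verticalSight_iff {p : Plane} {c h : ℝ} :
    p ∈ verticalSight R (c, h) ↔ p.1 = c ∧ p ∈ lineSight R h := by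
  constructor
  · rintro ⟨h1, h2⟩
    exact ⟨h1, fun y hy => by rw [show p.1 = c from h1]; exact h2 y hy⟩
  · rintro ⟨h1, h2⟩
    exact ⟨h1, fun y hy => by have := h2 y hy; rwa [show p.1 = c from h1] at this⟩

lemma isClosed_verticalSight (hR : IsClosed R) (c h : ℝ) : IsClosed (verticalSight R (c, h)) := by
  have : verticalSight R (c, h) = {p | p.1 = c} ∩ lineSight R h := by
    ext p; exact mem_verticalSight_iff
  rw [this]
  exact (isClosed_eq continuous_fst continuous_const).inter (isClosed_lineSight hR h)

/-- The part of the plane that is swept by a robot moving from abscissa `c` to `r` along a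
horizontal track at height `h`. -/
def sweep (R : Set Plane) (h c r : ℝ) : Set Plane := {p | c ≤ p.1 ∧ p.1 ≤ r ∧ p ∈ lineSight R h}

lemma isClosed_sweep (hR : IsClosed R) (h c r : ℝ) : IsClosed (sweep R h c r) :=
  (isClosed_le continuous_const continuous_fst).inter
    ((isClosed_le continuous_fst continuous_const).inter (isClosed_lineSight hR h))

lemma exists_gap_bottom {A : Set ℝ} (hA : IsClosed A) {lo o : ℝ} (hlo : lo ∈ A) (h : lo ≤ o)
    (ho : o ∉ A) : ∃ u ∈ A, lo ≤ u ∧ u < o ∧ ∀ y, u < y → y ≤ o → y ∉ A := by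
  have hne : (A ∩ Icc lo o).Nonempty := ⟨lo, hlo, le_rfl, h⟩
  have hb : BddAbove (A ∩ Icc lo o) := bddAbove_Icc.mono inter_subset_right
  have hmem := (hA.inter isClosed_Icc).csSup_mem hne hb
  refine ⟨_, hmem.1, hmem.2.1, lt_of_le_of_ne hmem.2.2 fun h => ho (h ▸ hmem.1),
    fun y hy hyo hyA => ?_⟩
  exact hy.not_ge (le_csSup hb ⟨hyA, hmem.2.1.trans hy.le, hyo⟩)

/-- While no reflex vertex comes into sight, the swept part grows continuously: a point seen from
the interior of the move is an interior point of the swept part, relative to `R`. A gap between the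
track and nearby points would begin at a reflex vertex in sight. -/
lemma IsRegion.eventually_mem_lineSight (hR : IsRegion R V) {h : ℝ} {z : Plane}
    (hz : z ∈ lineSight R h) (htrack : ∀ᶠ x in nhds z.1, (x, h) ∈ R)
    (hV : ∀ v ∈ V, v.1 = z.1 → v ∉ lineSight R h) :
    ∀ᶠ p in nhdsWithin z R, p ∈ lineSight R h := by
  obtain ⟨ε, hε, hcol⟩ := hR.isTame.exists_column z.1
  have hcont : Filter.Tendsto (fun p : Plane => p.1) (nhds z) (nhds z.1) :=
    continuous_fst.tendsto z
  have hball : ∀ᶠ x in nhds z.1, |x - z.1| < ε := by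
    have := Metric.ball_mem_nhds z.1 hε
    filter_upwards [this] with x hx using by rwa [Metric.mem_ball, Real.dist_eq] at hx
  filter_upwards [hR.eventually_rectangle Filter.univ_mem, nhdsWithin_le_nhds (hcont htrack),
    nhdsWithin_le_nhds (hcont hball)] with p hp hpt hpε
  have hchord : ∀ y ∈ uIcc p.2 h, (z.1, y) ∈ R := by
    intro y hy
    rcases uIcc_subset_uIcc_union_uIcc (b := z.2) hy with h1 | h1
    · exact (hp z.1 left_mem_uIcc y (by rwa [uIcc_comm])).1
    · exact hz y h1
  have hpR : (p.1, p.2) ∈ R := (hp p.1 right_mem_uIcc p.2 right_mem_uIcc).1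
  have htR : (p.1, h) ∈ R := hpt
  by_contra hcon
  obtain ⟨o, ho, hoR⟩ : ∃ o ∈ uIcc p.2 h, (p.1, o) ∉ R := by
    simpa [lineSight] using hcon
  have hne : p.1 ≠ z.1 := by
    intro heq
    rw [heq] at hoR
    exact hoR (hchord o ho)
  have hcl : IsClosed {y | (p.1, y) ∈ R} := hR.isClosed.preimage (by fun_prop)
  obtain ⟨u, huA, hlu, huo, hgap⟩ := exists_gap_bottom hcl (lo := p.2 ⊓ h)
    (by rcases min_choice p.2 h with h1 | h1 <;> simp only [mem_ofPred_eq, h1] <;> assumption)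
    ho.1 hoR
  obtain ⟨s, hs, hsd⟩ : ∃ s : ℝ, (s = 1 ∨ s = -1) ∧ p.1 - z.1 = s * |p.1 - z.1| := by
    rcases le_total 0 (p.1 - z.1) with h1 | h1
    · exact ⟨1, Or.inl rfl, by rw [abs_of_nonneg h1, one_mul]⟩
    · exact ⟨-1, Or.inr rfl, by rw [abs_of_nonpos h1]; ring⟩
  have hd : 0 < |p.1 - z.1| := abs_pos.2 (sub_ne_zero.2 hne)
  have hcol' : ∀ a ∈ Ioc 0 |p.1 - z.1|, ∀ y, (z.1 + s * a, y) ∈ R ↔ (p.1, y) ∈ R := by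
    intro a ha y
    have hp1 : p.1 = z.1 + s * |p.1 - z.1| := by linarith
    refine hcol _ _ y ?_ hpε ?_ ?_
    · rcases hs with rfl | rfl
      · rw [one_mul, add_sub_cancel_left, abs_of_pos ha.1]; exact ha.2.trans_lt hpε
      · rw [neg_one_mul, add_sub_cancel_left, abs_neg, abs_of_pos ha.1]; exact ha.2.trans_lt hpε
    · rw [hp1] at hd ⊢
      rcases hs with rfl | rfl <;> constructor <;> intro <;> linarith [ha.1, ha.2]
    · rw [hp1] at hd ⊢
      rcases hs with rfl | rfl <;> constructor <;> intro <;> linarith [ha.1, ha.2]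
  have hsub : ∀ y, u ≤ y → y ≤ o → y ∈ uIcc p.2 h := fun y h1 h2 =>
    ⟨hlu.trans h1, h2.trans ho.2⟩
  refine hV (z.1, u) (hR.reflex (z.1, u) s 1 hs (Or.inl rfl) (min |p.1 - z.1| (o - u))
    (lt_min hd (sub_pos.2 huo)) ?_ ?_ ?_) rfl ?_
  · intro a ha
    have h1 := ha.2.trans (min_le_right _ _)
    exact hchord _ (hsub _ (by simp only; linarith [ha.1]) (by simp only; linarith))
  · intro a ha
    rcases ha.1.eq_or_lt with h1 | h1
    · rw [← h1, mul_zero, add_zero]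
      exact hchord _ (hsub _ le_rfl huo.le)
    · exact (hcol' a ⟨h1, ha.2.trans (min_le_left _ _)⟩ u).2 huA
  · intro a ha b hb hmem
    have h1 := hb.2.trans (min_le_right _ _)
    rw [one_mul] at hmem
    exact hgap (u + b) (by linarith [hb.1]) (by linarith)
      ((hcol' a ⟨ha.1, ha.2.trans (min_le_left _ _)⟩ _).1 hmem)
  · exact fun y hy => hchord y (uIcc_subset_uIcc (hsub u le_rfl huo.le) right_mem_uIcc hy)

/-- A robot moves to the right from abscissa `c` to `r` along a horizontal track at height `h` that
ends at `g`. If every component of what it still has to clear has a point that is visible from the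
rest of the track, and no reflex vertex comes into sight on the way, then what remains is bounded
by the new line of sight, and by the set `B` that also bounded it before. -/
theorem IsRegion.separated_diff_sweep (hR : IsRegion R V) {B D : Set Plane} {c r g h : ℝ}
    (hcr : c < r) (hrg : r ≤ g) (htrack : ∀ x ∈ Icc c g, (x, h) ∈ R) (hDR : D ⊆ R)
    (hDc : ∀ p ∈ D, p ∉ verticalSight R (c, h))
    (hsep : ∀ z ∈ R, z ∉ B → z ∉ verticalSight R (c, h) → Separated R D z)
    (hcomp : ∀ z ∈ D, ∃ p ∈ connectedComponentIn D z, c < p.1 ∧ p.1 ≤ g ∧ p ∈ lineSight R h)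
    (hV : ∀ v ∈ V, c < v.1 → v.1 < r → v ∉ lineSight R h) {z : Plane} (hzR : z ∈ R) (hzB : z ∉ B)
    (hz : z ∉ verticalSight R (r, h)) : Separated R (D \ sweep R h c r) z := by
  by_cases hzF : z ∈ sweep R h c r
  swap
  · refine (hsep z hzR hzB fun hzc => hzF ?_).diff_isClosed (isClosed_sweep hR.isClosed h c r) hzF
    have := mem_verticalSight_iff.1 hzc
    exact ⟨this.1.ge, this.1.le.trans hcr.le, this.2⟩
  obtain ⟨hcz, hzr, hzl⟩ := hzF
  have hzr : z.1 < r := lt_of_le_of_ne hzr fun h => hz (mem_verticalSight_iff.2 ⟨h, hzl⟩)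
  have hcont : Filter.Tendsto (fun p : Plane => p.1) (nhds z) (nhds z.1) :=
    continuous_fst.tendsto z
  right
  -- A point on the old line of sight needs `IsRegion.chord`; one seen later in the move does not.
  rcases hcz.eq_or_lt with hcz | hcz
  · obtain ⟨ε, hε, hcol⟩ := hR.isTame.exists_column c
    have hball : ∀ᶠ x in nhds z.1, |x - c| < ε := by
      rw [← hcz]
      have := Metric.ball_mem_nhds c hε
      filter_upwards [this] with x hx using by rwa [Metric.mem_ball, Real.dist_eq] at hx
    filter_upwards [hR.eventually_rectangle Filter.univ_mem, self_mem_nhdsWithin,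
      nhdsWithin_le_nhds (hcont hball), nhdsWithin_le_nhds (hcont (gt_mem_nhds hzr))]
      with p hp hpR hpε hpr
    rintro ⟨hpD, hpF⟩
    have hpc : (c, p.2) ∈ verticalSight R (c, h) := by
      refine ⟨rfl, fun y hy => ?_⟩
      simp only at hy ⊢
      rw [hcz]
      rcases uIcc_subset_uIcc_union_uIcc (b := z.2) hy with h1 | h1
      · exact (hp z.1 left_mem_uIcc y (by rwa [uIcc_comm])).1
      · exact hzl y h1
    have hne : p.1 ≠ c := by
      rintro rfl
      exact hDc p hpD hpc
    obtain ⟨p', hp', hcp', hpg', hpl'⟩ := hcomp p hpD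
    have hDF : D ⊆ R \ verticalSight R (c, h) := fun w hw => ⟨hDR hw, hDc w hw⟩
    have hJ : OrthoJoined (R \ verticalSight R (c, h)) p p' :=
      hR.joined_of_isPreconnected (isClosed_verticalSight hR.isClosed c h)
        isPreconnected_connectedComponentIn ((connectedComponentIn_subset D p).trans hDF)
        (mem_connectedComponentIn hpD) hp'
    have hax : AxisParallel p' (p'.1, h) := Or.inl rfl
    have hJ' : OrthoJoined (R \ verticalSight R (c, h)) p (p'.1, h) := by
      refine hJ.trans (OrthoJoined.single hax fun w hw => ?_)
      rw [hax.mem_segment_iff, uIcc_self] at hw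
      obtain ⟨w1, w2⟩ := w
      obtain ⟨rfl, hw2⟩ : w1 = p'.1 ∧ _ := hw
      exact ⟨hpl' w2 hw2, fun hws => hcp'.ne' hws.1⟩
    obtain ⟨hcp, hsee⟩ := hR.chord (x' := p.1) (z := p.2) hcp'
      (fun x hx => htrack x ⟨hx.1, hx.2.trans hpg'⟩) hpc
      (fun x hx => (hp x (by rwa [← hcz]) p.2 right_mem_uIcc).1) hJ'
    refine hpF ⟨hcp.le, hpr.le, hsee (fun x hx y hy => ?_) (htrack _ ⟨hcp.le, hpr.le.trans hrg⟩)⟩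
    refine (hcol x p.1 y ?_ hpε ?_ ?_).1 hy
    · refine lt_of_le_of_lt ?_ hpε
      rw [abs_of_pos (sub_pos.2 hx.1), abs_of_pos (sub_pos.2 hcp)]
      linarith [hx.2]
    · exact ⟨fun _ => hcp, fun _ => hx.1⟩
    · exact ⟨fun h => absurd h hx.1.not_gt, fun h => absurd h hcp.not_gt⟩
  · have htr : ∀ᶠ x in nhds z.1, (x, h) ∈ R := by
      filter_upwards [Ioo_mem_nhds hcz hzr] with x hx using
        htrack x ⟨hx.1.le, hx.2.le.trans hrg⟩
    filter_upwards [hR.eventually_mem_lineSight hzl htr fun v hv h1 =>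
        hV v hv (by rwa [h1]) (by rwa [h1]), nhdsWithin_le_nhds (hcont (Ioo_mem_nhds hcz hzr))]
      with p hp hp' hpD
    exact hpD.2 ⟨hp'.1.le, hp'.2.le, hp⟩

end OrthoPlane

namespace SimpleOrthogonalPolygon

open OrthoPlane

variable {n : ℕ} [NeZero n] (P : SimpleOrthogonalPolygon n)

/-! ### The boundary of a simple orthogonal polygon -/

/-- The boundary as a cycle of directed segments. -/
def edges : Multiset (Plane × Plane) :=
  Finset.univ.val.map fun k => (P.vertex k, P.vertex (k + 1))

lemma axisParallel (k : Fin n) : AxisParallel (P.vertex k) (P.vertex (k + 1)) :=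
  (P.orthogonal k).elim (fun h => Or.inr h.1) fun h => Or.inl h.1

lemma mem_edge_iff {k : Fin n} {p : Plane} : p ∈ P.edge k ↔
    p.1 ∈ uIcc (P.vertex k).1 (P.vertex (k + 1)).1 ∧
      p.2 ∈ uIcc (P.vertex k).2 (P.vertex (k + 1)).2 :=
  (P.axisParallel k).mem_segment_iff

lemma mem_boundary_iff {p : Plane} : p ∈ P.boundary ↔ ∃ k, p ∈ P.edge k := by
  simp [boundary]

lemma forall_mem_edges {q : Plane × Plane → Prop} :
    (∀ e ∈ P.edges, q e) ↔ ∀ k, q (P.vertex k, P.vertex (k + 1)) := by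
  simp [edges]

lemma axisParallel_edges : ∀ e ∈ P.edges, AxisParallel e.1 e.2 :=
  P.forall_mem_edges.2 P.axisParallel

lemma sum_edges (f : Plane × Plane → ℤ) :
    (P.edges.map f).sum = ∑ k, f (P.vertex k, P.vertex (k + 1)) := by
  rw [edges, Multiset.map_map]; rfl

lemma sum_vertex_succ {M : Type*} [AddCommMonoid M] (f : Plane → M) :
    ∑ k, f (P.vertex (k + 1)) = ∑ k, f (P.vertex k) :=
  Equiv.sum_comp (Equiv.addRight (1 : Fin n)) fun k => f (P.vertex k)

lemma isCycle_edges : IsCycle P.edges := fun f => by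
  rw [sum_edges, Finset.sum_sub_distrib, sub_eq_zero]
  exact P.sum_vertex_succ f

/-- The winding number of the boundary. -/
noncomputable def wind (p : Plane) : ℤ := winding P.edges p

lemma wind_eq_sum (p : Plane) : P.wind p =
    ∑ k, rightOf p (P.vertex k) * (above p (P.vertex (k + 1)) - above p (P.vertex k)) :=
  P.sum_edges _

lemma odd_ncard_crossings_iff (p : Plane) : Odd (P.crossings p).ncard ↔ Odd (P.wind p) := by
  classical
  have h1 : ((P.crossings p).ncard : ℤ) = ∑ k, if k ∈ P.crossings p then 1 else 0 := by
    rw [Set.ncard_eq_toFinset_card', Finset.sum_boole]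
    congr 2
    ext k; simp
  have h2 : Even (P.wind p - (P.crossings p).ncard) := by
    rw [h1, wind_eq_sum, ← Finset.sum_sub_distrib]
    refine Finset.even_sum _ fun k _ => ?_
    have hk : k ∈ P.crossings p ↔ p.1 < (P.vertex k).1 ∧
      min (P.vertex k).2 (P.vertex (k + 1)).2 ≤ p.2 ∧
      p.2 < max (P.vertex k).2 (P.vertex (k + 1)).2 := Iff.rfl
    simp only [hk, min_le_iff, lt_max_iff, rightOf, above]
    rcases lt_or_ge p.1 (P.vertex k).1 with h1 | h1 <;>
    rcases lt_or_ge p.2 (P.vertex k).2 with h2 | h2 <;>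
    rcases lt_or_ge p.2 (P.vertex (k + 1)).2 with h3 | h3 <;>
    simp [h1, h2, h3, not_lt.2, not_le.2]
  rw [Int.even_sub'] at h2
  rw [h2, Int.odd_coe_nat]

lemma mem_region_iff {p : Plane} : p ∈ P.region ↔ p ∈ P.boundary ∨ Odd (P.wind p) := by
  rw [← odd_ncard_crossings_iff]; rfl

lemma vertical_or_horizontal (k : Fin n) :
    ((P.vertex k).1 = (P.vertex (k + 1)).1 ∧ (P.vertex k).2 ≠ (P.vertex (k + 1)).2) ∨
      ((P.vertex k).2 = (P.vertex (k + 1)).2 ∧ (P.vertex k).1 ≠ (P.vertex (k + 1)).1) := by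
  rcases P.axisParallel k with h | h
  · exact Or.inl ⟨h, fun h' => P.vertex_ne k (Prod.ext h h')⟩
  · exact Or.inr ⟨h, fun h' => P.vertex_ne k (Prod.ext h' h)⟩

lemma eq_of_mem_edge {k l : Fin n} {z : Plane} (hk : z ∈ P.edge k) (h1 : z ≠ P.vertex k)
    (h2 : z ≠ P.vertex (k + 1)) (hl : z ∈ P.edge l) : l = k := by
  rcases P.simple k l z hk hl with h | ⟨rfl, h⟩ | ⟨rfl, h⟩
  · exact h.symm
  · exact absurd h h2
  · exact absurd h h1

lemma eq_or_eq_of_vertex_mem_edge {k l : Fin n} (hl : P.vertex (k + 1) ∈ P.edge l) :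
    l = k ∨ l = k + 1 := by
  rcases P.simple (k + 1) l _ (left_mem_segment ℝ _ _) hl with h | ⟨rfl, h⟩ | ⟨h, -⟩
  · exact Or.inr h.symm
  · exact absurd h (P.vertex_ne _)
  · exact Or.inl (add_right_cancel h).symm

/-- `p` is closer to `z` than all vertices, in both coordinates, except those with the same
coordinate as `z`. -/
def Near (z p : Plane) : Prop :=
  ∀ k, ((P.vertex k).1 ≠ z.1 → |p.1 - z.1| < |(P.vertex k).1 - z.1|) ∧
    ((P.vertex k).2 ≠ z.2 → |p.2 - z.2| < |(P.vertex k).2 - z.2|)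

variable {P}

lemma Near.mem_edge {z p : Plane} (h : P.Near z p) {k : Fin n} (hp : p ∈ P.edge k) :
    z ∈ P.edge k := by
  have key : ∀ a b p z : ℝ, (a ≠ z → |p - z| < |a - z|) → (b ≠ z → |p - z| < |b - z|) →
      p ∈ uIcc a b → z ∈ uIcc a b := by
    intro a b p z ha hb hp
    by_cases haz : a = z
    · subst haz; exact left_mem_uIcc
    by_cases hbz : b = z
    · subst hbz; exact right_mem_uIcc
    have ha := ha haz
    have hb := hb hbz
    rw [mem_uIcc] at hp ⊢
    rcases abs_cases (p - z) with h1 | h1 <;> rcases abs_cases (a - z) with h2 | h2 <;>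
      rcases abs_cases (b - z) with h3 | h3 <;> rcases hp with hp | hp <;>
      first
        | (left; constructor <;> linarith)
        | (right; constructor <;> linarith)
  rw [mem_edge_iff] at hp ⊢
  exact ⟨key _ _ _ _ (h k).1 (h (k + 1)).1 hp.1, key _ _ _ _ (h k).2 (h (k + 1)).2 hp.2⟩

lemma Near.notMem_boundary {z p : Plane} (h : P.Near z p) (hz : z ∉ P.boundary) :
    p ∉ P.boundary := by
  rw [mem_boundary_iff] at *
  exact fun ⟨k, hk⟩ => hz ⟨k, h.mem_edge hk⟩

lemma Near.mono {z p p' : Plane} (h : P.Near z p) (h1 : |p'.1 - z.1| ≤ |p.1 - z.1|)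
    (h2 : |p'.2 - z.2| ≤ |p.2 - z.2|) : P.Near z p' := fun k =>
  ⟨fun hk => h1.trans_lt ((h k).1 hk), fun hk => h2.trans_lt ((h k).2 hk)⟩

lemma Near.fst_ne {z p : Plane} (h : P.Near z p) (hp : p.1 ≠ z.1) (k : Fin n) :
    (P.vertex k).1 ≠ p.1 := fun hk => by
  have := (h k).1 (by rwa [hk])
  rw [hk] at this
  exact lt_irrefl _ this

lemma Near.snd_ne {z p : Plane} (h : P.Near z p) (hp : p.2 ≠ z.2) (k : Fin n) :
    (P.vertex k).2 ≠ p.2 := fun hk => by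
  have := (h k).2 (by rwa [hk])
  rw [hk] at this
  exact lt_irrefl _ this

lemma eventually_near (z : Plane) : ∀ᶠ p in nhds z, P.Near z p := by
  refine Filter.eventually_all.2 fun k => Filter.Eventually.and ?_ ?_
  · by_cases h : (P.vertex k).1 = z.1
    · simp [h]
    · have hc : Continuous fun p : Plane => |p.1 - z.1| := by fun_prop
      have : Filter.Tendsto (fun p : Plane => |p.1 - z.1|) (nhds z) (nhds 0) := by
        simpa using hc.tendsto z
      filter_upwards [this (gt_mem_nhds (abs_pos.2 (sub_ne_zero.2 h)))] with p hp _ using hp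
  · by_cases h : (P.vertex k).2 = z.2
    · simp [h]
    · have hc : Continuous fun p : Plane => |p.2 - z.2| := by fun_prop
      have : Filter.Tendsto (fun p : Plane => |p.2 - z.2|) (nhds z) (nhds 0) := by
        simpa using hc.tendsto z
      filter_upwards [this (gt_mem_nhds (abs_pos.2 (sub_ne_zero.2 h)))] with p hp _ using hp

lemma exists_near (z : Plane) : ∃ ε > 0, ∀ a b : ℝ, |a| ≤ ε → |b| ≤ ε →
    P.Near z (z.1 + a, z.2 + b) := by
  obtain ⟨ε, hε, h⟩ := Metric.eventually_nhds_iff.1 (P.eventually_near z)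
  refine ⟨ε / 2, by linarith, fun a b ha hb => h ?_⟩
  rw [Prod.dist_eq, max_lt_iff, Real.dist_eq, Real.dist_eq]
  simp only [add_sub_cancel_left]
  constructor <;> linarith

/-- The winding number is constant near points off the boundary. -/
lemma Near.wind_eq {z p : Plane} (h : P.Near z p) (hz : z ∉ P.boundary) :
    P.wind p = P.wind z := by
  have h1 : AxisParallel z (p.1, z.2) := Or.inr rfl
  have h2 : AxisParallel (p.1, z.2) p := Or.inl rfl
  have key : ∀ w : Plane, w.1 ∈ uIcc z.1 p.1 → w.2 ∈ uIcc z.2 p.2 → w ∉ P.boundary :=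
    fun w hw1 hw2 => (h.mono (abs_sub_left_of_mem_uIcc hw1)
      (abs_sub_left_of_mem_uIcc hw2)).notMem_boundary hz
  have h3 : P.wind z = P.wind (p.1, z.2) := by
    refine winding_eq_of_segment P.isCycle_edges P.axisParallel_edges h1
      (P.forall_mem_edges.2 fun k => Set.disjoint_left.2 fun w hw hwk => ?_)
    rw [h1.mem_segment_iff, uIcc_self] at hw
    exact key w hw.1 (by rw [show w.2 = z.2 from hw.2]; exact left_mem_uIcc)
      (P.mem_boundary_iff.2 ⟨k, hwk⟩)
  have h4 : P.wind (p.1, z.2) = P.wind p := by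
    refine winding_eq_of_segment P.isCycle_edges P.axisParallel_edges h2
      (P.forall_mem_edges.2 fun k => Set.disjoint_left.2 fun w hw hwk => ?_)
    rw [h2.mem_segment_iff, uIcc_self] at hw
    exact key w (by rw [show w.1 = p.1 from hw.1]; exact right_mem_uIcc) hw.2
      (P.mem_boundary_iff.2 ⟨k, hwk⟩)
  rw [h3, h4]

lemma isOpen_compl_region : IsOpen P.regionᶜ := by
  rw [isOpen_iff_mem_nhds]
  intro z hz
  rw [mem_compl_iff, mem_region_iff, not_or] at hz
  filter_upwards [P.eventually_near z] with p hp
  rw [mem_compl_iff, mem_region_iff, not_or, hp.wind_eq hz.1]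
  exact ⟨hp.notMem_boundary hz.1, hz.2⟩

lemma isTame_region : IsTame P.region := by
  refine ⟨Finset.univ.image fun k => (P.vertex k).1, Finset.univ.image fun k => (P.vertex k).2,
    fun p p' h1 h2 => ?_⟩
  have h1 : ∀ k, ((P.vertex k).1 < p.1 ↔ (P.vertex k).1 < p'.1) ∧
      (p.1 < (P.vertex k).1 ↔ p'.1 < (P.vertex k).1) := fun k => h1 _ (by simp)
  have h2 : ∀ k, ((P.vertex k).2 < p.2 ↔ (P.vertex k).2 < p'.2) ∧
      (p.2 < (P.vertex k).2 ↔ p'.2 < (P.vertex k).2) := fun k => h2 _ (by simp)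
  have hw : P.wind p = P.wind p' := by
    simp only [wind_eq_sum, rightOf, above, h1, h2]
  have hb : p ∈ P.boundary ↔ p' ∈ P.boundary := by
    simp only [mem_boundary_iff, mem_edge_iff, mem_uIcc]
    simp only [← not_lt, h1, h2]
  rw [mem_region_iff, mem_region_iff, hw, hb]

lemma bounded_region : ∃ M, ∀ p ∈ P.region, ‖p‖ ≤ M := by
  obtain ⟨M, hM⟩ : ∃ M, ∀ k, ‖P.vertex k‖ ≤ M := by
    obtain ⟨M, hM⟩ := (Set.finite_range fun k => ‖P.vertex k‖).bddAbove
    exact ⟨M, fun k => hM ⟨k, rfl⟩⟩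
  refine ⟨M, fun p hp => ?_⟩
  rw [mem_region_iff, mem_boundary_iff] at hp
  rcases hp with ⟨k, hk⟩ | hp
  · have hball : Convex ℝ (Metric.closedBall (0 : Plane) M) := convex_closedBall _ _
    simpa using hball.segment_subset (x := P.vertex k) (y := P.vertex (k + 1))
      (by simpa using hM k) (by simpa using hM (k + 1)) hk
  · by_contra hcon
    have h0 : P.wind p = 0 := winding_eq_zero_of_far P.isCycle_edges
      (P.forall_mem_edges.2 fun k => ⟨hM k, hM (k + 1)⟩) (not_le.1 hcon)
    rw [h0] at hp
    exact absurd hp (by decide)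

/-- Crossing an edge from its right to its left side increases the winding number by one: the case
of a vertical edge. -/
lemma wind_sub_wind_of_vertical {k : Fin n} {z : Plane} (hz : z ∈ P.edge k)
    (hv : (P.vertex k).1 = (P.vertex (k + 1)).1) (h1 : (P.vertex k).2 ≠ z.2)
    (h2 : (P.vertex (k + 1)).2 ≠ z.2) {x x' : ℝ} (hx : x < z.1) (hx' : z.1 < x')
    (hn : P.Near z (x, z.2)) (hn' : P.Near z (x', z.2)) :
    P.wind (x, z.2) - P.wind (x', z.2) =
      if (P.vertex k).2 < (P.vertex (k + 1)).2 then 1 else -1 := by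
  have hzk : (P.vertex k).1 = z.1 ∧ (P.vertex (k + 1)).1 = z.1 := by
    have := (P.mem_edge_iff.1 hz).1
    rw [← hv, uIcc_self] at this
    exact ⟨(show z.1 = _ from this).symm, hv ▸ (show z.1 = _ from this).symm⟩
  rw [wind_eq_sum, wind_eq_sum, ← Finset.sum_sub_distrib, Finset.sum_eq_single k]
  · have h3 := (P.mem_edge_iff.1 hz).2
    simp only [rightOf, above, hzk.1, hx, if_true, not_lt.2 hx'.le, if_false]
    rcases mem_uIcc.1 h3 with ⟨h4, h5⟩ | ⟨h4, h5⟩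
    · have h6 := lt_of_le_of_ne h4 h1
      have h7 := lt_of_le_of_ne h5 h2.symm
      simp [h6.not_gt, h7, h6.trans h7]
    · have h6 := lt_of_le_of_ne h4 h2
      have h7 := lt_of_le_of_ne h5 h1.symm
      simp [h6.not_gt, h7, (h6.trans h7).not_gt]
  · intro l _ hl
    rw [sub_eq_zero]
    refine horizontal_term_eq (P.axisParallel l) rfl (hx.trans hx').le fun w hw hw' hwl => hl ?_
    refine P.eq_of_mem_edge hz (fun h => h1 (by rw [h])) (fun h => h2 (by rw [h])) ?_
    have : P.Near z (w, z.2) := by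
      rcases le_total w z.1 with h | h
      · refine hn.mono ?_ le_rfl
        simp only at *
        rw [abs_of_nonpos (by linarith), abs_of_nonpos (by linarith)]; linarith
      · refine hn'.mono ?_ le_rfl
        simp only at *
        rw [abs_of_nonneg (by linarith), abs_of_nonneg (by linarith)]; linarith
    exact this.mem_edge hwl
  · simp

/-- Crossing an edge from its right to its left side increases the winding number by one: the case
of a horizontal edge. -/
lemma wind_sub_wind_of_horizontal {k : Fin n} {z : Plane} (hz : z ∈ P.edge k)
    (hv : (P.vertex k).2 = (P.vertex (k + 1)).2) (h1 : (P.vertex k).1 ≠ z.1)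
    (h2 : (P.vertex (k + 1)).1 ≠ z.1) {y y' : ℝ} (hy : y < z.2) (hy' : z.2 < y')
    (hn : P.Near z (z.1, y)) (hn' : P.Near z (z.1, y')) :
    P.wind (z.1, y') - P.wind (z.1, y) =
      if (P.vertex k).1 < (P.vertex (k + 1)).1 then 1 else -1 := by
  have hzk : (P.vertex k).2 = z.2 ∧ (P.vertex (k + 1)).2 = z.2 := by
    have := (P.mem_edge_iff.1 hz).2
    rw [← hv, uIcc_self] at this
    exact ⟨(show z.2 = _ from this).symm, hv ▸ (show z.2 = _ from this).symm⟩
  rw [wind, wind, winding_sub_of_fst_eq P.isCycle_edges P.axisParallel_edges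
    (p := (z.1, y)) (p' := (z.1, y')) rfl, sum_edges, Finset.sum_eq_single k]
  · have h3 := (P.mem_edge_iff.1 hz).1
    simp only [rightOf, above, hzk.1, hy, if_true, not_lt.2 hy'.le, if_false]
    rcases mem_uIcc.1 h3 with ⟨h4, h5⟩ | ⟨h4, h5⟩
    · have h6 := lt_of_le_of_ne h4 h1
      have h7 := lt_of_le_of_ne h5 h2.symm
      simp [h6.not_gt, h7, h6.trans h7]
    · have h6 := lt_of_le_of_ne h4 h2
      have h7 := lt_of_le_of_ne h5 h1.symm
      simp [h6.not_gt, h7, (h6.trans h7).not_gt]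
  · intro l _ hl
    refine vertical_term_eq_zero (P.axisParallel l) (hy.trans hy').le fun w hw hw' hwl => hl ?_
    refine P.eq_of_mem_edge hz (fun h => h1 (by rw [h])) (fun h => h2 (by rw [h])) ?_
    have : P.Near z (z.1, w) := by
      rcases le_total w z.2 with h | h
      · refine hn.mono le_rfl ?_
        simp only at *
        rw [abs_of_nonpos (by linarith), abs_of_nonpos (by linarith)]; linarith
      · refine hn'.mono le_rfl ?_
        simp only at *
        rw [abs_of_nonneg (by linarith), abs_of_nonneg (by linarith)]; linarith
    exact this.mem_edge hwl
  · simp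

end SimpleOrthogonalPolygon

namespace SimpleOrthogonalPolygon

open OrthoPlane

variable {n : ℕ} [NeZero n] {P : SimpleOrthogonalPolygon n}

/-! ### Walking along the boundary -/

/-- `ε` is smaller than all differences of distinct coordinates of vertices. -/
def IsGap (P : SimpleOrthogonalPolygon n) (ε : ℝ) : Prop :=
  0 < ε ∧ ∀ k l : Fin n,
    ((P.vertex k).1 ≠ (P.vertex l).1 → ε < |(P.vertex k).1 - (P.vertex l).1|) ∧
      ((P.vertex k).2 ≠ (P.vertex l).2 → ε < |(P.vertex k).2 - (P.vertex l).2|)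

variable (P) in
lemma exists_isGap : ∃ ε, P.IsGap ε := by
  classical
  obtain ⟨ε₁, h1, h1'⟩ := exists_gap (Finset.univ.image fun x : Fin n × Fin n =>
    (P.vertex x.1).1 - (P.vertex x.2).1) 0
  obtain ⟨ε₂, h2, h2'⟩ := exists_gap (Finset.univ.image fun x : Fin n × Fin n =>
    (P.vertex x.1).2 - (P.vertex x.2).2) 0
  refine ⟨min ε₁ ε₂ / 2, half_pos (lt_min h1 h2), fun k l => ⟨fun h => ?_, fun h => ?_⟩⟩
  · have := h1' ((P.vertex k).1 - (P.vertex l).1)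
      (Finset.mem_image.2 ⟨(k, l), Finset.mem_univ _, rfl⟩) (sub_ne_zero.2 h)
    rw [sub_zero] at this
    linarith [min_le_left ε₁ ε₂]
  · have := h2' ((P.vertex k).2 - (P.vertex l).2)
      (Finset.mem_image.2 ⟨(k, l), Finset.mem_univ _, rfl⟩) (sub_ne_zero.2 h)
    rw [sub_zero] at this
    linarith [min_le_right ε₁ ε₂]

lemma IsGap.near_vertex {ε : ℝ} (hε : P.IsGap ε) {k : Fin n} {p : Plane}
    (h1 : |p.1 - (P.vertex k).1| ≤ ε) (h2 : |p.2 - (P.vertex k).2| ≤ ε) :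
    P.Near (P.vertex k) p := fun l =>
  ⟨fun h => h1.trans_lt ((hε.2 l k).1 h), fun h => h2.trans_lt ((hε.2 l k).2 h)⟩

lemma IsGap.near_of_vertical {ε : ℝ} (hε : P.IsGap ε) {k : Fin n} {x y : ℝ}
    (h1 : |x - (P.vertex k).1| ≤ ε) : P.Near ((P.vertex k).1, y) (x, y) := fun l =>
  ⟨fun h => h1.trans_lt ((hε.2 l k).1 h), fun h => by simpa using abs_pos.2 (sub_ne_zero.2 h)⟩

lemma IsGap.near_of_horizontal {ε : ℝ} (hε : P.IsGap ε) {k : Fin n} {x y : ℝ}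
    (h1 : |y - (P.vertex k).2| ≤ ε) : P.Near (x, (P.vertex k).2) (x, y) := fun l =>
  ⟨fun h => by simpa using abs_pos.2 (sub_ne_zero.2 h), fun h => h1.trans_lt ((hε.2 l k).2 h)⟩

/-- The strips along a vertical edge contain no boundary points. -/
lemma IsGap.notMem_boundary_of_vertical {ε : ℝ} (hε : P.IsGap ε) {k : Fin n}
    (hv : (P.vertex k).1 = (P.vertex (k + 1)).1) {x y : ℝ} (hx : |x - (P.vertex k).1| ≤ ε)
    (hx0 : x ≠ (P.vertex k).1) (hy : y ∈ uIcc (P.vertex k).2 (P.vertex (k + 1)).2)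
    (h1 : y ≠ (P.vertex k).2) (h2 : y ≠ (P.vertex (k + 1)).2) : (x, y) ∉ P.boundary := by
  rw [mem_boundary_iff]
  rintro ⟨l, hl⟩
  have hz : ((P.vertex k).1, y) ∈ P.edge k := P.mem_edge_iff.2 ⟨left_mem_uIcc, hy⟩
  have := P.eq_of_mem_edge hz (fun h => h1 (by rw [← h])) (fun h => h2 (by rw [← h]))
    ((hε.near_of_vertical hx).mem_edge hl)
  subst this
  have := (P.mem_edge_iff.1 hl).1
  rw [← hv, uIcc_self] at this
  exact hx0 this

/-- The strips along a horizontal edge contain no boundary points. -/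
lemma IsGap.notMem_boundary_of_horizontal {ε : ℝ} (hε : P.IsGap ε) {k : Fin n}
    (hv : (P.vertex k).2 = (P.vertex (k + 1)).2) {x y : ℝ} (hx : |y - (P.vertex k).2| ≤ ε)
    (hx0 : y ≠ (P.vertex k).2) (hy : x ∈ uIcc (P.vertex k).1 (P.vertex (k + 1)).1)
    (h1 : x ≠ (P.vertex k).1) (h2 : x ≠ (P.vertex (k + 1)).1) : (x, y) ∉ P.boundary := by
  rw [mem_boundary_iff]
  rintro ⟨l, hl⟩
  have hz : (x, (P.vertex k).2) ∈ P.edge k := P.mem_edge_iff.2 ⟨hy, left_mem_uIcc⟩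
  have := P.eq_of_mem_edge hz (fun h => h1 (by rw [← h])) (fun h => h2 (by rw [← h]))
    ((hε.near_of_horizontal hx).mem_edge hl)
  subst this
  have := (P.mem_edge_iff.1 hl).2
  rw [← hv, uIcc_self] at this
  exact hx0 this

/-- The point at distance `ε` to the right of the edge `k` near its start. -/
noncomputable def cornerStart (P : SimpleOrthogonalPolygon n) (ε : ℝ) (k : Fin n) : Plane :=
  let dx := Real.sign ((P.vertex (k + 1)).1 - (P.vertex k).1)
  let dy := Real.sign ((P.vertex (k + 1)).2 - (P.vertex k).2)
  ((P.vertex k).1 + ε * (dx + dy), (P.vertex k).2 + ε * (dy - dx))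

/-- The point at distance `ε` to the right of the edge `k` near its end. -/
noncomputable def cornerEnd (P : SimpleOrthogonalPolygon n) (ε : ℝ) (k : Fin n) : Plane :=
  let dx := Real.sign ((P.vertex (k + 1)).1 - (P.vertex k).1)
  let dy := Real.sign ((P.vertex (k + 1)).2 - (P.vertex k).2)
  ((P.vertex (k + 1)).1 + ε * (dy - dx), (P.vertex (k + 1)).2 - ε * (dx + dy))

variable (P) in
lemma sign_cases (k : Fin n) :
    ((P.vertex k).1 = (P.vertex (k + 1)).1 ∧
      Real.sign ((P.vertex (k + 1)).1 - (P.vertex k).1) = 0 ∧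
      (((P.vertex k).2 < (P.vertex (k + 1)).2 ∧
          Real.sign ((P.vertex (k + 1)).2 - (P.vertex k).2) = 1) ∨
        ((P.vertex (k + 1)).2 < (P.vertex k).2 ∧
          Real.sign ((P.vertex (k + 1)).2 - (P.vertex k).2) = -1))) ∨
    ((P.vertex k).2 = (P.vertex (k + 1)).2 ∧
      Real.sign ((P.vertex (k + 1)).2 - (P.vertex k).2) = 0 ∧
      (((P.vertex k).1 < (P.vertex (k + 1)).1 ∧
          Real.sign ((P.vertex (k + 1)).1 - (P.vertex k).1) = 1) ∨
        ((P.vertex (k + 1)).1 < (P.vertex k).1 ∧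
          Real.sign ((P.vertex (k + 1)).1 - (P.vertex k).1) = -1))) := by
  rcases P.vertical_or_horizontal k with ⟨h, h'⟩ | ⟨h, h'⟩
  · refine Or.inl ⟨h, by rw [h, sub_self, Real.sign_zero], ?_⟩
    rcases h'.lt_or_gt with h' | h'
    · exact Or.inl ⟨h', Real.sign_of_pos (sub_pos.2 h')⟩
    · exact Or.inr ⟨h', Real.sign_of_neg (sub_neg.2 h')⟩
  · refine Or.inr ⟨h, by rw [h, sub_self, Real.sign_zero], ?_⟩
    rcases h'.lt_or_gt with h' | h'
    · exact Or.inl ⟨h', Real.sign_of_pos (sub_pos.2 h')⟩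
    · exact Or.inr ⟨h', Real.sign_of_neg (sub_neg.2 h')⟩

/-- Two points in the strip on one side of a vertical edge are joined off the boundary. -/
lemma IsGap.joined_of_vertical {ε : ℝ} (hε : P.IsGap ε) {k : Fin n}
    (hv : (P.vertex k).1 = (P.vertex (k + 1)).1) {x x' y y' : ℝ} (hx : |x - (P.vertex k).1| ≤ ε)
    (hx' : |x' - (P.vertex k).1| ≤ ε) (hxx : (x - (P.vertex k).1) * (x' - (P.vertex k).1) > 0)
    (hy : y ∈ uIcc (P.vertex k).2 (P.vertex (k + 1)).2)
    (h1 : y ≠ (P.vertex k).2) (h2 : y ≠ (P.vertex (k + 1)).2)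
    (hy' : y' ∈ uIcc (P.vertex k).2 (P.vertex (k + 1)).2)
    (h1' : y' ≠ (P.vertex k).2) (h2' : y' ≠ (P.vertex (k + 1)).2) :
    OrthoJoined P.boundaryᶜ (x, y) (x', y') := by
  have ha : AxisParallel (x, y) (x', y) := Or.inr rfl
  have hb : AxisParallel (x', y) (x', y') := Or.inl rfl
  refine (OrthoJoined.single ha fun w hw => ?_).trans (OrthoJoined.single hb fun w hw => ?_)
  · rw [ha.mem_segment_iff, uIcc_self] at hw
    obtain ⟨w1, w2⟩ := w
    obtain ⟨hw1, rfl⟩ : w1 ∈ uIcc x x' ∧ w2 = y := hw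
    rw [abs_le] at hx hx'
    have hne : w1 ≠ (P.vertex k).1 := by
      rintro rfl
      rcases mem_uIcc.1 hw1 with hw1 | hw1 <;> nlinarith
    refine hε.notMem_boundary_of_vertical hv (abs_le.2 ?_) hne hy h1 h2
    rcases mem_uIcc.1 hw1 with hw1 | hw1 <;> constructor <;> linarith
  · rw [hb.mem_segment_iff, uIcc_self] at hw
    obtain ⟨w1, w2⟩ := w
    obtain ⟨rfl, hw2⟩ : w1 = x' ∧ w2 ∈ uIcc y y' := hw
    have hne : w1 ≠ (P.vertex k).1 := by
      rintro rfl
      simp at hxx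
    refine hε.notMem_boundary_of_vertical hv hx' hne (uIcc_subset_uIcc hy hy' hw2) ?_ ?_
    · rintro rfl
      rcases mem_uIcc.1 hw2 with hw2 | hw2 <;> rcases mem_uIcc.1 hy with hy | hy <;>
        rcases mem_uIcc.1 hy' with hy' | hy' <;> first
        | exact h1 (by linarith)
        | exact h1' (by linarith)
    · rintro rfl
      rcases mem_uIcc.1 hw2 with hw2 | hw2 <;> rcases mem_uIcc.1 hy with hy | hy <;>
        rcases mem_uIcc.1 hy' with hy' | hy' <;> first
        | exact h2 (by linarith)
        | exact h2' (by linarith)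

lemma IsGap.joined_cornerEnd {ε : ℝ} (hε : P.IsGap ε) (k : Fin n) :
    OrthoJoined P.boundaryᶜ (P.cornerStart ε k) (P.cornerEnd ε k) := by
  have hε0 := hε.1
  rcases P.sign_cases k with ⟨hv, hs, hd⟩ | ⟨hv, hs, hd⟩
  · simp only [cornerStart, cornerEnd, hs]
    have hg := (hε.2 (k + 1) k).2
    rcases hd with ⟨hlt, hs'⟩ | ⟨hlt, hs'⟩ <;> rw [hs']
    · rw [abs_of_pos (by linarith)] at hg
      have hg := hg hlt.ne'
      refine hε.joined_of_vertical hv ?_ ?_ ?_ ?_ ?_ ?_ ?_ ?_ ?_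
      · rw [add_sub_cancel_left, abs_of_pos (by linarith)]; linarith
      · rw [hv, add_sub_cancel_left, abs_of_pos (by linarith)]; linarith
      · rw [hv]; nlinarith
      · exact mem_uIcc.2 (Or.inl ⟨by linarith, by linarith⟩)
      · exact ne_of_gt (by linarith)
      · exact ne_of_lt (by linarith)
      · exact mem_uIcc.2 (Or.inl ⟨by linarith, by linarith⟩)
      · exact ne_of_gt (by linarith)
      · exact ne_of_lt (by linarith)
    · rw [abs_of_neg (by linarith)] at hg
      have hg := hg hlt.ne
      refine hε.joined_of_vertical hv ?_ ?_ ?_ ?_ ?_ ?_ ?_ ?_ ?_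
      · rw [add_sub_cancel_left, abs_of_neg (by linarith)]; linarith
      · rw [hv, add_sub_cancel_left, abs_of_neg (by linarith)]; linarith
      · rw [hv]; nlinarith
      · exact mem_uIcc.2 (Or.inr ⟨by linarith, by linarith⟩)
      · exact ne_of_lt (by linarith)
      · exact ne_of_gt (by linarith)
      · exact mem_uIcc.2 (Or.inr ⟨by linarith, by linarith⟩)
      · exact ne_of_lt (by linarith)
      · exact ne_of_gt (by linarith)
  · simp only [cornerStart, cornerEnd, hs]
    have hg := (hε.2 (k + 1) k).1
    have hax : ∀ s : ℝ, AxisParallel ((P.vertex k).1 + ε * (s + 0), (P.vertex k).2 + ε * (0 - s))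
        ((P.vertex (k + 1)).1 + ε * (0 - s), (P.vertex (k + 1)).2 - ε * (s + 0)) := fun s =>
      Or.inr (by simp only [hv]; ring)
    refine OrthoJoined.single (hax _) fun w hw => ?_
    rw [(hax _).mem_segment_iff, ← hv] at hw
    obtain ⟨w1, w2⟩ := w
    rcases hd with ⟨hlt, hs'⟩ | ⟨hlt, hs'⟩ <;> rw [hs'] at hw <;> ring_nf at hw <;>
      rw [uIcc_self] at hw <;> obtain ⟨hw1, hw2⟩ := hw <;> rw [mem_singleton_iff] at hw2
    · rw [abs_of_pos (by linarith)] at hg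
      have hg := hg hlt.ne'
      have hw1' : (P.vertex k).1 < w1 ∧ w1 < (P.vertex (k + 1)).1 := by
        rcases mem_uIcc.1 hw1 with h | h <;> constructor <;> linarith
      refine hε.notMem_boundary_of_horizontal hv ?_ ?_ (mem_uIcc.2 (Or.inl
        ⟨hw1'.1.le, hw1'.2.le⟩)) hw1'.1.ne' hw1'.2.ne
      · rw [hw2, abs_of_neg (by linarith)]; linarith
      · rw [hw2]; exact ne_of_lt (by linarith)
    · rw [abs_of_neg (by linarith)] at hg
      have hg := hg hlt.ne
      have hw1' : (P.vertex (k + 1)).1 < w1 ∧ w1 < (P.vertex k).1 := by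
        rcases mem_uIcc.1 hw1 with h | h <;> constructor <;> linarith
      refine hε.notMem_boundary_of_horizontal hv ?_ ?_ (mem_uIcc.2 (Or.inr
        ⟨hw1'.1.le, hw1'.2.le⟩)) hw1'.2.ne hw1'.1.ne'
      · rw [hw2, abs_of_pos (by linarith)]; linarith
      · rw [hw2]; exact ne_of_gt (by linarith)

/-- Near a vertex, the boundary consists of the two edges at that vertex. -/
lemma IsGap.notMem_boundary_of_vertex {ε : ℝ} (hε : P.IsGap ε) {k : Fin n} {p : Plane}
    (h1 : |p.1 - (P.vertex (k + 1)).1| ≤ ε) (h2 : |p.2 - (P.vertex (k + 1)).2| ≤ ε)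
    (hk : p ∉ P.edge k) (hk' : p ∉ P.edge (k + 1)) : p ∉ P.boundary := by
  rw [mem_boundary_iff]
  rintro ⟨l, hl⟩
  rcases P.eq_or_eq_of_vertex_mem_edge ((hε.near_vertex h1 h2).mem_edge hl) with rfl | rfl
  · exact hk hl
  · exact hk' hl

/-- The path around a vertex whose edges leave in the directions `(-σ, 0)` and `(0, -τ)`, through the
three quadrants other than the one between them. -/
lemma IsGap.joined_around_vertex {ε : ℝ} (hε : P.IsGap ε) {k : Fin n} {σ τ : ℝ}
    (hσ : σ = 1 ∨ σ = -1) (hτ : τ = 1 ∨ τ = -1)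
    (h : ∀ p, p ∈ P.edge k ∨ p ∈ P.edge (k + 1) →
      (p.1 = (P.vertex (k + 1)).1 ∧ τ * (p.2 - (P.vertex (k + 1)).2) ≤ 0) ∨
        (p.2 = (P.vertex (k + 1)).2 ∧ σ * (p.1 - (P.vertex (k + 1)).1) ≤ 0)) :
    OrthoJoined P.boundaryᶜ ((P.vertex (k + 1)).1 + ε * σ, (P.vertex (k + 1)).2 - ε * τ)
      ((P.vertex (k + 1)).1 - ε * σ, (P.vertex (k + 1)).2 + ε * τ) := by
  have hε0 := hε.1
  set v := P.vertex (k + 1) with hv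
  have a1 : AxisParallel (v.1 + ε * σ, v.2 - ε * τ) (v.1 + ε * σ, v.2 + ε * τ) := Or.inl rfl
  have a2 : AxisParallel (v.1 + ε * σ, v.2 + ε * τ) (v.1 - ε * σ, v.2 + ε * τ) := Or.inr rfl
  have key : ∀ w : Plane, |w.1 - v.1| ≤ ε → |w.2 - v.2| ≤ ε →
      (σ * (w.1 - v.1) = ε ∨ τ * (w.2 - v.2) = ε) → w ∈ P.boundaryᶜ := by
    intro w h1 h2 h3
    have : ¬ (w ∈ P.edge k ∨ w ∈ P.edge (k + 1)) := by
      intro hw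
      rcases h w hw with ⟨h4, h5⟩ | ⟨h4, h5⟩ <;> rw [h4] at h3 <;> simp at h3 <;>
        rcases h3 with h3 | h3 <;> linarith
    exact hε.notMem_boundary_of_vertex h1 h2 (fun h => this (Or.inl h)) fun h => this (Or.inr h)
  have hbd : ∀ s : ℝ, (s = 1 ∨ s = -1) → |ε * s| ≤ ε := by
    rintro s (rfl | rfl) <;> simp [abs_of_pos hε0]
  have hsq : ∀ s : ℝ, (s = 1 ∨ s = -1) → s * (ε * s) = ε := by
    rintro s (rfl | rfl) <;> ring
  have hmid : ∀ (s c w : ℝ), (s = 1 ∨ s = -1) → w ∈ uIcc (c - ε * s) (c + ε * s) →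
      |w - c| ≤ ε := by
    intro s c w hs hw
    rw [abs_le]
    rcases hs with rfl | rfl <;> rcases mem_uIcc.1 hw with hw | hw <;> constructor <;> linarith
  refine (OrthoJoined.single a1 fun w hw => ?_).trans (OrthoJoined.single a2 fun w hw => ?_)
  · rw [a1.mem_segment_iff, uIcc_self] at hw
    have hw1 : w.1 - v.1 = ε * σ := by rw [show w.1 = _ from hw.1]; simp
    exact key w (hw1 ▸ hbd σ hσ) (hmid τ _ _ hτ hw.2) (Or.inl (hw1 ▸ hsq σ hσ))
  · rw [a2.mem_segment_iff, uIcc_self] at hw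
    have hw2 : w.2 - v.2 = ε * τ := by rw [show w.2 = _ from hw.2]; simp
    exact key w (hmid σ _ _ hσ (by rw [uIcc_comm]; exact hw.1)) (hw2 ▸ hbd τ hτ)
      (Or.inr (hw2 ▸ hsq τ hτ))

/-- At a vertex, the right sides of the two edges are joined off the boundary: they are the same
quadrant if the boundary turns right; if it turns left, the path goes around the vertex. -/
lemma IsGap.joined_cornerStart_succ {ε : ℝ} (hε : P.IsGap ε) (k : Fin n) :
    OrthoJoined P.boundaryᶜ (P.cornerEnd ε k) (P.cornerStart ε (k + 1)) := by
  have hor := P.orthogonal k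
  rcases P.sign_cases k with ⟨hv, hs, hd⟩ | ⟨hv, hs, hd⟩ <;>
  rcases P.sign_cases (k + 1) with ⟨hv', hs', hd'⟩ | ⟨hv', hs', hd'⟩
  · rcases hor with h | h
    · exact absurd (Prod.ext hv h.1) (P.vertex_ne k)
    · exact absurd (Prod.ext hv' h.2) (P.vertex_ne (k + 1))
  · -- a vertical edge in the direction `t` is followed by a horizontal one in the direction `s`
    have key : ∀ t s : ℝ, (t = 1 ∨ t = -1) → (s = 1 ∨ s = -1) →
        Real.sign ((P.vertex (k + 1)).2 - (P.vertex k).2) = t →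
        Real.sign ((P.vertex (k + 1 + 1)).1 - (P.vertex (k + 1)).1) = s →
        t * (P.vertex k).2 ≤ t * (P.vertex (k + 1)).2 →
        s * (P.vertex (k + 1)).1 ≤ s * (P.vertex (k + 1 + 1)).1 →
        OrthoJoined P.boundaryᶜ (P.cornerEnd ε k) (P.cornerStart ε (k + 1)) := by
      intro t s ht hs1 e e' hlt hlt'
      have e1 : P.cornerEnd ε k = ((P.vertex (k + 1)).1 + ε * t, (P.vertex (k + 1)).2 - ε * t) := by
        simp only [cornerEnd, hs, e]; ext <;> simp only <;> ring
      have e2 : P.cornerStart ε (k + 1) =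
          ((P.vertex (k + 1)).1 + ε * s, (P.vertex (k + 1)).2 - ε * s) := by
        simp only [cornerStart, hs', e']; ext <;> simp only <;> ring
      rw [e1, e2]
      by_cases hst : s = t
      · rw [hst]; exact Relation.ReflTransGen.refl
      · have hst : s = -t := by
          rcases ht with rfl | rfl <;> rcases hs1 with rfl | rfl <;> simp at hst ⊢
        have := hε.joined_around_vertex (k := k) ht ht fun p hp => by
          rw [mem_edge_iff, mem_edge_iff, hv, ← hv', uIcc_self, uIcc_self] at hp
          rcases hp with ⟨h1, h2⟩ | ⟨h2, h1⟩
          · refine Or.inl ⟨h1, ?_⟩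
            rcases ht with rfl | rfl <;> rcases mem_uIcc.1 h2 with h2 | h2 <;> linarith
          · refine Or.inr ⟨h1, ?_⟩
            rw [hst] at hlt'
            rcases ht with rfl | rfl <;> rcases mem_uIcc.1 h2 with h2 | h2 <;> linarith
        rw [hst]
        simpa [sub_eq_add_neg] using this
    rcases hd with ⟨hlt, hd⟩ | ⟨hlt, hd⟩ <;> rcases hd' with ⟨hlt', hd'⟩ | ⟨hlt', hd'⟩ <;>
      refine key _ _ ?_ ?_ hd hd' ?_ ?_ <;> first | simp; done | linarith
  · -- a horizontal edge in the direction `t` is followed by a vertical one in the direction `s`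
    have key : ∀ t s : ℝ, (t = 1 ∨ t = -1) → (s = 1 ∨ s = -1) →
        Real.sign ((P.vertex (k + 1)).1 - (P.vertex k).1) = t →
        Real.sign ((P.vertex (k + 1 + 1)).2 - (P.vertex (k + 1)).2) = s →
        t * (P.vertex k).1 ≤ t * (P.vertex (k + 1)).1 →
        s * (P.vertex (k + 1)).2 ≤ s * (P.vertex (k + 1 + 1)).2 →
        OrthoJoined P.boundaryᶜ (P.cornerEnd ε k) (P.cornerStart ε (k + 1)) := by
      intro t s ht hs1 e e' hlt hlt'
      have e1 : P.cornerEnd ε k = ((P.vertex (k + 1)).1 - ε * t, (P.vertex (k + 1)).2 - ε * t) := by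
        simp only [cornerEnd, hs, e]; ext <;> simp only <;> ring
      have e2 : P.cornerStart ε (k + 1) =
          ((P.vertex (k + 1)).1 + ε * s, (P.vertex (k + 1)).2 + ε * s) := by
        simp only [cornerStart, hs', e']; ext <;> simp only <;> ring
      rw [e1, e2]
      by_cases hst : s = -t
      · rw [hst]; simp only [mul_neg, ← sub_eq_add_neg]; exact Relation.ReflTransGen.refl
      · have hst : s = t := by
          rcases ht with rfl | rfl <;> rcases hs1 with rfl | rfl <;> simp at hst ⊢
        have hnt : -t = 1 ∨ -t = -1 := by rcases ht with rfl | rfl <;> simp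
        have := hε.joined_around_vertex (k := k) ht hnt fun p hp => by
          rw [mem_edge_iff, mem_edge_iff, hv, ← hv', uIcc_self, uIcc_self] at hp
          rcases hp with ⟨h2, h1⟩ | ⟨h1, h2⟩
          · refine Or.inr ⟨h1, ?_⟩
            rcases ht with rfl | rfl <;> rcases mem_uIcc.1 h2 with h2 | h2 <;> linarith
          · refine Or.inl ⟨h1, ?_⟩
            rw [hst] at hlt'
            rcases ht with rfl | rfl <;> rcases mem_uIcc.1 h2 with h2 | h2 <;> linarith
        rw [hst]
        simpa [sub_eq_add_neg] using this.symm
    rcases hd with ⟨hlt, hd⟩ | ⟨hlt, hd⟩ <;> rcases hd' with ⟨hlt', hd'⟩ | ⟨hlt', hd'⟩ <;>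
      refine key _ _ ?_ ?_ hd hd' ?_ ?_ <;> first | simp; done | linarith
  · rcases hor with h | h
    · exact absurd (Prod.ext h.2 hv') (P.vertex_ne (k + 1))
    · exact absurd (Prod.ext h.1 hv) (P.vertex_ne k)

/-- The right sides of all edges are joined off the boundary. -/
lemma IsGap.joined_cornerStart {ε : ℝ} (hε : P.IsGap ε) (k l : Fin n) :
    OrthoJoined P.boundaryᶜ (P.cornerStart ε k) (P.cornerStart ε l) := by
  have h0 : ∀ m : ℕ, OrthoJoined P.boundaryᶜ (P.cornerStart ε 0) (P.cornerStart ε (Fin.ofNat n m)) := by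
    intro m
    induction m with
    | zero => exact Relation.ReflTransGen.refl
    | succ m ih =>
      have : Fin.ofNat n (m + 1) = Fin.ofNat n m + 1 := by
        apply Fin.ext; simp [Fin.val_add, Fin.ofNat]
      rw [this]
      exact ih.trans ((hε.joined_cornerEnd _).trans (hε.joined_cornerStart_succ _))
  have h1 : ∀ k : Fin n, OrthoJoined P.boundaryᶜ (P.cornerStart ε 0) (P.cornerStart ε k) := by
    intro k
    have : Fin.ofNat n k = k := by apply Fin.ext; simp [Fin.ofNat, Nat.mod_eq_of_lt k.2]
    rw [← this]; exact h0 k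
  exact (h1 k).symm.trans (h1 l)

end SimpleOrthogonalPolygon

namespace SimpleOrthogonalPolygon

open OrthoPlane

variable {n : ℕ} [NeZero n] {P : SimpleOrthogonalPolygon n}

/-! ### Orientation and exterior -/

lemma wind_eq_of_joined {a b : Plane} (h : OrthoJoined P.boundaryᶜ a b) : P.wind a = P.wind b :=
  h.winding_eq P.isCycle_edges P.axisParallel_edges (P.forall_mem_edges.2 fun k =>
    (disjoint_compl_left.mono_right fun _ hw => P.mem_boundary_iff.2 ⟨k, hw⟩))

/-- A ray to the right at a height that is not the height of a vertex either avoids the boundary, or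
first meets it at a vertical edge. In the second case, it arrives on the right side of the edge, from
which the right sides of all edges can be reached, or on the left side, where the winding number is
larger by one. -/
lemma IsGap.ray_cases {ε : ℝ} (hε : P.IsGap ε) {p : Plane} (hp : p ∉ P.boundary)
    (hgen : ∀ k, (P.vertex k).2 ≠ p.2) :
    (∀ x, p.1 ≤ x → (x, p.2) ∉ P.boundary) ∨
      (∀ l, OrthoJoined P.boundaryᶜ p (P.cornerStart ε l)) ∨
      ∀ l, P.wind p = P.wind (P.cornerStart ε l) + 1 := by
  classical
  have hε0 := hε.1
  have hvert : ∀ x l, (x, p.2) ∈ P.edge l → (P.vertex l).1 = x ∧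
      (P.vertex l).1 = (P.vertex (l + 1)).1 := by
    intro x l hl
    rw [mem_edge_iff] at hl
    rcases P.vertical_or_horizontal l with h | h
    · rw [← h.1, uIcc_self] at hl
      exact ⟨(show x = _ from hl.1).symm, h.1⟩
    · rw [← h.1, uIcc_self] at hl
      exact absurd (show p.2 = _ from hl.2).symm (hgen l)
  set T := Finset.univ.filter fun l : Fin n => p.1 < (P.vertex l).1 ∧
    ((P.vertex l).1, p.2) ∈ P.edge l with hT
  rcases T.eq_empty_or_nonempty with hTe | hTn
  · left
    intro x hx hxb
    obtain ⟨l, hl⟩ := P.mem_boundary_iff.1 hxb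
    have h1 := hvert x l hl
    have hlT : l ∈ T := by
      refine Finset.mem_filter.2 ⟨Finset.mem_univ _, lt_of_le_of_ne (h1.1 ▸ hx) fun h => hp ?_, ?_⟩
      · rw [h1.1] at h; subst h; exact hxb
      · rw [h1.1]; exact hl
    rw [hTe] at hlT
    simp at hlT
  right
  obtain ⟨l, hlT, hmin⟩ := T.exists_min_image (fun l => (P.vertex l).1) hTn
  obtain ⟨-, hpl, hle⟩ := Finset.mem_filter.1 hlT
  have hv := (hvert _ l hle).2
  have hy := (P.mem_edge_iff.1 hle).2
  -- the ray is followed to a point at distance `d` before the edge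
  set d := min ε ((P.vertex l).1 - p.1) with hd
  have hd0 : 0 < d := lt_min hε0 (by linarith)
  have hdε : d ≤ ε := min_le_left _ _
  have hdp : d ≤ (P.vertex l).1 - p.1 := min_le_right _ _
  have hax : AxisParallel p ((P.vertex l).1 - d, p.2) := Or.inr rfl
  have hJ : OrthoJoined P.boundaryᶜ p ((P.vertex l).1 - d, p.2) := by
    refine OrthoJoined.single hax fun w hw hwb => ?_
    rw [hax.mem_segment_iff, uIcc_self, uIcc_of_le (by simp only; linarith)] at hw
    obtain ⟨w1, w2⟩ := w
    obtain ⟨⟨hw1, hw1'⟩, rfl⟩ : w1 ∈ Icc _ _ ∧ w2 = p.2 := hw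
    simp only at hw1 hw1'
    obtain ⟨m, hm⟩ := P.mem_boundary_iff.1 hwb
    have h1 := hvert w1 m hm
    rcases hw1.eq_or_lt with h | h
    · subst h; exact hp hwb
    · have := hmin m (Finset.mem_filter.2 ⟨Finset.mem_univ _, by rw [h1.1]; exact h,
        by rw [h1.1]; exact hm⟩)
      simp only [h1.1] at this
      linarith
  have hwJ := wind_eq_of_joined hJ
  have h1 : p.2 ≠ (P.vertex l).2 := (hgen l).symm
  have h2 : p.2 ≠ (P.vertex (l + 1)).2 := (hgen (l + 1)).symm
  have hg := (hε.2 (l + 1) l).2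
  rcases P.sign_cases l with ⟨-, hs, ⟨hlt, hs'⟩ | ⟨hlt, hs'⟩⟩ | ⟨h, -⟩
  · right
    intro m
    have hn : ∀ x, |x - (P.vertex l).1| ≤ ε → P.Near ((P.vertex l).1, p.2) (x, p.2) :=
      fun x hx => hε.near_of_vertical hx
    have hcross := wind_sub_wind_of_vertical hle hv h1.symm h2.symm
      (x := (P.vertex l).1 - d) (x' := (P.vertex l).1 + ε) (by simp only; linarith)
      (by simp only; linarith)
      (hn _ (by rw [sub_sub_cancel_left, abs_neg, abs_of_pos hd0]; exact hdε))
      (hn _ (by rw [add_sub_cancel_left, abs_of_pos hε0]))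
    rw [if_pos hlt] at hcross
    rw [abs_of_pos (by linarith)] at hg
    have hg := hg hlt.ne'
    have hJ2 : OrthoJoined P.boundaryᶜ ((P.vertex l).1 + ε, p.2) (P.cornerStart ε l) := by
      simp only [cornerStart, hs, hs']
      refine hε.joined_of_vertical hv ?_ ?_ ?_ hy h1 h2 ?_ ?_ ?_
      · rw [add_sub_cancel_left, abs_of_pos hε0]
      · rw [add_sub_cancel_left, abs_of_pos (by linarith)]; linarith
      · nlinarith
      · exact mem_uIcc.2 (Or.inl ⟨by linarith, by linarith⟩)
      · exact ne_of_gt (by linarith)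
      · exact ne_of_lt (by linarith)
    rw [hwJ, ← wind_eq_of_joined (hJ2.trans (hε.joined_cornerStart l m))]
    simp only at hcross ⊢
    linarith
  · left
    intro m
    rw [abs_of_neg (by linarith)] at hg
    have hg := hg hlt.ne
    refine hJ.trans (OrthoJoined.trans ?_ (hε.joined_cornerStart l m))
    simp only [cornerStart, hs, hs']
    refine hε.joined_of_vertical hv ?_ ?_ ?_ hy h1 h2 ?_ ?_ ?_
    · rw [sub_sub_cancel_left, abs_neg, abs_of_pos hd0]; exact hdε
    · rw [add_sub_cancel_left, abs_of_neg (by linarith)]; linarith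
    · nlinarith
    · exact mem_uIcc.2 (Or.inr ⟨by linarith, by linarith⟩)
    · exact ne_of_lt (by linarith)
    · exact ne_of_gt (by linarith)
  · exact absurd hv fun h' => P.vertex_ne l (Prod.ext h' h)

variable (P) in
/-- Every value of the winding number is taken at a point in general position: just to the upper right
of the given one, on the side whose crossings the strict inequalities in `winding` count. -/
lemma exists_generic (p : Plane) : ∃ p' : Plane, p' ∉ P.boundary ∧
    (∀ k, (P.vertex k).2 ≠ p'.2) ∧ P.wind p' = P.wind p := by
  obtain ⟨ε, hε, hn⟩ := P.exists_near p
  have hn := hn ε ε (by rw [abs_of_pos hε]) (by rw [abs_of_pos hε])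
  have hx := hn.fst_ne (by simp [hε.ne'])
  have hy := hn.snd_ne (by simp [hε.ne'])
  refine ⟨_, ?_, hy, ?_⟩
  · rw [mem_boundary_iff]
    rintro ⟨k, hk⟩
    rw [mem_edge_iff] at hk
    rcases P.axisParallel k with h | h
    · rw [← h, uIcc_self] at hk; exact hx k (show _ = _ from hk.1).symm
    · rw [← h, uIcc_self] at hk; exact hy k (show _ = _ from hk.2).symm
  · have key : ∀ v z : ℝ, (v ≠ z → |z + ε - z| < |v - z|) → (z + ε < v ↔ z < v) := by
      intro v z h
      refine ⟨fun h' => by linarith, fun h' => ?_⟩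
      have := h h'.ne'
      rw [add_sub_cancel_left, abs_of_pos hε, abs_of_pos (by linarith)] at this
      linarith
    have h1 : ∀ k, rightOf (p.1 + ε, p.2 + ε) (P.vertex k) = rightOf p (P.vertex k) := fun k => by
      simp only [rightOf, key _ _ (hn k).1]
    have h2 : ∀ k, above (p.1 + ε, p.2 + ε) (P.vertex k) = above p (P.vertex k) := fun k => by
      simp only [above, key _ _ (hn k).2]
    simp only [wind_eq_sum, h1, h2]

/-- A point on a ray to the right that avoids the boundary has winding number `0`. -/
lemma wind_eq_zero_of_ray {p : Plane} (h : ∀ x, p.1 ≤ x → (x, p.2) ∉ P.boundary) :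
    P.wind p = 0 := by
  rw [wind_eq_sum]
  refine Finset.sum_eq_zero fun k _ => ?_
  by_cases h1 : p.2 ∈ uIcc (P.vertex k).2 (P.vertex (k + 1)).2
  · by_cases h2 : p.1 < (P.vertex k).1
    · have h3 : ((P.vertex k).1, p.2) ∈ P.edge k := P.mem_edge_iff.2 ⟨left_mem_uIcc, h1⟩
      exact absurd (P.mem_boundary_iff.2 ⟨k, h3⟩) (h _ h2.le)
    · simp [rightOf, h2]
  · rw [above_sub_above_eq_zero' h1, mul_zero]

variable (P) in
/-- Far to the left, there are points from which a ray to the right meets the boundary. -/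
lemma exists_far_left (M : ℝ) : ∃ p : Plane, M < ‖p‖ ∧ p ∉ P.boundary ∧ P.wind p = 0 ∧
    (∀ k, (P.vertex k).2 ≠ p.2) ∧ ¬ ∀ x, p.1 ≤ x → (x, p.2) ∉ P.boundary := by
  obtain ⟨k, hk⟩ : ∃ k, (P.vertex k).1 = (P.vertex (k + 1)).1 :=
    (P.orthogonal 0).elim (fun h => ⟨0 + 1, h.2⟩) fun h => ⟨0, h.1⟩
  have hne : (P.vertex k).2 ≠ (P.vertex (k + 1)).2 := fun h => P.vertex_ne k (Prod.ext hk h)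
  obtain ⟨M', hM'⟩ := P.bounded_region
  obtain ⟨ε, hε, hn⟩ := P.exists_near (P.vertex k)
  -- a height strictly between those of the two ends of the edge
  obtain ⟨b, hb0, hb, hby⟩ : ∃ b : ℝ, b ≠ 0 ∧ |b| ≤ ε ∧
      ((P.vertex k).2 + b) ∈ uIcc (P.vertex k).2 (P.vertex (k + 1)).2 := by
    rcases hne.lt_or_gt with h | h
    · refine ⟨min ε ((P.vertex (k + 1)).2 - (P.vertex k).2), (lt_min hε (by linarith)).ne', ?_, ?_⟩
      · rw [abs_of_pos (lt_min hε (by linarith))]; exact min_le_left _ _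
      · refine mem_uIcc.2 (Or.inl ⟨?_, ?_⟩)
        · linarith [lt_min hε (sub_pos.2 h)]
        · linarith [min_le_right ε ((P.vertex (k + 1)).2 - (P.vertex k).2)]
    · refine ⟨-min ε ((P.vertex k).2 - (P.vertex (k + 1)).2),
        (neg_neg_of_pos (lt_min hε (by linarith))).ne, ?_, ?_⟩
      · rw [abs_neg, abs_of_pos (lt_min hε (by linarith))]; exact min_le_left _ _
      · refine mem_uIcc.2 (Or.inr ⟨?_, ?_⟩)
        · linarith [min_le_right ε ((P.vertex k).2 - (P.vertex (k + 1)).2)]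
        · linarith [lt_min hε (sub_pos.2 h)]
  have hgen := (hn 0 b (by simpa using hε.le) hb).snd_ne (by simpa using hb0)
  have hm : ((P.vertex k).1, (P.vertex k).2 + b) ∈ P.boundary :=
    P.mem_boundary_iff.2 ⟨k, P.mem_edge_iff.2 ⟨left_mem_uIcc, hby⟩⟩
  set N := |M| + |M'| + |(P.vertex k).1| + 1 with hN
  have hNb : ∀ y, max M M' < ‖((-N, y) : Plane)‖ := fun y => by
    refine lt_of_lt_of_le ?_ (norm_fst_le ((-N, y) : Plane))
    rw [Real.norm_eq_abs, abs_neg, max_lt_iff]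
    constructor <;> refine lt_of_lt_of_le ?_ (le_abs_self N) <;>
      linarith [le_abs_self M, le_abs_self M', abs_nonneg M, abs_nonneg M',
        abs_nonneg (P.vertex k).1]
  refine ⟨(-N, (P.vertex k).2 + b), (le_max_left _ _).trans_lt (hNb _), fun h => ?_, ?_, hgen,
    fun h => h (P.vertex k).1 ?_ hm⟩
  · exact ((le_max_right M M').trans_lt (hNb _)).not_ge (hM' _ (P.mem_region_iff.2 (Or.inl h)))
  · refine winding_eq_zero_of_far P.isCycle_edges (M := M') (P.forall_mem_edges.2 fun k => ?_)
      ((le_max_right M M').trans_lt (hNb _))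
    exact ⟨hM' _ (P.mem_region_iff.2 (Or.inl (P.mem_boundary_iff.2 ⟨k, left_mem_segment ℝ _ _⟩))),
      hM' _ (P.mem_region_iff.2 (Or.inl (P.mem_boundary_iff.2 ⟨k, right_mem_segment ℝ _ _⟩)))⟩
  · simp only
    linarith [neg_abs_le (P.vertex k).1, abs_nonneg M, abs_nonneg M']

lemma integral_step {a M : ℝ} (h1 : -M ≤ a) (h2 : a ≤ M) :
    ∫ x in (-M)..M, (if x < a then (1 : ℝ) else 0) = a + M := by
  have hi : ∀ u v, IntervalIntegrable (fun x : ℝ => if x < a then (1 : ℝ) else 0)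
      MeasureTheory.volume u v := fun u v => by
    refine Antitone.intervalIntegrable fun x y hxy => ?_
    split_ifs with h3 h4 <;> linarith
  rw [← intervalIntegral.integral_add_adjacent_intervals (hi (-M) a) (hi a M)]
  have e1 : ∫ x in (-M)..a, (if x < a then (1 : ℝ) else 0) = ∫ x in (-M)..a, (1 : ℝ) := by
    refine intervalIntegral.integral_congr_ae ?_
    have : ∀ᵐ x : ℝ, x ≠ a := by simp [MeasureTheory.ae_iff, MeasureTheory.measure_singleton]
    filter_upwards [this] with x hx hx'
    rw [uIoc_of_le h1] at hx'
    rw [if_pos (lt_of_le_of_ne hx'.2 hx)]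
  have e2 : ∫ x in a..M, (if x < a then (1 : ℝ) else 0) = ∫ x in a..M, (0 : ℝ) := by
    refine intervalIntegral.integral_congr fun x hx => ?_
    rw [uIcc_of_le h2] at hx
    rw [if_neg (not_lt.2 hx.1)]
  rw [e1, e2]
  simp

/-- The integral of the winding number over a large square is half of the signed area; hence it is
positive somewhere. -/
lemma exists_wind_pos : ∃ p, 0 < P.wind p := by
  by_contra hcon
  have hcon : ∀ p, P.wind p ≤ 0 := fun p => not_lt.1 fun h => hcon ⟨p, h⟩
  obtain ⟨M, hM⟩ := P.bounded_region
  have hv : ∀ k, (-M ≤ (P.vertex k).1 ∧ (P.vertex k).1 ≤ M) ∧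
      (-M ≤ (P.vertex k).2 ∧ (P.vertex k).2 ≤ M) := fun k => by
    have := hM _ (P.mem_region_iff.2 (Or.inl (P.mem_boundary_iff.2 ⟨k, left_mem_segment ℝ _ _⟩)))
    rw [Prod.norm_def, max_le_iff, Real.norm_eq_abs, Real.norm_eq_abs, abs_le, abs_le] at this
    exact this
  have hM0 : -M ≤ M := (hv 0).1.1.trans (hv 0).1.2
  have hint : ∀ a u v, IntervalIntegrable (fun x : ℝ => if x < a then (1 : ℝ) else 0)
      MeasureTheory.volume u v := fun a u v => by
    refine Antitone.intervalIntegrable fun x y hxy => ?_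
    split_ifs with h3 h4 <;> linarith
  have hW : ∀ x y : ℝ, (P.wind (x, y) : ℝ) = ∑ k, (if x < (P.vertex k).1 then (1 : ℝ) else 0) *
      ((if y < (P.vertex (k + 1)).2 then 1 else 0) - if y < (P.vertex k).2 then 1 else 0) := by
    intro x y
    rw [wind_eq_sum]
    push_cast [rightOf, above]
    rfl
  have hinner : ∀ y : ℝ, ∑ k, ((P.vertex k).1 + M) *
      ((if y < (P.vertex (k + 1)).2 then (1 : ℝ) else 0) - if y < (P.vertex k).2 then 1 else 0) ≤ 0 := by
    intro y
    have h1 : ∫ x in (-M)..M, (P.wind (x, y) : ℝ) ≤ 0 := by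
      rw [← neg_nonneg, ← intervalIntegral.integral_neg]
      refine intervalIntegral.integral_nonneg hM0 fun x _ => ?_
      have : (P.wind (x, y) : ℝ) ≤ 0 := by exact_mod_cast hcon (x, y)
      linarith
    simp only [hW] at h1
    rw [intervalIntegral.integral_finsetSum fun k _ => (hint _ _ _).mul_const _] at h1
    simp only [intervalIntegral.integral_mul_const] at h1
    refine le_of_eq_of_le (Finset.sum_congr rfl fun k _ => ?_) h1
    rw [integral_step (hv k).1.1 (hv k).1.2]
  have houter : ∑ k, ((P.vertex k).1 + M) * ((P.vertex (k + 1)).2 - (P.vertex k).2) ≤ 0 := by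
    have h1 : ∫ y in (-M)..M, ∑ k, ((P.vertex k).1 + M) *
        ((if y < (P.vertex (k + 1)).2 then (1 : ℝ) else 0) - if y < (P.vertex k).2 then 1 else 0)
        ≤ 0 := by
      rw [← neg_nonneg, ← intervalIntegral.integral_neg]
      exact intervalIntegral.integral_nonneg hM0 fun y _ => by linarith [hinner y]
    rw [intervalIntegral.integral_finsetSum fun k _ =>
      ((hint _ _ _).sub (hint _ _ _)).const_mul _] at h1
    refine le_of_eq_of_le (Finset.sum_congr rfl fun k _ => ?_) h1
    rw [intervalIntegral.integral_const_mul, intervalIntegral.integral_sub (hint _ _ _) (hint _ _ _),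
      integral_step (hv _).2.1 (hv _).2.2, integral_step (hv _).2.1 (hv _).2.2]
    ring
  -- summation by parts turns the shoelace formula into twice the sum above
  have harea := P.counterclockwise
  have e1 := P.sum_vertex_succ fun p : Plane => p.1 * p.2
  have e2 := P.sum_vertex_succ fun p : Plane => p.2
  have e3 : ∀ k, (P.vertex k).1 * (P.vertex (k + 1)).2 - (P.vertex (k + 1)).1 * (P.vertex k).2 =
      2 * (((P.vertex k).1 + M) * ((P.vertex (k + 1)).2 - (P.vertex k).2)) -
        2 * M * ((P.vertex (k + 1)).2 - (P.vertex k).2) -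
        ((P.vertex (k + 1)).1 * (P.vertex (k + 1)).2 - (P.vertex k).1 * (P.vertex k).2) := by
    intro k
    rcases P.axisParallel k with h | h
    · rw [← h]; ring
    · rw [← h]; ring
  simp only [e3, Finset.sum_sub_distrib, ← Finset.mul_sum] at harea
  simp only [Finset.sum_sub_distrib, mul_sub] at houter harea
  rw [e1, e2] at harea
  linarith

variable (P) in
/-- As the boundary is simple and counterclockwise, its winding number is `0` or `1` everywhere. -/
lemma wind_eq_zero_or_one (p : Plane) : P.wind p = 0 ∨ P.wind p = 1 := by
  obtain ⟨ε, hε⟩ := P.exists_isGap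
  set c := P.wind (P.cornerStart ε 0) with hc
  have hall : ∀ p, P.wind p = 0 ∨ P.wind p = c ∨ P.wind p = c + 1 := by
    intro p
    obtain ⟨p', hp', hgen, hpp'⟩ := P.exists_generic p
    rw [← hpp']
    rcases hε.ray_cases hp' hgen with h | h | h
    · exact Or.inl (wind_eq_zero_of_ray h)
    · exact Or.inr (Or.inl (wind_eq_of_joined (h 0)))
    · exact Or.inr (Or.inr (h 0))
  have hc' : c = 0 ∨ c = -1 := by
    obtain ⟨q, -, hq, hq0, hgen, hray⟩ := P.exists_far_left 0
    rcases hε.ray_cases hq hgen with h | h | h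
    · exact absurd h hray
    · left; rw [hc, ← wind_eq_of_joined (h 0), hq0]
    · right; have := h 0; rw [hq0] at this; linarith
  obtain ⟨q, hq⟩ := P.exists_wind_pos
  have h1 := hall q
  have h2 := hall p
  omega

lemma mem_region_iff_wind {p : Plane} : p ∈ P.region ↔ p ∈ P.boundary ∨ P.wind p = 1 := by
  rw [mem_region_iff]
  rcases P.wind_eq_zero_or_one p with h | h <;> simp [h]

lemma notMem_region_iff {p : Plane} : p ∉ P.region ↔ p ∉ P.boundary ∧ P.wind p = 0 := by
  rw [mem_region_iff_wind, not_or]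
  rcases P.wind_eq_zero_or_one p with h | h <;> simp [h]

lemma orthoJoined_compl_region {a b : Plane} (h : OrthoJoined P.boundaryᶜ a b) (ha : P.wind a = 0) :
    OrthoJoined P.regionᶜ a b := by
  induction h with
  | refl => exact Relation.ReflTransGen.refl
  | @tail b c h1 h2 ih =>
    refine ih.trans (OrthoJoined.single h2.1 fun w hw => ?_)
    refine P.notMem_region_iff.2 ⟨h2.2 hw, ?_⟩
    have hax : AxisParallel b w := by
      rw [h2.1.mem_segment_iff] at hw
      rcases h2.1 with h3 | h3
      · rw [← h3, uIcc_self] at hw; exact Or.inl (show _ = _ from hw.1).symm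
      · rw [← h3, uIcc_self] at hw; exact Or.inr (show _ = _ from hw.2).symm
    have hbw : OrthoJoined P.boundaryᶜ b w := OrthoJoined.single hax fun u hu =>
      h2.2 ((convex_segment b c).segment_subset (left_mem_segment ℝ b c) hw hu)
    have h1' : OrthoJoined P.boundaryᶜ a b := h1
    rw [← wind_eq_of_joined (h1'.trans hbw), ha]

/-- Points outside the polygon are joined to points far away: first to the boundary, then along the
boundary. -/
lemma exists_joined_far {o : Plane} (ho : o ∉ P.region) (M : ℝ) :
    ∃ o', M < ‖o'‖ ∧ OrthoJoined P.regionᶜ o o' := by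
  obtain ⟨ε, hε⟩ := P.exists_isGap
  obtain ⟨hob, how⟩ := P.notMem_region_iff.1 ho
  suffices ∃ o', M < ‖o'‖ ∧ OrthoJoined P.boundaryᶜ o o' by
    obtain ⟨o', h1, h2⟩ := this
    exact ⟨o', h1, orthoJoined_compl_region h2 how⟩
  obtain ⟨δ, hδ, hn⟩ := P.exists_near o
  have hn0 := hn 0 δ (by simpa using hδ.le) (by rw [abs_of_pos hδ])
  rw [add_zero] at hn0
  have hgen := hn0.snd_ne (by simp [hδ.ne'])
  have hp := hn0.notMem_boundary hob
  have hax : AxisParallel o (o.1, o.2 + δ) := Or.inl rfl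
  have hJ : OrthoJoined P.boundaryᶜ o (o.1, o.2 + δ) := by
    refine OrthoJoined.single hax fun w hw => ?_
    rw [hax.mem_segment_iff, uIcc_self] at hw
    refine (hn0.mono ?_ (abs_sub_left_of_mem_uIcc hw.2)).notMem_boundary hob
    rw [show w.1 = o.1 from hw.1]
  rcases hε.ray_cases hp hgen with h | h | h
  · have hax' : AxisParallel (o.1, o.2 + δ) (max o.1 (|M| + 1), o.2 + δ) := Or.inr rfl
    refine ⟨(max o.1 (|M| + 1), o.2 + δ), ?_, hJ.trans (OrthoJoined.single hax' fun w hw => ?_)⟩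
    · refine lt_of_lt_of_le ?_ (norm_fst_le _)
      refine lt_of_lt_of_le ?_ (le_abs_self _)
      exact lt_max_of_lt_right (by linarith [le_abs_self M])
    · rw [hax'.mem_segment_iff, uIcc_self, uIcc_of_le (le_max_left _ _)] at hw
      have := h w.1 hw.1.1
      rwa [← show w.2 = o.2 + δ from hw.2] at this
  · obtain ⟨q, hqM, hq, hq0, hgen', hray⟩ := P.exists_far_left M
    rcases hε.ray_cases hq hgen' with h' | h' | h'
    · exact absurd h' hray
    · exact ⟨q, hqM, hJ.trans ((h 0).trans (h' 0).symm)⟩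
    · have h1 := h' 0
      rw [← wind_eq_of_joined (h 0), ← wind_eq_of_joined hJ, how, hq0] at h1
      simp at h1
  · have h1 := h 0
    rw [← wind_eq_of_joined hJ, how] at h1
    rcases P.wind_eq_zero_or_one (P.cornerStart ε 0) with h2 | h2 <;> rw [h2] at h1 <;> simp at h1

/-- Where an open quadrant is locally outside the polygon, but its two sides are inside, the sides
are the edges at a vertex, and as the exterior is on the right of both of them, it is reflex. -/
lemma exists_isReflex {z : Plane} {s t δ : ℝ} (hs : s = 1 ∨ s = -1) (ht : t = 1 ∨ t = -1)
    (hδ : 0 < δ) (h1 : ∀ a ∈ Icc 0 δ, (z.1, z.2 + t * a) ∈ P.region)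
    (h2 : ∀ a ∈ Icc 0 δ, (z.1 + s * a, z.2) ∈ P.region)
    (h3 : ∀ a ∈ Ioc 0 δ, ∀ b ∈ Ioc 0 δ, (z.1 + s * a, z.2 + t * b) ∉ P.region) :
    ∃ k, P.IsReflex k ∧ P.vertex k = z := by
  have habs : ∀ {σ : ℝ}, (σ = 1 ∨ σ = -1) → ∀ a : ℝ, |σ * a| = |a| := by
    rintro σ (rfl | rfl) a <;> simp
  have hne : ∀ {σ : ℝ}, (σ = 1 ∨ σ = -1) → ∀ {a : ℝ}, 0 < a → ∀ x : ℝ, x + σ * a ≠ x := by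
    rintro σ (rfl | rfl) a ha x <;> simp [ha.ne']
  obtain ⟨ε, hε, hn⟩ := P.exists_near z
  set a := min ε δ with ha
  have ha0 : 0 < a := lt_min hε hδ
  have haδ : a ≤ δ := min_le_right _ _
  have hn : ∀ x y : ℝ, |x| ≤ a → |y| ≤ a → P.Near z (z.1 + x, z.2 + y) := fun x y hx hy =>
    hn x y (hx.trans (min_le_left _ _)) (hy.trans (min_le_left _ _))
  have haa : |a| ≤ a := (abs_of_pos ha0).le
  -- the two sides of the quadrant belong to the boundary
  have hbd : ∀ q, q ∈ P.region → (∀ η > 0, ∃ x y : ℝ, |x| ≤ η ∧ |y| ≤ η ∧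
      (q.1 + x, q.2 + y) ∉ P.region) → q ∈ P.boundary := by
    intro q hq hex
    by_contra hqb
    obtain ⟨η, hη, hnq⟩ := P.exists_near q
    obtain ⟨x, y, hx, hy, hxy⟩ := hex η hη
    have hw := (hnq x y hx hy).wind_eq hqb
    have := P.mem_region_iff_wind.1 hq
    rw [P.notMem_region_iff, hw] at hxy
    rcases this with h | h
    · exact hqb h
    · rw [h] at hxy; exact one_ne_zero hxy.2
  have hq1 : (z.1 + s * a, z.2) ∈ P.boundary := by
    refine hbd _ (h2 a ⟨ha0.le, haδ⟩) fun η hη => ⟨0, t * min η a, by simpa using hη.le, ?_, ?_⟩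
    · rw [habs ht, abs_of_pos (lt_min hη ha0)]; exact min_le_left _ _
    · simpa using h3 a ⟨ha0, haδ⟩ (min η a) ⟨lt_min hη ha0, (min_le_right _ _).trans haδ⟩
  have hq2 : (z.1, z.2 + t * a) ∈ P.boundary := by
    refine hbd _ (h1 a ⟨ha0.le, haδ⟩) fun η hη => ⟨s * min η a, 0, ?_, by simpa using hη.le, ?_⟩
    · rw [habs hs, abs_of_pos (lt_min hη ha0)]; exact min_le_left _ _
    · simpa using h3 (min η a) ⟨lt_min hη ha0, (min_le_right _ _).trans haδ⟩ a ⟨ha0, haδ⟩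
  obtain ⟨l, hl⟩ := P.mem_boundary_iff.1 hq1
  obtain ⟨m, hm⟩ := P.mem_boundary_iff.1 hq2
  have hn1 : P.Near z (z.1 + s * a, z.2) := by
    simpa using hn (s * a) 0 (by rw [habs hs]; exact haa) (by simpa using ha0.le)
  have hn2 : P.Near z (z.1, z.2 + t * a) := by
    simpa using hn 0 (t * a) (by simpa using ha0.le) (by rw [habs ht]; exact haa)
  have hx := hn1.fst_ne (hne hs ha0 _)
  have hy := hn2.snd_ne (hne ht ha0 _)
  have hlm := P.mem_edge_iff.1 hl
  have hmm := P.mem_edge_iff.1 hm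
  have hlh : (P.vertex l).2 = (P.vertex (l + 1)).2 := by
    rcases P.axisParallel l with h | h
    · rw [← h, uIcc_self] at hlm; exact absurd (show _ = _ from hlm.1).symm (hx l)
    · exact h
  have hmv : (P.vertex m).1 = (P.vertex (m + 1)).1 := by
    rcases P.axisParallel m with h | h
    · exact h
    · rw [← h, uIcc_self] at hmm; exact absurd (show _ = _ from hmm.2).symm (hy m)
  have hlz : (P.vertex l).2 = z.2 := by
    rw [← hlh, uIcc_self] at hlm; exact (show _ = _ from hlm.2).symm
  have hmz : (P.vertex m).1 = z.1 := by
    rw [← hmv, uIcc_self] at hmm; exact (show _ = _ from hmm.1).symm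
  -- the exterior quadrant is on the right side of the horizontal edge
  have hdir : ((P.vertex l).1 < (P.vertex (l + 1)).1 ↔ t = -1) := by
    obtain ⟨η, hη, hnq⟩ := P.exists_near (z.1 + s * a, z.2)
    set b := min η a with hb
    have hb0 : 0 < b := lt_min hη ha0
    have hbη : b ≤ η := min_le_left _ _
    have h0η : |(0 : ℝ)| ≤ η := by simpa using hη.le
    have hnb := hnq 0 b h0η (by rwa [abs_of_pos hb0])
    have hnb' := hnq 0 (-b) h0η (by rwa [abs_neg, abs_of_pos hb0])
    simp only [add_zero, ← sub_eq_add_neg] at hnb hnb'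
    have hcross := wind_sub_wind_of_horizontal hl hlh (hx l) (hx (l + 1)) (y := z.2 - b)
      (y' := z.2 + b) (by simp only; linarith) (by simp only; linarith) hnb' hnb
    have hout := (P.notMem_region_iff.1 (h3 a ⟨ha0, haδ⟩ b ⟨hb0, (min_le_right _ _).trans haδ⟩)).2
    simp only at hcross
    rcases ht with rfl | rfl
    · rw [one_mul] at hout
      rw [hout] at hcross
      rcases P.wind_eq_zero_or_one (z.1 + s * a, z.2 - b) with h | h <;> rw [h] at hcross <;>
        split_ifs at hcross with h4 <;> simp at hcross <;> simp [h4] <;> norm_num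
    · rw [neg_one_mul, ← sub_eq_add_neg] at hout
      rw [hout] at hcross
      rcases P.wind_eq_zero_or_one (z.1 + s * a, z.2 + b) with h | h <;> rw [h] at hcross <;>
        split_ifs at hcross with h4 <;> simp at hcross <;> simp [h4]
  have hsa : 0 < |a| := abs_pos.2 ha0.ne'
  rcases P.simple l m z (hn1.mem_edge hl) (hn2.mem_edge hm) with rfl | ⟨rfl, hz⟩ | ⟨rfl, hz⟩
  · exact absurd (Prod.ext hmv hlh) (P.vertex_ne l)
  · refine ⟨l + 1, ?_, hz.symm⟩
    rw [IsReflex, add_sub_cancel_right, ← hz, hlz, sub_self, zero_mul, sub_zero]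
    rw [← hz] at hdir hmm hlm
    have hA := hlm.1
    have hB := hmm.2
    rcases hs with rfl | rfl <;> rcases ht with rfl | rfl <;> norm_num at hdir <;>
      rcases mem_uIcc.1 hA with hA | hA <;> rcases mem_uIcc.1 hB with hB | hB <;>
      simp only at hA hB <;> first | (exfalso; linarith) | nlinarith
  · refine ⟨m + 1, ?_, hz.symm⟩
    rw [IsReflex, add_sub_cancel_right, ← hz, hmz, sub_self, zero_mul, zero_sub]
    rw [← hz] at hdir hmm hlm
    have hA := hlm.1
    have hB := hmm.2
    rcases hs with rfl | rfl <;> rcases ht with rfl | rfl <;> norm_num at hdir <;>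
      rcases mem_uIcc.1 hA with hA | hA <;> rcases mem_uIcc.1 hB with hB | hB <;>
      simp only at hA hB <;> first | (exfalso; linarith) | nlinarith

variable (P) in
/-- The reflex vertices, as a set of points. -/
def reflexVertices : Set Plane := {z | ∃ k, P.IsReflex k ∧ P.vertex k = z}

variable (P) in
theorem isRegion : IsRegion P.region P.reflexVertices where
  isClosed := ⟨P.isOpen_compl_region⟩
  isTame := P.isTame_region
  bounded := P.bounded_region
  exterior _ ho M := exists_joined_far ho M
  reflex _ _ _ hs ht _ hδ h1 h2 h3 := exists_isReflex hs ht hδ h1 h2 h3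

end SimpleOrthogonalPolygon

namespace OrthoPlane

/-! ### Symmetries of the coordinate axes -/

lemma segment_apply_apply (ψ : Plane ≃L[ℝ] Plane) (x y : Plane) :
    segment ℝ (ψ x) (ψ y) = ψ '' segment ℝ x y :=
  (image_segment ℝ (ψ : Plane →ₗ[ℝ] Plane).toAffineMap x y).symm

lemma OrthoJoined.map {O O' : Set Plane} (ψ : Plane ≃L[ℝ] Plane)
    (hax : ∀ a b, AxisParallel a b → AxisParallel (ψ a) (ψ b)) (hO : ∀ p ∈ O, ψ p ∈ O') {a b : Plane}
    (h : OrthoJoined O a b) : OrthoJoined O' (ψ a) (ψ b) := by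
  have key : ∀ x y, AxisParallel x y ∧ segment ℝ x y ⊆ O →
      AxisParallel (ψ x) (ψ y) ∧ segment ℝ (ψ x) (ψ y) ⊆ O' := by
    intro x y hxy
    refine ⟨hax x y hxy.1, ?_⟩
    rw [segment_apply_apply]
    rintro _ ⟨w, hw, rfl⟩
    exact hO w (hxy.2 hw)
  exact Relation.ReflTransGen.lift ψ key _ _ h

/-- Exchange of the coordinates. -/
noncomputable def swap : Plane ≃L[ℝ] Plane := ContinuousLinearEquiv.prodComm ℝ ℝ ℝ

/-- The reflection in the vertical axis. -/
noncomputable def negFst : Plane ≃L[ℝ] Plane :=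
  (ContinuousLinearEquiv.neg ℝ).prodCongr (ContinuousLinearEquiv.refl ℝ ℝ)

@[simp] lemma swap_apply (p : Plane) : swap p = (p.2, p.1) := rfl

@[simp] lemma negFst_apply (p : Plane) : negFst p = (-p.1, p.2) := rfl

variable {R V : Set Plane}

lemma IsTame.swap {A : Set Plane} (hA : IsTame A) : IsTame (OrthoPlane.swap ⁻¹' A) := by
  obtain ⟨X, Y, h⟩ := hA
  exact ⟨Y, X, fun p p' h1 h2 => h (OrthoPlane.swap p) (OrthoPlane.swap p') h2 h1⟩

lemma IsTame.negFst {A : Set Plane} (hA : IsTame A) : IsTame (OrthoPlane.negFst ⁻¹' A) := by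
  classical
  obtain ⟨X, Y, h⟩ := hA
  refine ⟨X.image Neg.neg, Y, fun p p' h1 h2 =>
    h (OrthoPlane.negFst p) (OrthoPlane.negFst p') (fun c hc => ?_) h2⟩
  have := h1 (-c) (Finset.mem_image_of_mem _ hc)
  simp only [negFst_apply]
  rw [lt_neg, neg_lt, lt_neg (a := c), neg_lt (b := c)]
  exact ⟨this.2, this.1⟩

lemma IsRegion.swap (hR : IsRegion R V) :
    IsRegion (OrthoPlane.swap ⁻¹' R) (OrthoPlane.swap ⁻¹' V) where
  isClosed := hR.isClosed.preimage OrthoPlane.swap.continuous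
  isTame := hR.isTame.swap
  bounded := by
    obtain ⟨M, hM⟩ := hR.bounded
    refine ⟨M, fun p hp => ?_⟩
    have := hM _ hp
    rwa [swap_apply, Prod.norm_def, max_comm] at this
  exterior o ho M := by
    obtain ⟨o', h1, h2⟩ := hR.exterior _ ho M
    refine ⟨OrthoPlane.swap o', ?_, ?_⟩
    · rwa [swap_apply, Prod.norm_def, max_comm]
    · exact OrthoJoined.map (O := Rᶜ) (O' := (OrthoPlane.swap ⁻¹' R)ᶜ) OrthoPlane.swap
        (fun a b h => Or.symm h) (fun p hp => hp) h2
  reflex z s t hs ht δ hδ h1 h2 h3 :=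
    hR.reflex (OrthoPlane.swap z) t s ht hs δ hδ h2 h1 fun a ha b hb => h3 b hb a ha

lemma IsRegion.negFst (hR : IsRegion R V) :
    IsRegion (OrthoPlane.negFst ⁻¹' R) (OrthoPlane.negFst ⁻¹' V) where
  isClosed := hR.isClosed.preimage OrthoPlane.negFst.continuous
  isTame := hR.isTame.negFst
  bounded := by
    obtain ⟨M, hM⟩ := hR.bounded
    refine ⟨M, fun p hp => ?_⟩
    have := hM _ hp
    rwa [negFst_apply, Prod.norm_def, norm_neg] at this
  exterior o ho M := by
    obtain ⟨o', h1, h2⟩ := hR.exterior _ ho M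
    refine ⟨OrthoPlane.negFst o', ?_, ?_⟩
    · rwa [negFst_apply, Prod.norm_def, norm_neg]
    · have := OrthoJoined.map (O' := (OrthoPlane.negFst ⁻¹' R)ᶜ) OrthoPlane.negFst
        (fun a b h => h.imp (congrArg Neg.neg) id) (fun p hp => by simpa using hp) h2
      simpa using this
  reflex z s t hs ht δ hδ h1 h2 h3 := by
    have key : ∀ a y : ℝ, OrthoPlane.negFst (z.1 + s * a, y) = (-z.1 + -s * a, y) := fun a y => by
      simp only [negFst_apply]; congr 1; ring
    refine hR.reflex (OrthoPlane.negFst z) (-s) t ?_ ht δ hδ h1 (fun a ha => ?_) fun a ha b hb => ?_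
    · rcases hs with rfl | rfl <;> simp
    · have := h2 a ha
      rwa [mem_preimage, key] at this
    · have := h3 a ha b hb
      rwa [mem_preimage, key] at this

lemma separated_preimage_iff (ψ : Plane ≃L[ℝ] Plane) {D : Set Plane} {w : Plane} :
    Separated (ψ ⁻¹' R) (ψ ⁻¹' D) w ↔ Separated R D (ψ w) := by
  have h : nhdsWithin (ψ w) R = Filter.map ψ (nhdsWithin w (ψ ⁻¹' R)) := by
    have := ψ.toHomeomorph.isEmbedding.map_nhdsWithin_eq (ψ ⁻¹' R) w
    rw [ContinuousLinearEquiv.coe_toHomeomorph, image_preimage_eq R ψ.surjective] at this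
    exact this.symm
  rw [Separated, Separated, h, Filter.eventually_map, Filter.eventually_map]
  rfl

lemma isTame_verticalSight (hR : IsTame R) (q : Plane) : IsTame (verticalSight R q) := by
  classical
  obtain ⟨X, Y, h⟩ := hR
  have hcell : ∀ (Y : Finset ℝ) (y y' b w : ℝ), SameCell (insert b Y) y y' → w ∈ uIcc y' b →
      ∃ u ∈ uIcc y b, SameCell Y w u := by
    intro Y y y' b w hyy hw
    by_cases hwy : w ∈ uIcc y b
    · exact ⟨w, hwy, fun _ _ => ⟨Iff.rfl, Iff.rfl⟩⟩
    refine ⟨y, left_mem_uIcc, fun c hc => ?_⟩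
    have h1 := hyy c (Finset.mem_insert_of_mem hc)
    have h2 := hyy b (Finset.mem_insert_self b Y)
    rw [mem_uIcc, not_or, not_and_or, not_and_or] at hwy
    rcases mem_uIcc.1 hw with ⟨h3, h4⟩ | ⟨h3, h4⟩
    · have h5 : w < y := by
        rcases hwy.1 with h | h
        · exact not_le.1 h
        · exact absurd h4 h
      exact ⟨⟨fun h => h.trans h5, fun h => (h1.1.1 h).trans_le h3⟩,
        ⟨fun h => h1.2.2 (h3.trans_lt h), fun h => h5.trans h⟩⟩
    · have h5 : y < w := by
        rcases hwy.2 with h | h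
        · exact absurd h3 h
        · exact not_le.1 h
      exact ⟨⟨fun h => h1.1.2 (h.trans_le h4), fun h => h.trans h5⟩,
        ⟨fun h => h5.trans h, fun h => h4.trans_lt (h1.2.1 h)⟩⟩
  have key : ∀ p p' : Plane, SameCell (insert q.1 X) p.1 p'.1 → SameCell (insert q.2 Y) p.2 p'.2 →
      p ∈ verticalSight R q → p' ∈ verticalSight R q := by
    intro p p' h1 h2 hp
    have h3 := h1 q.1 (Finset.mem_insert_self _ _)
    rw [hp.1] at h3
    refine ⟨le_antisymm (not_lt.1 fun h => lt_irrefl _ (h3.1.2 h))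
      (not_lt.1 fun h => lt_irrefl _ (h3.2.2 h)), fun w hw => ?_⟩
    obtain ⟨u, hu, hwu⟩ := hcell Y _ _ _ _ h2 hw
    exact (h (q.1, w) (q.1, u) (fun _ _ => ⟨Iff.rfl, Iff.rfl⟩) hwu).2 (hp.2 u hu)
  exact ⟨insert q.1 X, insert q.2 Y, fun p p' h1 h2 =>
    ⟨key p p' h1 h2, key p' p h1.symm h2.symm⟩⟩

end OrthoPlane

namespace SlidingRobots

open OrthoPlane

variable {n : ℕ} [NeZero n] {P : SimpleOrthogonalPolygon n} {ι : Type*} (S : SlidingRobots P ι)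

/-! ### Lines of sight -/

lemma mem_sight_self {i : ι} {q : Plane} (hq : q ∈ S.track i) : q ∈ S.sight i q := by
  refine ⟨?_, by simp⟩
  rw [segment_same, singleton_subset_iff]
  exact S.inside i hq

lemma sight_subset (i : ι) (q : Plane) : S.sight i q ⊆ P.region := fun _ hp =>
  hp.1 (left_mem_segment ℝ _ _)

lemma isClosed_setOf_mem_sight (i : ι) : IsClosed {x : Plane × Plane | x.1 ∈ S.sight i x.2} := by
  have h1 : {x : Plane × Plane | x.1 ∈ S.sight i x.2} =
      (⋂ t ∈ Icc (0 : ℝ) 1, {x : Plane × Plane | AffineMap.lineMap x.1 x.2 t ∈ P.region}) ∩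
      {x : Plane × Plane | (x.1.1 - x.2.1) * ((S.b i).1 - (S.a i).1) +
        (x.1.2 - x.2.2) * ((S.b i).2 - (S.a i).2) = 0} := by
    ext x
    simp only [sight, mem_ofPred_eq, mem_inter_iff, mem_iInter]
    rw [segment_eq_image_lineMap, image_subset_iff]
    rfl
  rw [h1]
  refine IsClosed.inter (isClosed_biInter fun t _ => P.isRegion.isClosed.preimage ?_) ?_
  · simp only [AffineMap.lineMap_apply]
    fun_prop
  · exact isClosed_eq (by fun_prop) continuous_const

lemma isClosed_sight (i : ι) (q : Plane) : IsClosed (S.sight i q) :=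
  (S.isClosed_setOf_mem_sight i).preimage (f := fun p : Plane => (p, q)) (by fun_prop)

/-- `ψ` is a symmetry of the coordinate axes that turns the track of robot `i` into a horizontal
one: the robot lives in the image of `ψ`, the arguments of `ψ` are the new coordinates. -/
structure IsFrame (i : ι) (ψ : Plane ≃L[ℝ] Plane) : Prop where
  isRegion : IsRegion (ψ ⁻¹' P.region) (ψ ⁻¹' P.reflexVertices)
  perpendicular : ∀ w w', ((ψ w).1 - (ψ w').1) * ((S.b i).1 - (S.a i).1) +
    ((ψ w).2 - (ψ w').2) * ((S.b i).2 - (S.a i).2) = 0 ↔ w.1 = w'.1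

variable {S}

lemma IsFrame.mem_sight_iff {i : ι} {ψ : Plane ≃L[ℝ] Plane} (h : S.IsFrame i ψ) {w q : Plane} :
    ψ w ∈ S.sight i (ψ q) ↔ w ∈ verticalSight (ψ ⁻¹' P.region) q := by
  simp only [sight, mem_ofPred_eq, verticalSight]
  rw [h.perpendicular, and_comm]
  refine and_congr_right fun h1 => ?_
  have hax : AxisParallel w q := Or.inl h1
  rw [segment_apply_apply, image_subset_iff]
  constructor
  · intro h2 y hy
    exact h2 (hax.mem_segment_iff.2 ⟨by rw [h1]; exact left_mem_uIcc, hy⟩)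
  · intro h2 u hu
    rw [hax.mem_segment_iff, h1, uIcc_self] at hu
    have := h2 u.2 hu.2
    rwa [← show u.1 = q.1 from hu.1] at this

variable (S) in
lemma mem_track_iff {i : ι} {q : Plane} : q ∈ S.track i ↔
    q.1 ∈ uIcc (S.a i).1 (S.b i).1 ∧ q.2 ∈ uIcc (S.a i).2 (S.b i).2 :=
  AxisParallel.mem_segment_iff (S.axisParallel i)

variable (S) in
/-- Coordinates in which the track of robot `i` is horizontal and `f` is to the right of `q`. -/
lemma exists_isFrame {i : ι} {q f : Plane} (hq : q ∈ S.track i) (hf : f ∈ S.track i)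
    (hqf : q ≠ f) : ∃ (ψ : Plane ≃L[ℝ] Plane) (c g h : ℝ), S.IsFrame i ψ ∧ c < g ∧ q = ψ (c, h) ∧
      f = ψ (g, h) := by
  rw [mem_track_iff] at hq hf
  obtain ⟨q1, q2⟩ := q
  obtain ⟨f1, f2⟩ := f
  rcases S.axisParallel i with h | h
  · have hne : (S.b i).2 - (S.a i).2 ≠ 0 := fun h' => S.ne i (Prod.ext h (sub_eq_zero.1 h').symm)
    rw [h, uIcc_self] at hq hf
    obtain rfl : q1 = _ := hq.1
    obtain rfl : f1 = _ := hf.1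
    have hqf : q2 ≠ f2 := fun h => hqf (by rw [h])
    rcases hqf.lt_or_gt with hlt | hlt
    · refine ⟨swap, q2, f2, _, ⟨P.isRegion.swap, fun w w' => ?_⟩, hlt, rfl, rfl⟩
      simp [h, hne, sub_eq_zero]
    · refine ⟨negFst.trans swap, -q2, -f2, (S.b i).1, ⟨P.isRegion.swap.negFst, fun w w' => ?_⟩,
        neg_lt_neg hlt, ?_, ?_⟩
      · simp only [ContinuousLinearEquiv.trans_apply, negFst_apply, swap_apply, h, sub_self, mul_zero,
          zero_add, mul_eq_zero, hne, or_false]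
        constructor <;> intro <;> linarith
      · simp
      · simp
  · have hne : (S.b i).1 - (S.a i).1 ≠ 0 := fun h' => S.ne i (Prod.ext (sub_eq_zero.1 h').symm h)
    rw [h, uIcc_self] at hq hf
    obtain rfl : q2 = _ := hq.2
    obtain rfl : f2 = _ := hf.2
    have hqf : q1 ≠ f1 := fun h => hqf (by rw [h])
    rcases hqf.lt_or_gt with hlt | hlt
    · refine ⟨ContinuousLinearEquiv.refl ℝ Plane, q1, f1, _, ⟨P.isRegion, fun w w' => ?_⟩, hlt,
        rfl, rfl⟩
      simp [h, hne, sub_eq_zero]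
    · refine ⟨negFst, -q1, -f1, (S.b i).2, ⟨P.isRegion.negFst, fun w w' => ?_⟩,
        neg_lt_neg hlt, ?_, ?_⟩
      · simp only [negFst_apply, h, sub_self, mul_zero, add_zero, mul_eq_zero, hne, or_false]
        constructor <;> intro <;> linarith
      · simp
      · simp

variable (S) in
lemma isTame_sight (i : ι) (q : Plane) : IsTame (S.sight i q) := by
  have key : ∀ ψ : Plane ≃L[ℝ] Plane, S.IsFrame i ψ → ∀ q, ψ ⁻¹' (S.sight i (ψ q)) =
      verticalSight (ψ ⁻¹' P.region) q := fun ψ h q => by ext w; exact h.mem_sight_iff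
  rcases S.axisParallel i with h | h
  · have hne : (S.b i).2 - (S.a i).2 ≠ 0 := fun h' => S.ne i (Prod.ext h (sub_eq_zero.1 h').symm)
    have hf : S.IsFrame i swap := ⟨P.isRegion.swap, fun w w' => by simp [h, hne, sub_eq_zero]⟩
    have := key swap hf (swap q)
    have h2 := (isTame_verticalSight hf.isRegion.isTame (swap q)).swap
    rw [← this] at h2
    exact h2
  · have hne : (S.b i).1 - (S.a i).1 ≠ 0 := fun h' => S.ne i (Prod.ext (sub_eq_zero.1 h').symm h)
    have hf : S.IsFrame i (ContinuousLinearEquiv.refl ℝ Plane) :=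
      ⟨P.isRegion, fun w w' => by simp [h, hne, sub_eq_zero]⟩
    have := key _ hf q
    have h2 := isTame_verticalSight hf.isRegion.isTame q
    rw [← this] at h2
    exact h2

variable (S) in
/-- The line of sight determines the position on the track. -/
lemma eq_of_mem_sight {i : ι} {q q' p : Plane} (hq : q ∈ S.track i) (hq' : q' ∈ S.track i)
    (h : p ∈ S.sight i q) (h' : p ∈ S.sight i q') : q = q' := by
  by_contra hne
  obtain ⟨ψ, c, g, y, hψ, hcg, rfl, rfl⟩ := S.exists_isFrame hq hq' hne
  obtain ⟨w, rfl⟩ := ψ.surjective p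
  rw [hψ.mem_sight_iff] at h h'
  exact hcg.ne (h.1.symm.trans h'.1)

/-- The sweep of a robot from `q` to `q'` on its way to `f`, in the original coordinates. -/
theorem separated_diff_swept {i : ι} {B D : Set Plane} {q q' f : Plane} (hq : q ∈ S.track i)
    (hf : f ∈ S.track i) (hq' : q' ∈ segment ℝ q f) (hqq : q ≠ q') (hDR : D ⊆ P.region)
    (hDq : Disjoint D (S.sight i q))
    (hsep : ∀ z ∈ P.region, z ∉ B → z ∉ S.sight i q → Separated P.region D z)
    (hcomp : ∀ z ∈ D, ∃ p ∈ connectedComponentIn D z, ∃ r ∈ segment ℝ q f, p ∈ S.sight i r)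
    (hV : ∀ k, P.IsReflex k → ∀ r ∈ openSegment ℝ q q', P.vertex k ∉ S.sight i r) {z : Plane}
    (hzR : z ∈ P.region) (hzB : z ∉ B) (hz : z ∉ S.sight i q') :
    Separated P.region (D \ S.swept i q q') z := by
  have hqf : q ≠ f := by
    rintro rfl
    rw [segment_same] at hq'
    exact hqq hq'.symm
  obtain ⟨ψ, c, g, h, hψ, hcg, rfl, rfl⟩ := S.exists_isFrame hq hf hqf
  have hax : AxisParallel (c, h) (g, h) := Or.inr rfl
  have hseg : ∀ p, p ∈ segment ℝ (ψ (c, h)) (ψ (g, h)) ↔ ∃ x ∈ Icc c g, p = ψ (x, h) := by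
    intro p
    rw [segment_apply_apply]
    constructor
    · rintro ⟨w, hw, rfl⟩
      rw [hax.mem_segment_iff, uIcc_self, uIcc_of_le hcg.le] at hw
      exact ⟨w.1, hw.1, congrArg ψ (Prod.ext rfl hw.2)⟩
    · rintro ⟨x, hx, rfl⟩
      exact ⟨(x, h), hax.mem_segment_iff.2 ⟨mem_uIcc.2 (Or.inl hx), left_mem_uIcc⟩, rfl⟩
  obtain ⟨r, ⟨hcr, hrg⟩, rfl⟩ := (hseg q').1 hq'
  have hcr : c < r := lt_of_le_of_ne hcr fun h => hqq (by rw [h])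
  have hax' : AxisParallel (c, h) (r, h) := Or.inr rfl
  obtain ⟨w, rfl⟩ := ψ.surjective z
  have hseg' : ∀ p, p ∈ segment ℝ (ψ (c, h)) (ψ (r, h)) ↔ ∃ x ∈ Icc c r, p = ψ (x, h) := by
    intro p
    rw [segment_apply_apply]
    constructor
    · rintro ⟨w, hw, rfl⟩
      rw [hax'.mem_segment_iff, uIcc_self, uIcc_of_le hcr.le] at hw
      exact ⟨w.1, hw.1, congrArg ψ (Prod.ext rfl hw.2)⟩
    · rintro ⟨x, hx, rfl⟩
      exact ⟨(x, h), hax'.mem_segment_iff.2 ⟨mem_uIcc.2 (Or.inl hx), left_mem_uIcc⟩, rfl⟩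
  have hswept : ψ ⁻¹' (S.swept i (ψ (c, h)) (ψ (r, h))) = sweep (ψ ⁻¹' P.region) h c r := by
    ext u
    simp only [swept, mem_preimage, mem_iUnion, exists_prop, hseg']
    constructor
    · rintro ⟨_, ⟨x, hx, rfl⟩, hu⟩
      rw [hψ.mem_sight_iff, mem_verticalSight_iff] at hu
      exact ⟨hu.1 ▸ hx.1, hu.1 ▸ hx.2, hu.2⟩
    · rintro ⟨h1, h2, h3⟩
      exact ⟨_, ⟨u.1, ⟨h1, h2⟩, rfl⟩, hψ.mem_sight_iff.2 (mem_verticalSight_iff.2 ⟨rfl, h3⟩)⟩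
  rw [← separated_preimage_iff, preimage_sdiff, hswept]
  refine hψ.isRegion.separated_diff_sweep (B := ψ ⁻¹' B) (g := g) hcr hrg ?_ (preimage_mono hDR)
    ?_ ?_ ?_ ?_ hzR hzB ?_
  · intro x hx
    refine S.inside i ?_
    exact (convex_segment _ _).segment_subset hq hf ((hseg _).2 ⟨x, hx, rfl⟩)
  · intro p hp hps
    exact disjoint_left.1 hDq hp (hψ.mem_sight_iff.2 hps)
  · intro p hpR hpB hps
    exact (separated_preimage_iff ψ).2 (hsep _ hpR hpB fun h => hps (hψ.mem_sight_iff.1 h))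
  · intro p hp
    obtain ⟨u, hu, r', hr', hur⟩ := hcomp (ψ p) hp
    obtain ⟨x, hx, rfl⟩ := (hseg r').1 hr'
    obtain ⟨u, rfl⟩ := ψ.surjective u
    have hcx : c ≠ x := by
      rintro rfl
      exact disjoint_left.1 hDq (connectedComponentIn_subset _ _ hu) hur
    rw [hψ.mem_sight_iff, mem_verticalSight_iff] at hur
    refine ⟨u, ?_, hur.1 ▸ lt_of_le_of_ne hx.1 hcx, hur.1 ▸ hx.2, hur.2⟩
    have h1 := ψ.toHomeomorph.image_connectedComponentIn (s := ψ ⁻¹' D) (x := p) hp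
    rw [ContinuousLinearEquiv.coe_toHomeomorph, image_preimage_eq D ψ.surjective] at h1
    rw [← h1] at hu
    obtain ⟨u', hu', h2⟩ := hu
    rwa [← ψ.injective h2]
  · rintro v ⟨k, hk, hkv⟩ h1 h2 h3
    refine hV k hk (ψ (v.1, h)) ?_ ?_
    · have : openSegment ℝ (ψ (c, h)) (ψ (r, h)) = ψ '' openSegment ℝ (c, h) (r, h) :=
        (image_openSegment ℝ (ψ : Plane →ₗ[ℝ] Plane).toAffineMap _ _).symm
      rw [this, ← Prod.image_mk_openSegment_left, openSegment_eq_Ioo hcr]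
      exact ⟨_, ⟨v.1, ⟨h1, h2⟩, rfl⟩, rfl⟩
    · rw [hkv, hψ.mem_sight_iff, mem_verticalSight_iff]
      exact ⟨rfl, h3⟩
  · intro hw
    exact hz (hψ.mem_sight_iff.2 hw)

/-- The points that robot `i` sees at some time of `[0, t]` while it moves from `q` to `q'`. -/
lemma mem_swept_lineMap {i : ι} {q q' p : Plane} {t : ℝ} (ht : 0 ≤ t) :
    p ∈ S.swept i q (AffineMap.lineMap q q' t) ↔
      ∃ τ ∈ Icc 0 t, p ∈ S.sight i (AffineMap.lineMap q q' τ) := by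
  simp only [swept, mem_iUnion, exists_prop]
  constructor
  · rintro ⟨r, hr, hp⟩
    rw [segment_eq_image_lineMap] at hr
    obtain ⟨u, hu, rfl⟩ := hr
    refine ⟨u * t, ⟨mul_nonneg hu.1 ht, mul_le_of_le_one_left ht hu.2⟩, ?_⟩
    convert hp using 2
    simp only [AffineMap.lineMap_apply, vsub_eq_sub, vadd_eq_add, add_sub_cancel_right, smul_smul]
  · rintro ⟨τ, hτ, hp⟩
    refine ⟨_, ?_, hp⟩
    rcases eq_or_lt_of_le ht with rfl | ht
    · obtain rfl : τ = 0 := le_antisymm hτ.2 hτ.1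
      exact right_mem_segment ℝ _ _
    rw [segment_eq_image_lineMap]
    refine ⟨τ / t, ⟨div_nonneg hτ.1 ht.le, div_le_one_of_le₀ hτ.2 ht.le⟩, ?_⟩
    simp only [AffineMap.lineMap_apply, vsub_eq_sub, vadd_eq_add, add_sub_cancel_right, smul_smul]
    rw [div_mul_cancel₀ _ ht.ne']

/-- An evader that stays unseen by a sweeping robot, and off `B`, cannot leave the part still to be
cleared, which shrinks during the sweep. -/
theorem mem_diff_swept_of_path {i : ι} {B D : Set Plane} {q q' : Plane}
    (hsep : ∀ r ∈ segment ℝ q q', ∀ z ∈ P.region, z ∉ B → z ∉ S.sight i r →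
      Separated P.region (D \ S.swept i q r) z)
    {γ : ℝ → Plane} (hγ : ContinuousOn γ (Icc 0 1)) (hγR : ∀ t ∈ Icc (0 : ℝ) 1, γ t ∈ P.region)
    (hγB : ∀ t ∈ Icc (0 : ℝ) 1, γ t ∉ B)
    (hγi : ∀ t ∈ Icc (0 : ℝ) 1, γ t ∉ S.sight i (AffineMap.lineMap q q' t)) (h0 : γ 0 ∈ D) :
    γ 1 ∈ D \ S.swept i q q' := by
  let F : ℝ → Set Plane := fun t => D \ S.swept i q (AffineMap.lineMap q q' t)
  have h00 : (0 : ℝ) ∈ Icc (0 : ℝ) 1 := by simp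
  have h01 : (1 : ℝ) ∈ Icc (0 : ℝ) 1 := by simp
  have hloc : ∀ t ∈ Icc (0 : ℝ) 1, ∀ᶠ t' in nhdsWithin t (Icc 0 1),
      (γ t ∈ F t ↔ γ t' ∈ F t') := by
    intro t ht
    have hsept := hsep (AffineMap.lineMap q q' t)
      (by rw [segment_eq_image_lineMap]; exact mem_image_of_mem _ ht) _ (hγR t ht) (hγB t ht)
      (hγi t ht)
    have hγt : Filter.Tendsto γ (nhdsWithin t (Icc 0 1)) (nhdsWithin (γ t) P.region) :=
      tendsto_nhdsWithin_iff.2 ⟨hγ t ht, Filter.eventually_of_mem self_mem_nhdsWithin hγR⟩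
    have h1 : ∀ᶠ t' in nhdsWithin t (Icc 0 1), (γ t ∈ F t ↔ γ t' ∈ F t) := by
      rcases hsept with h | h
      · have h2 := h.self_of_nhdsWithin (hγR t ht)
        filter_upwards [hγt.eventually h] with t' ht'
        exact iff_of_true h2 ht'
      · have h2 := h.self_of_nhdsWithin (hγR t ht)
        filter_upwards [hγt.eventually h] with t' ht'
        exact iff_of_false h2 ht'
    -- Shortly before and after the time `t` the points near `γ t` are not seen.
    have h2 : ∀ᶠ x : Plane × ℝ in nhds (γ t) ×ˢ nhds t,
        x.1 ∉ S.sight i (AffineMap.lineMap q q' x.2) := by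
      rw [← nhds_prod_eq]
      have hcont : Continuous fun x : Plane × ℝ => (x.1, (AffineMap.lineMap q q' x.2 : Plane)) := by
        simp only [AffineMap.lineMap_apply]
        fun_prop
      exact ((S.isClosed_setOf_mem_sight i).preimage hcont).isOpen_compl.eventually_mem (hγi t ht)
    obtain ⟨p₁, hp₁, p₂, hp₂, h12⟩ := Filter.eventually_prod_iff.1 h2
    obtain ⟨ε, hε, hball⟩ := Metric.eventually_nhds_iff.1 hp₂
    filter_upwards [h1, (hγ t ht).eventually hp₁, self_mem_nhdsWithin,
      mem_nhdsWithin_of_mem_nhds (Metric.ball_mem_nhds t hε)] with t' h1 h3 ht' h4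
    rw [h1]
    refine and_congr_right fun _ => not_congr ?_
    rw [mem_swept_lineMap ht.1, mem_swept_lineMap ht'.1]
    rw [Metric.mem_ball, Real.dist_eq, abs_lt] at h4
    constructor
    · rintro ⟨τ, hτ, h⟩
      rcases le_or_gt τ t' with h5 | h5
      · exact ⟨τ, ⟨hτ.1, h5⟩, h⟩
      · refine absurd h (h12 h3 (hball ?_))
        rw [Real.dist_eq, abs_lt]
        constructor <;> linarith [hτ.2]
    · rintro ⟨τ, hτ, h⟩
      rcases le_or_gt τ t with h5 | h5
      · exact ⟨τ, ⟨hτ.1, h5⟩, h⟩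
      · refine absurd h (h12 h3 (hball ?_))
        rw [Real.dist_eq, abs_lt]
        constructor <;> linarith [hτ.2]
  have hmain : γ 0 ∈ F 0 ↔ γ 1 ∈ F 1 :=
    isPreconnected_Icc.induction₂ (fun t t' => γ t ∈ F t ↔ γ t' ∈ F t') hloc
      (fun _ _ _ _ _ _ h h' => h.trans h') (fun _ _ _ _ h => h.symm) h00 h01
  have h1 : γ 1 ∈ F 1 := by
    refine hmain.1 ⟨h0, fun h => ?_⟩
    rw [mem_swept_lineMap le_rfl] at h
    obtain ⟨τ, hτ, h⟩ := h
    obtain rfl : τ = 0 := le_antisymm hτ.2 hτ.1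
    exact hγi 0 h00 h
  simpa only [F, AffineMap.lineMap_apply_one] using h1

end SlidingRobots

namespace SlidingRobots

open OrthoPlane

variable {n : ℕ} [NeZero n] {P : SimpleOrthogonalPolygon n} {ι : Type*} (S : SlidingRobots P ι)

/-! ### The invariant of the algorithm -/

/-- The part of the polygon seen by the robots of the list `l` from their present positions. -/
def watched (s : PursuitState ι) (l : List ι) : Set Plane := ⋃ w ∈ l, S.sight w (s.pos w)

/-- The part of the polygon that a robot has to clear when the list of the robots waiting for it is
`l`: all of the polygon if there are none, and otherwise the pocket of the first one. -/
def task (s : PursuitState ι) : List ι → Set Plane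
  | [] => P.region
  | j :: _ => s.D3 j

/-- What is true of a robot `x` of the chain, if the robots below it are `lower`: the part `D2 x` of
its task, which it has not yet cleared, is invisible from the positions it has swept, and is bounded
by the lines of sight of `x` and of the robots below. -/
structure Level (s : PursuitState ι) (x : ι) (lower : List ι) : Prop where
  notMem : x ∉ lower
  pos_mem : s.pos x ∈ S.track x
  ends : S.AreEnds x (s.back x) (s.goal x)
  D2_subset : s.D2 x ⊆ task (P := P) s lower
  subset_union : task (P := P) s lower ⊆ s.D1 x ∪ s.D2 x
  nonempty : lower ≠ [] → (task (P := P) s lower).Nonempty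
  unseen : ∀ r ∈ segment ℝ (s.back x) (s.pos x), Disjoint (s.D2 x) (S.sight x r)
  separated : ∀ z ∈ P.region, z ∉ S.watched s (x :: lower) → Separated P.region (s.D2 x) z
  pocket : s.D3 x = ∅ ∨ S.IsPocket s x (s.D3 x)

/-- Each robot of the list is in the situation described by `Level`, relative to those below it. -/
def Valid (s : PursuitState ι) : List ι → Prop
  | [] => True
  | x :: lower => S.Level s x lower ∧ Valid s lower

/-- The region that the robots of a chain have not yet cleared: the head is responsible for all of
its `D2`, the others for what lies outside the pocket that they have handed on. -/
def uncleared (s : PursuitState ι) : List ι → Set Plane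
  | [] => ∅
  | x :: lower => s.D2 x ∪ ⋃ w ∈ lower, s.D2 w \ s.D3 w

/-- The invariant of the algorithm. -/
structure Invariant (s : PursuitState ι) : Prop where
  valid : S.Valid s s.chain
  idle : ∀ w ∉ s.chain, s.D2 w = ∅ ∧ s.D3 w = ∅
  D1_subset : ∀ w, s.D1 w ⊆ P.region
  disjoint : ∀ w, Disjoint (s.D1 w) (uncleared s s.chain)
  contaminated : ∀ p ∈ s.contaminated, p ∉ S.watched s s.chain → p ∈ uncleared s s.chain
  finished : s.chain = [] → P.region ⊆ ⋃ w, s.D1 w ∧ s.contaminated = ∅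

/-- The two states store the same data for the robots of `l`. -/
def Agree (s s' : PursuitState ι) (l : List ι) : Prop :=
  ∀ w ∈ l, s'.pos w = s.pos w ∧ s'.goal w = s.goal w ∧ s'.back w = s.back w ∧
    s'.D1 w = s.D1 w ∧ s'.D2 w = s.D2 w ∧ s'.D3 w = s.D3 w

variable {S} {s s' : PursuitState ι} {x : ι} {l lower : List ι}

lemma mem_watched {p : Plane} : p ∈ S.watched s l ↔ ∃ w ∈ l, p ∈ S.sight w (s.pos w) := by
  simp [watched]

lemma watched_cons : S.watched s (x :: l) = S.sight x (s.pos x) ∪ S.watched s l := by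
  ext p
  simp [mem_watched]

lemma Agree.tail (h : Agree s s' (x :: l)) : Agree s s' l := fun w hw =>
  h w (List.mem_cons_of_mem _ hw)

lemma Agree.watched_eq (h : Agree s s' l) : S.watched s' l = S.watched s l := by
  ext p
  simp only [mem_watched]
  exact exists_congr fun w => and_congr_right fun hw => by rw [(h w hw).1]

lemma Agree.task_eq (h : Agree s s' l) : task (P := P) s' l = task (P := P) s l := by
  cases l with
  | nil => rfl
  | cons j _ => exact (h j List.mem_cons_self).2.2.2.2.2

lemma Level.congr (h : Agree s s' (x :: lower)) (hx : S.Level s x lower) :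
    S.Level s' x lower := by
  obtain ⟨h1, h2, h3, h4, h5, h6⟩ := h x List.mem_cons_self
  obtain ⟨g1, g2, g3, g4, g5, g6, g7, g8, g9⟩ := hx
  rw [← h.tail.task_eq] at g4 g5 g6
  rw [← h.watched_eq, ← h5] at g8
  refine ⟨g1, h1 ▸ g2, by rwa [h2, h3], by rwa [h5], by rwa [h4, h5], g6, by rwa [h1, h3, h5], g8, ?_⟩
  rw [h6]
  refine g9.imp_right fun h => ?_
  rwa [IsPocket, h5]

lemma Valid.congr (h : Agree s s' l) (hl : S.Valid s l) : S.Valid s' l := by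
  induction l with
  | nil => trivial
  | cons x lower ih => exact ⟨hl.1.congr h, ih h.tail hl.2⟩

lemma IsPocket.nonempty {K : Set Plane} (h : S.IsPocket s x K) : K.Nonempty := by
  obtain ⟨⟨p, hp, rfl⟩, -⟩ := h
  exact ⟨p, mem_connectedComponentIn hp⟩

lemma IsPocket.subset {K : Set Plane} (h : S.IsPocket s x K) : K ⊆ s.D2 x := by
  obtain ⟨⟨p, hp, rfl⟩, -⟩ := h
  exact connectedComponentIn_subset _ _

lemma Level.D3_subset (h : S.Level s x lower) : s.D3 x ⊆ s.D2 x := by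
  rcases h.pocket with h | h
  · rw [h]
    exact empty_subset _
  · exact h.subset

lemma Level.disjoint_D3 (h : S.Level s x lower) :
    Disjoint (s.D3 x) (S.visibilityPolygon x) := by
  rcases h.pocket with h | h
  · rw [h]
    exact empty_disjoint _
  · exact h.2

lemma Level.separated_D3 (h : S.Level s x lower) {z : Plane} (hz : z ∈ P.region)
    (hw : z ∉ S.watched s (x :: lower)) : Separated P.region (s.D3 x) z := by
  rcases h.pocket with h' | ⟨⟨p, hp, h'⟩, -⟩
  · rw [h']
    exact Or.inr (Filter.Eventually.of_forall fun _ => notMem_empty _)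
  · rw [h']
    exact P.isRegion.separated_connectedComponentIn hz (h.separated z hz hw)

lemma Level.sight_subset_visibilityPolygon (h : S.Level s x lower) :
    S.sight x (s.pos x) ⊆ S.visibilityPolygon x :=
  subset_biUnion_of_mem (u := S.sight x) h.pos_mem

lemma Valid.nodup (h : S.Valid s l) : l.Nodup := by
  induction l with
  | nil => exact List.nodup_nil
  | cons x lower ih => exact List.nodup_cons.2 ⟨h.1.notMem, ih h.2⟩

/-- The pockets of a chain are nested. -/
lemma Valid.task_subset_D3 (h : S.Valid s l) {w : ι} (hw : w ∈ l) :
    task (P := P) s l ⊆ s.D3 w := by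
  induction l with
  | nil => simp at hw
  | cons x lower ih =>
    rcases List.mem_cons.1 hw with rfl | hw
    · exact subset_rfl
    · exact (h.1.D3_subset.trans h.1.D2_subset).trans (ih h.2 hw)

lemma Valid.task_subset_region (h : S.Valid s l) : task (P := P) s l ⊆ P.region := by
  induction l with
  | nil => exact subset_rfl
  | cons x lower ih => exact (h.1.D3_subset.trans h.1.D2_subset).trans (ih h.2)

lemma Valid.exists_level (h : S.Valid s l) {w : ι} (hw : w ∈ l) :
    ∃ lower, S.Level s w lower ∧ S.Valid s lower ∧ S.watched s (w :: lower) ⊆ S.watched s l := by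
  induction l with
  | nil => simp at hw
  | cons x lower ih =>
    rcases List.mem_cons.1 hw with rfl | hw
    · exact ⟨lower, h.1, h.2, subset_rfl⟩
    · obtain ⟨lower', h1, h2, h3⟩ := ih h.2 hw
      refine ⟨lower', h1, h2, h3.trans ?_⟩
      rw [watched_cons (x := x)]
      exact subset_union_right

lemma Valid.disjoint_task (h : S.Valid s l) {w : ι} (hw : w ∈ l) :
    Disjoint (task (P := P) s l) (S.visibilityPolygon w) := by
  obtain ⟨_, h1, -⟩ := h.exists_level hw
  exact h1.disjoint_D3.mono_left (h.task_subset_D3 hw)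

lemma Valid.disjoint_watched (h : S.Valid s (x :: lower)) :
    Disjoint (s.D2 x) (S.watched s (x :: lower)) := by
  rw [watched_cons, disjoint_union_right]
  refine ⟨h.1.unseen _ (right_mem_segment ℝ _ _), ?_⟩
  rw [watched, disjoint_iUnion₂_right]
  intro w hw
  obtain ⟨_, h1, -⟩ := h.2.exists_level hw
  exact ((h.2.disjoint_task hw).mono_left h.1.D2_subset).mono_right
    h1.sight_subset_visibilityPolygon

lemma isTame_watched : IsTame (S.watched s l) := by
  induction l with
  | nil => simpa [watched] using isTame_empty
  | cons x l ih =>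
    rw [watched_cons]
    exact (S.isTame_sight _ _).union ih

/-- An evader that stays off `B` cannot leave a set that is open and closed in the rest. -/
lemma mem_of_path {B E : Set Plane} (hsep : ∀ z ∈ P.region, z ∉ B → Separated P.region E z)
    {γ : ℝ → Plane} (hγ : ContinuousOn γ (Icc 0 1))
    (hγB : ∀ t ∈ Icc (0 : ℝ) 1, γ t ∈ P.region ∧ γ t ∉ B) (h0 : γ 0 ∈ E) : γ 1 ∈ E := by
  have h00 : (0 : ℝ) ∈ Icc (0 : ℝ) 1 := by simp
  have h01 : (1 : ℝ) ∈ Icc (0 : ℝ) 1 := by simp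
  refine (mem_iff_mem_of_isPreconnected (R := P.region) (isPreconnected_Icc.image γ hγ) ?_ ?_
    (mem_image_of_mem γ h00) (mem_image_of_mem γ h01)).1 h0
  · rintro _ ⟨t, ht, rfl⟩
    exact (hγB t ht).1
  · rintro _ ⟨t, ht, rfl⟩
    exact hsep _ (hγB t ht).1 (hγB t ht).2

/-- The parts that waiting robots have kept for themselves are not left by unseen evaders as long as
these robots stand still. -/
lemma Valid.mem_of_path (h : S.Valid s l) {w : ι} (hw : w ∈ l) {γ : ℝ → Plane}
    (hγ : ContinuousOn γ (Icc 0 1))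
    (hγB : ∀ t ∈ Icc (0 : ℝ) 1, γ t ∈ P.region ∧ γ t ∉ S.watched s l)
    (h0 : γ 0 ∈ s.D2 w \ s.D3 w) : γ 1 ∈ s.D2 w \ s.D3 w := by
  obtain ⟨_, h1, -, h3⟩ := h.exists_level hw
  exact SlidingRobots.mem_of_path (fun z hz hzB => (h1.separated z hz fun h => hzB (h3 h)).diff
    (h1.separated_D3 hz fun h => hzB (h3 h))) hγ hγB h0

lemma AreEnds.segment_eq {i : ι} {e f : Plane} (h : S.AreEnds i e f) :
    segment ℝ e f = S.track i := by
  rcases h with ⟨rfl, rfl⟩ | ⟨rfl, rfl⟩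
  · rfl
  · exact segment_symm ℝ _ _

variable (S) in
/-- Three positions on a track are collinear, whatever their order. -/
lemma mem_segment_or {i : ι} {e f q r : Plane} (he : e ∈ S.track i) (hq : q ∈ S.track i)
    (hf : f ∈ S.track i) (hr : r ∈ segment ℝ e f) : r ∈ segment ℝ e q ∨ r ∈ segment ℝ q f := by
  rw [mem_track_iff] at he hq hf
  rcases S.axisParallel i with h | h
  · rw [h, uIcc_self] at he hq hf
    have h1 : e.1 = q.1 := Eq.trans he.1 (Eq.symm hq.1)
    have h2 : q.1 = f.1 := Eq.trans hq.1 (Eq.symm hf.1)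
    rw [AxisParallel.mem_segment_iff (Or.inl (h1.trans h2))] at hr
    rw [AxisParallel.mem_segment_iff (Or.inl h1), AxisParallel.mem_segment_iff (Or.inl h2)]
    rw [← h2, h1] at hr
    rw [← h2, h1]
    exact (uIcc_subset_uIcc_union_uIcc hr.2).imp (fun h => ⟨hr.1, h⟩) fun h => ⟨hr.1, h⟩
  · rw [h, uIcc_self] at he hq hf
    have h1 : e.2 = q.2 := Eq.trans he.2 (Eq.symm hq.2)
    have h2 : q.2 = f.2 := Eq.trans hq.2 (Eq.symm hf.2)
    rw [AxisParallel.mem_segment_iff (Or.inr (h1.trans h2))] at hr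
    rw [AxisParallel.mem_segment_iff (Or.inr h1), AxisParallel.mem_segment_iff (Or.inr h2)]
    rw [← h2, h1] at hr
    rw [← h2, h1]
    exact (uIcc_subset_uIcc_union_uIcc hr.1).imp (fun h => ⟨h, hr.2⟩) fun h => ⟨h, hr.2⟩

lemma AreEnds.mem_or_mem {i : ι} {e f q r : Plane} (h : S.AreEnds i e f) (hq : q ∈ S.track i)
    (hr : r ∈ S.track i) : r ∈ segment ℝ e q ∨ r ∈ segment ℝ q f := by
  have h1 := h.segment_eq
  refine S.mem_segment_or (h1 ▸ left_mem_segment ℝ e f) hq (h1 ▸ right_mem_segment ℝ e f) ?_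
  rwa [h1]

/-- While a robot has no pocket to hand on, every piece of what it has to clear contains a point that
it sees on its way to its goal. -/
lemma Level.exists_mem_sight (h : S.Level s x lower) (hK : ∀ K, ¬ S.IsPocket s x K) {z : Plane}
    (hz : z ∈ s.D2 x) : ∃ p ∈ connectedComponentIn (s.D2 x) z,
      ∃ r ∈ segment ℝ (s.pos x) (s.goal x), p ∈ S.sight x r := by
  have h1 := hK (connectedComponentIn (s.D2 x) z)
  rw [IsPocket, not_and, not_disjoint_iff] at h1
  obtain ⟨p, hp, hpV⟩ := h1 ⟨z, hz, rfl⟩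
  simp only [visibilityPolygon, mem_iUnion, exists_prop] at hpV
  obtain ⟨r, hr, hpr⟩ := hpV
  refine ⟨p, hp, r, (h.ends.mem_or_mem h.pos_mem hr).resolve_left fun h2 => ?_, hpr⟩
  exact disjoint_left.1 (h.unseen r h2) (connectedComponentIn_subset _ _ hp) hpr

lemma dist_lt_of_mem_segment {a b r : Plane} (h : r ∈ segment ℝ a b) (hr : r ≠ b) :
    dist a r < dist a b := by
  rw [← dist_add_dist_of_mem_segment h]
  exact lt_add_of_pos_right _ (dist_pos.2 hr)

/-- What a robot has to clear remains open and closed off the lines of sight during a move to the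
next event point. -/
lemma Level.separated_diff_swept (h : S.Level s x lower) (hsub : s.D2 x ⊆ P.region)
    (hK : ∀ K, ¬ S.IsPocket s x K) {q' r : Plane} (hq : S.IsNextEvent s x q')
    (hr : r ∈ segment ℝ (s.pos x) q') {z : Plane} (hz : z ∈ P.region)
    (hzB : z ∉ S.watched s lower) (hzr : z ∉ S.sight x r) :
    Separated P.region (s.D2 x \ S.swept x (s.pos x) r) z := by
  obtain ⟨hq1, hq2, -, hq4⟩ := hq
  have hunseen := h.unseen _ (right_mem_segment ℝ _ _)
  have hsep : ∀ z ∈ P.region, z ∉ S.watched s lower → z ∉ S.sight x (s.pos x) →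
      Separated P.region (s.D2 x) z := fun z h1 h2 h3 => h.separated z h1 <| by
    rw [watched_cons]
    exact fun h => h.elim h3 h2
  rcases eq_or_ne (s.pos x) r with rfl | hne
  · have h1 : S.swept x (s.pos x) (s.pos x) = S.sight x (s.pos x) := by
      simp [swept]
    rw [h1, hunseen.sdiff_eq_left]
    exact hsep z hz hzB hzr
  have hgoal : s.goal x ∈ S.track x := by
    rw [← h.ends.segment_eq]
    exact right_mem_segment ℝ _ _
  refine SlidingRobots.separated_diff_swept (f := s.goal x) h.pos_mem hgoal ?_ hne hsub hunseen hsep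
    (fun z hz => h.exists_mem_sight hK hz) ?_ hz hzB hzr
  · exact (convex_segment _ _).segment_subset (left_mem_segment ℝ _ _) hq1 hr
  · intro k hk r' hr' hkr
    refine hq4 r' ?_ (Or.inl ⟨k, hk, hkr⟩)
    have h1 := openSegment_subset_segment ℝ _ _ hr'
    refine mem_openSegment_of_ne_left_right ?_ ?_
      ((convex_segment _ _).segment_subset (left_mem_segment ℝ _ _) hr h1)
    · rintro rfl
      exact hne (left_mem_openSegment_iff.1 hr')
    · rintro rfl
      have h2 : q' ≠ r := by
        rintro rfl
        exact hne (right_mem_openSegment_iff.1 hr')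
      have h3 := dist_lt_of_mem_segment h1 h2
      have h4 := dist_add_dist_of_mem_segment hr
      linarith [dist_nonneg (x := r) (y := q')]

end SlidingRobots

namespace SlidingRobots

open OrthoPlane

variable {n : ℕ} [NeZero n] {P : SimpleOrthogonalPolygon n} {ι : Type*} {S : SlidingRobots P ι}
  {s s' : PursuitState ι} {x : ι} {l lower : List ι}

/-! ### Preservation of the invariant -/

/-- The motion of an evader that no robot sees while the positions change from `pos` to `pos'`. -/
lemma exists_path_of_mem_evolve {pos pos' : ι → Plane} {C : Set Plane} {p : Plane}
    (hp : p ∈ S.evolve pos pos' C) : ∃ γ : ℝ → Plane, ContinuousOn γ (Icc 0 1) ∧ γ 0 ∈ C ∧ γ 1 = p ∧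
      (∀ t ∈ Icc (0 : ℝ) 1, γ t ∈ P.region) ∧ (∀ w, γ 0 ∉ S.sight w (pos w)) ∧
      (∀ w, γ 1 ∉ S.sight w (pos' w)) ∧ (∀ w, ∀ t ∈ Icc (0 : ℝ) 1,
        γ t ∉ S.sight w (AffineMap.lineMap (pos w) (pos' w) t)) := by
  obtain ⟨γ, h1, h2, h3, h4⟩ := hp
  refine ⟨γ, h1, h2, h3, fun t ht => (h4 t ht).1, fun w => ?_, fun w => ?_, fun w t ht => (h4 t ht).2 w⟩
  · simpa using (h4 0 (by simp)).2 w
  · simpa using (h4 1 (by simp)).2 w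

lemma mem_uncleared_cons {p : Plane} : p ∈ uncleared s (x :: lower) ↔
    p ∈ s.D2 x ∨ ∃ w ∈ lower, p ∈ s.D2 w \ s.D3 w := by
  simp only [uncleared, mem_union, mem_iUnion, exists_prop]

/-- What the head of a chain hands on does not overlap with what the robots of the chain keep. -/
lemma Valid.disjoint_kept (h : S.Valid s l) {w : ι} (hw : w ∈ l) :
    Disjoint (task (P := P) s l) (s.D2 w \ s.D3 w) :=
  disjoint_sdiff_right.mono_left (h.task_subset_D3 hw)

/-- An evader whom no robot sees at present is in the region not yet cleared. -/
lemma Invariant.mem_uncleared (h : S.Invariant s) ⦃p : Plane⦄ (hp : p ∈ s.contaminated)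
    (hw : ∀ w, p ∉ S.sight w (s.pos w)) : p ∈ uncleared s s.chain :=
  h.contaminated p hp fun h => by
    obtain ⟨w, -, h⟩ := mem_watched.1 h
    exact hw w h

/-- As long as the robots of `l` stand still, they watch the same points. -/
lemma notMem_watched_of_still {pos' : ι → Plane} {p : Plane} {t : ℝ} (h : ∀ w ∈ l, pos' w = s.pos w)
    (hp : ∀ w, p ∉ S.sight w (AffineMap.lineMap (s.pos w) (pos' w) t)) : p ∉ S.watched s l := by
  intro h'
  obtain ⟨w, hw, hpw⟩ := mem_watched.1 h'
  have := hp w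
  rw [h w hw, AffineMap.lineMap_same] at this
  exact this hpw

/-- The robots of the chain see nothing of the pocket of its head, so an answering robot is new. -/
theorem Invariant.notMem_of_canAnswer (h : S.Invariant s) {j m : ι} {q e f : Plane}
    {rest : List ι} (hchain : s.chain = j :: rest) (hm : S.CanAnswer s j m q e f) :
    m ∉ j :: rest := by
  intro hmem
  have hv := h.valid
  rw [hchain] at hv
  obtain ⟨p, hp, hpK⟩ := hm.1
  exact disjoint_left.1 (hv.disjoint_task hmem) hpK hp

/-- When `m` reports to `j`, what is removed from `D2 j` is exactly the pocket of `j`: all of it is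
recorded as cleared by `m`, and nothing of what `j` has kept for itself is. -/
theorem Invariant.D2_diff_D1 (h : S.Invariant s) {m j : ι} {rest : List ι}
    (hchain : s.chain = m :: j :: rest) (hD2 : s.D2 m = ∅) :
    s.D2 j \ s.D1 m = s.D2 j \ s.D3 j := by
  have hv := h.valid
  have h4 := h.disjoint m
  rw [hchain] at hv h4
  have h1 : s.D3 j ⊆ s.D1 m := by simpa [task, hD2] using hv.1.subset_union
  refine subset_antisymm (sdiff_subset_sdiff_right h1) fun p hp => ⟨hp.1, fun hp1 => ?_⟩
  exact disjoint_left.1 h4 hp1 (mem_uncleared_cons.2 (Or.inr ⟨j, List.mem_cons_self, hp⟩))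

section Steps

variable [DecidableEq ι]

open Function (update)

theorem Invariant.wait (h : S.Invariant s) {rest : List ι} {K : Set Plane}
    (hchain : s.chain = x :: rest) (hK : S.IsPocket s x K)
    (hs' : s' = { s with
      D3 := update s.D3 x K
      contaminated := S.evolve s.pos s.pos s.contaminated }) : S.Invariant s' := by
  have hunc := h.mem_uncleared
  obtain ⟨hv, h2, h3, h4, -, -⟩ := h
  have hcont : s'.contaminated = S.evolve s.pos s.pos s.contaminated := by rw [hs']
  have hpos : s'.pos = s.pos := by rw [hs']
  have hD1 : s'.D1 = s.D1 := by rw [hs']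
  have hD2 : s'.D2 = s.D2 := by rw [hs']
  have hD3 : s'.D3 = update s.D3 x K := by rw [hs']
  have hchain' : s'.chain = x :: rest := by rw [hs', ← hchain]
  have hw' : ∀ l, S.watched s' l = S.watched s l := fun l => by rw [watched, hpos]; rfl
  rw [hchain] at hv h2 h4 hunc
  have hx := hv.1.notMem
  have hag : Agree s s' rest := fun w hw => by
    have : w ≠ x := by rintro rfl; exact hx hw
    simp [hs', this]
  have hun : uncleared s' (x :: rest) = uncleared s (x :: rest) := by
    ext p
    rw [mem_uncleared_cons, mem_uncleared_cons, hD2]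
    refine or_congr_right (exists_congr fun w => and_congr_right fun hw => ?_)
    rw [(hag w hw).2.2.2.2.2]
  obtain ⟨-, g2, g3, g4, g5, g6, g7, g8, -⟩ := hv.1
  refine ⟨?_, ?_, by rwa [hD1], ?_, ?_, by simp [hchain']⟩
  · rw [hchain']
    refine ⟨⟨hx, by rwa [hpos], by rw [hs']; exact g3, by rwa [hag.task_eq, hD2],
      by rwa [hag.task_eq, hD1, hD2], by rwa [hag.task_eq], by rw [hs']; exact g7, ?_, Or.inr ?_⟩,
      hv.2.congr hag⟩
    · rwa [hw', hD2]
    · rw [hD3, Function.update_self]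
      rwa [IsPocket, hD2]
  · intro w hw
    rw [hchain'] at hw
    rw [hD2, hD3, Function.update_of_ne (List.ne_of_not_mem_cons hw)]
    exact h2 w hw
  · intro w
    rw [hchain', hD1, hun]
    exact h4 w
  · intro p hp hpw
    rw [hcont] at hp
    rw [hchain', hun]
    obtain ⟨γ, hγ, h0, rfl, hγR, hγ0, -, hγw⟩ := exists_path_of_mem_evolve hp
    have hγB : ∀ t ∈ Icc (0 : ℝ) 1, γ t ∈ P.region ∧ γ t ∉ S.watched s (x :: rest) :=
      fun t ht => ⟨hγR t ht, notMem_watched_of_still (fun _ _ => rfl) fun w => hγw w t ht⟩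
    rcases mem_uncleared_cons.1 (hunc h0 hγ0) with h1 | ⟨w, hw, h1⟩
    · exact mem_uncleared_cons.2 (Or.inl (mem_of_path g8 hγ hγB h1))
    · exact mem_uncleared_cons.2 (Or.inr ⟨w, hw, hv.mem_of_path (List.mem_cons_of_mem _ hw) hγ hγB h1⟩)

/-- The new robot is put in charge of the pocket, which is separated off the lines of sight of the
robots engaged before. Behind its starting position it sees nothing of the pocket. -/
theorem Invariant.answer (h : S.Invariant s) {j m : ι} {q e f : Plane} {rest : List ι}
    (hchain : s.chain = j :: rest) (hD3 : s.D3 j ≠ ∅) (hm : S.CanAnswer s j m q e f)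
    (hs' : s' = { s with
        pos := update s.pos m q
        goal := update s.goal m f
        back := update s.back m e
        D1 := update s.D1 m (s.D1 m ∪ (s.D3 j ∩ S.sight m q))
        D2 := update s.D2 m (s.D3 j \ S.sight m q)
        chain := m :: j :: rest
        contaminated := S.evolve s.pos (update s.pos m q) s.contaminated }) : S.Invariant s' := by
  have hmj := h.notMem_of_canAnswer hchain hm
  have hunc := h.mem_uncleared
  obtain ⟨hv, h2, h3, h4, -, -⟩ := h
  have hcont : s'.contaminated = S.evolve s.pos (update s.pos m q) s.contaminated := by rw [hs']
  have hposm : s'.pos m = q := by simp [hs']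
  have hD1m : s'.D1 m = s.D1 m ∪ (s.D3 j ∩ S.sight m q) := by simp [hs']
  have hD2m : s'.D2 m = s.D3 j \ S.sight m q := by simp [hs']
  have hD3 : s'.D3 = s.D3 := by rw [hs']
  have hchain' : s'.chain = m :: j :: rest := by rw [hs']
  rw [hchain] at hv h2 h4 hunc
  have hag : Agree s s' (j :: rest) := fun w hw => by
    have : w ≠ m := by rintro rfl; exact hmj hw
    simp [hs', this]
  have hsub : uncleared s' (m :: j :: rest) ⊆ uncleared s (j :: rest) := by
    intro p hp
    rcases mem_uncleared_cons.1 hp with h1 | ⟨w, hw, h1⟩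
    · rw [hD2m] at h1
      exact mem_uncleared_cons.2 (Or.inl (hv.1.D3_subset h1.1))
    · rw [(hag w hw).2.2.2.2.1, (hag w hw).2.2.2.2.2] at h1
      rcases List.mem_cons.1 hw with rfl | hw
      · exact mem_uncleared_cons.2 (Or.inl h1.1)
      · exact mem_uncleared_cons.2 (Or.inr ⟨w, hw, h1⟩)
  obtain ⟨hm1, hm2, hm3⟩ := hm
  have hqt : q ∈ S.track m := by
    rcases hm3 with rfl | hm3
    · rw [← hm2.segment_eq]
      exact left_mem_segment ℝ _ _
    · exact hm3.1
  have htask : task (P := P) s' (j :: rest) = s.D3 j := hag.task_eq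
  refine ⟨?_, ?_, ?_, ?_, ?_, by simp [hchain']⟩
  · rw [hchain']
    refine ⟨⟨hmj, by rwa [hposm], by simpa [hs'] using hm2, by rw [htask, hD2m]; exact sdiff_subset,
      ?_, fun _ => ?_, ?_, ?_, ?_⟩, hv.congr hag⟩
    · rw [htask, hD1m, hD2m, union_assoc, inter_union_sdiff]
      exact subset_union_right
    · rw [htask]
      exact nonempty_iff_ne_empty.2 (hD3 ▸ ‹s.D3 j ≠ ∅›)
    · intro r hr
      rw [hposm, show s'.back m = e by simp [hs']] at hr
      rw [hD2m]
      rcases eq_or_ne r q with rfl | hrq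
      · exact disjoint_sdiff_left
      · rcases hm3 with rfl | hm3
        · rw [segment_same] at hr
          exact absurd hr hrq
        · exact ((hm3.2.2.2 r hr hrq).symm).mono_left sdiff_subset
    · intro z hz hzw
      rw [watched_cons, mem_union, not_or, hposm, hag.watched_eq] at hzw
      rw [hD2m]
      exact (hv.1.separated_D3 hz hzw.2).diff_isClosed (S.isClosed_sight m q) hzw.1
    · rw [hD3]
      exact Or.inl (h2 m hmj).2
  · intro w hw
    rw [hchain'] at hw
    have hwm := List.ne_of_not_mem_cons hw
    rw [hD3, show s'.D2 w = s.D2 w by simp [hs', hwm]]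
    exact h2 w (List.not_mem_of_not_mem_cons hw)
  · intro w
    rcases eq_or_ne w m with rfl | hwm
    · rw [hD1m]
      exact union_subset (h3 _) (inter_subset_right.trans (S.sight_subset _ _))
    · rw [show s'.D1 w = s.D1 w by simp [hs', hwm]]
      exact h3 w
  · intro w
    rw [hchain']
    rcases eq_or_ne w m with rfl | hwm
    · rw [hD1m, disjoint_union_left]
      refine ⟨(h4 _).mono_right hsub, ?_⟩
      rw [uncleared, disjoint_union_right, hD2m]
      refine ⟨disjoint_sdiff_right.mono_left inter_subset_right, ?_⟩
      rw [disjoint_iUnion₂_right]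
      intro w' hw'
      rw [(hag w' hw').2.2.2.2.1, (hag w' hw').2.2.2.2.2]
      exact (hv.disjoint_kept hw').mono_left inter_subset_left
    · rw [show s'.D1 w = s.D1 w by simp [hs', hwm]]
      exact (h4 w).mono_right hsub
  · intro p hp hpw
    rw [hcont] at hp
    rw [hchain']
    obtain ⟨γ, hγ, h0, rfl, hγR, hγ0, hγ1, hγw⟩ := exists_path_of_mem_evolve hp
    have hγB : ∀ t ∈ Icc (0 : ℝ) 1, γ t ∈ P.region ∧ γ t ∉ S.watched s (j :: rest) := by
      refine fun t ht => ⟨hγR t ht, notMem_watched_of_still (fun w hw => ?_) fun w => hγw w t ht⟩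
      exact Function.update_of_ne (by rintro rfl; exact hmj hw) _ _
    have hkept : ∀ w ∈ j :: rest, γ 0 ∈ s.D2 w \ s.D3 w → γ 1 ∈ uncleared s' (m :: j :: rest) := by
      intro w hw h1
      refine mem_uncleared_cons.2 (Or.inr ⟨w, hw, ?_⟩)
      rw [(hag w hw).2.2.2.2.1, (hag w hw).2.2.2.2.2]
      exact hv.mem_of_path hw hγ hγB h1
    rcases mem_uncleared_cons.1 (hunc h0 hγ0) with h1 | ⟨w, hw, h1⟩
    · by_cases h6 : γ 0 ∈ s.D3 j
      · refine mem_uncleared_cons.2 (Or.inl ?_)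
        rw [hD2m]
        refine ⟨mem_of_path (fun z => hv.1.separated_D3) hγ hγB h6, ?_⟩
        simpa using hγ1 m
      · exact hkept j List.mem_cons_self ⟨h1, h6⟩
    · exact hkept w (List.mem_cons_of_mem _ hw) h1

/-- A move to the next event point preserves the invariant, by the sweeping theorem for the shape of
what remains, and by its version with paths for the evaders. -/
theorem Invariant.advance (h : S.Invariant s) {rest : List ι} {q' : Plane}
    (hchain : s.chain = x :: rest) (hD3 : s.D3 x = ∅)
    (hK : ∀ K, ¬ S.IsPocket s x K) (hq : S.IsNextEvent s x q')
    (hs' : s' = { s with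
        pos := update s.pos x q'
        D1 := update s.D1 x (s.D1 x ∪ (s.D2 x ∩ S.swept x (s.pos x) q'))
        D2 := update s.D2 x (s.D2 x \ S.swept x (s.pos x) q')
        contaminated := S.evolve s.pos (update s.pos x q') s.contaminated }) : S.Invariant s' := by
  have hunc := h.mem_uncleared
  obtain ⟨hv, h2, h3, h4, -, -⟩ := h
  have hcont : s'.contaminated = S.evolve s.pos (update s.pos x q') s.contaminated := by rw [hs']
  have hposx : s'.pos x = q' := by simp [hs']
  have hD1x : s'.D1 x = s.D1 x ∪ (s.D2 x ∩ S.swept x (s.pos x) q') := by simp [hs']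
  have hD2x : s'.D2 x = s.D2 x \ S.swept x (s.pos x) q' := by simp [hs']
  have hD3' : s'.D3 = s.D3 := by rw [hs']
  have hchain' : s'.chain = x :: rest := by rw [hs', ← hchain]
  rw [hchain] at hv h2 h4 hunc
  have hx := hv.1.notMem
  have hag : Agree s s' rest := fun w hw => by
    have : w ≠ x := by rintro rfl; exact hx hw
    simp [hs', this]
  have hkept : ∀ w ∈ rest, s'.D2 w \ s'.D3 w = s.D2 w \ s.D3 w := fun w hw => by
    rw [(hag w hw).2.2.2.2.1, (hag w hw).2.2.2.2.2]
  have hun : uncleared s' (x :: rest) ⊆ uncleared s (x :: rest) := by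
    intro p hp
    refine mem_uncleared_cons.2 ((mem_uncleared_cons.1 hp).imp (fun h => ?_) ?_)
    · rw [hD2x] at h
      exact h.1
    · rintro ⟨w, hw, h⟩
      exact ⟨w, hw, hkept w hw ▸ h⟩
  have hsubR : s.D2 x ⊆ P.region := hv.1.D2_subset.trans hv.2.task_subset_region
  have hqpos : q' ∈ segment ℝ (s.pos x) (s.goal x) := hq.1
  have hgoal : s.goal x ∈ S.track x := by
    rw [← hv.1.ends.segment_eq]
    exact right_mem_segment ℝ _ _
  have hqt : q' ∈ S.track x := (convex_segment _ _).segment_subset hv.1.pos_mem hgoal hqpos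
  obtain ⟨-, g2, g3, g4, g5, g6, g7, g8, -⟩ := hv.1
  refine ⟨?_, ?_, ?_, ?_, ?_, by simp [hchain']⟩
  · rw [hchain']
    refine ⟨⟨hx, by rwa [hposx], by rw [hs']; exact g3, ?_, ?_, by rwa [hag.task_eq], ?_, ?_,
      Or.inl (by rwa [hD3'])⟩, hv.2.congr hag⟩
    · rw [hag.task_eq, hD2x]
      exact sdiff_subset.trans g4
    · rw [hag.task_eq, hD1x, hD2x, union_assoc, inter_union_sdiff]
      exact g5
    · intro r hr
      rw [hposx, show s'.back x = s.back x by rw [hs']] at hr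
      have hbt : s.back x ∈ S.track x := by
        rw [← g3.segment_eq]
        exact left_mem_segment ℝ _ _
      rw [hD2x]
      rcases S.mem_segment_or hbt hv.1.pos_mem hqt hr with hr | hr
      · exact (g7 r hr).mono_left sdiff_subset
      · exact disjoint_sdiff_left.mono_right (subset_biUnion_of_mem (u := S.sight x) hr)
    · intro z hz hzw
      rw [watched_cons, mem_union, not_or, hposx, hag.watched_eq] at hzw
      rw [hD2x]
      exact hv.1.separated_diff_swept hsubR hK hq (right_mem_segment ℝ _ _) hz hzw.2 hzw.1
  · intro w hw
    rw [hchain'] at hw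
    rw [hD3', show s'.D2 w = s.D2 w by simp [hs', List.ne_of_not_mem_cons hw]]
    exact h2 w hw
  · intro w
    rcases eq_or_ne w x with rfl | hwm
    · rw [hD1x]
      exact union_subset (h3 _) (inter_subset_left.trans hsubR)
    · rw [show s'.D1 w = s.D1 w by simp [hs', hwm]]
      exact h3 w
  · intro w
    rw [hchain']
    rcases eq_or_ne w x with rfl | hwm
    · rw [hD1x, disjoint_union_left]
      refine ⟨(h4 _).mono_right hun, ?_⟩
      rw [uncleared, disjoint_union_right, hD2x]
      refine ⟨disjoint_sdiff_right.mono_left inter_subset_right, ?_⟩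
      rw [disjoint_iUnion₂_right]
      intro w' hw'
      rw [hkept w' hw']
      exact (hv.2.disjoint_kept hw').mono_left (inter_subset_left.trans g4)
    · rw [show s'.D1 w = s.D1 w by simp [hs', hwm]]
      exact (h4 w).mono_right hun
  · intro p hp hpw
    rw [hcont] at hp
    rw [hchain']
    obtain ⟨γ, hγ, h0, rfl, hγR, hγ0, -, hγw⟩ := exists_path_of_mem_evolve hp
    have hγB : ∀ t ∈ Icc (0 : ℝ) 1, γ t ∈ P.region ∧ γ t ∉ S.watched s rest := by
      refine fun t ht => ⟨hγR t ht, notMem_watched_of_still (fun w hw => ?_) fun w => hγw w t ht⟩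
      exact Function.update_of_ne (by rintro rfl; exact hx hw) _ _
    rcases mem_uncleared_cons.1 (hunc h0 hγ0) with h1 | ⟨w, hw, h1⟩
    · refine mem_uncleared_cons.2 (Or.inl ?_)
      rw [hD2x]
      refine mem_diff_swept_of_path (B := S.watched s rest) (fun r hr z hz => ?_) hγ hγR
        (fun t ht => (hγB t ht).2) (fun t ht => ?_) h1
      · exact hv.1.separated_diff_swept hsubR hK hq hr hz
      · simpa using hγw x t ht
    · refine mem_uncleared_cons.2 (Or.inr ⟨w, hw, ?_⟩)
      rw [hkept w hw]
      exact hv.2.mem_of_path hw hγ hγB h1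

theorem Invariant.report (h : S.Invariant s) {m j : ι} {rest : List ι} {q' : Plane}
    (hchain : s.chain = m :: j :: rest) (hD2 : s.D2 m = ∅)
    (hs' : s' = { s with
        pos := update s.pos m q'
        D1 := update s.D1 j (s.D1 j ∪ s.D1 m)
        D2 := update s.D2 j (s.D2 j \ s.D1 m)
        D3 := update s.D3 j ∅
        chain := j :: rest
        contaminated := S.evolve s.pos (update s.pos m q') s.contaminated }) : S.Invariant s' := by
  have hkey := h.D2_diff_D1 hchain hD2
  have hunc := h.mem_uncleared
  obtain ⟨hv, h2, h3, h4, -, -⟩ := h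
  have hcont : s'.contaminated = S.evolve s.pos (update s.pos m q') s.contaminated := by rw [hs']
  rw [hchain] at hv h2 h4 hunc
  have hm := hv.1.notMem
  have hj := hv.2.1.notMem
  have hmj : j ≠ m := by rintro rfl; exact hm List.mem_cons_self
  have hD1j : s'.D1 j = s.D1 j ∪ s.D1 m := by simp [hs']
  have hD2j : s'.D2 j = s.D2 j \ s.D3 j := by simp [hs', hkey]
  have hD3j : s'.D3 j = ∅ := by simp [hs']
  have hchain' : s'.chain = j :: rest := by rw [hs']
  have hpos : ∀ w ∈ j :: rest, s'.pos w = s.pos w := fun w hw => by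
    have : w ≠ m := by rintro rfl; exact hm hw
    simp [hs', this]
  have hw' : S.watched s' (j :: rest) = S.watched s (j :: rest) := by
    ext p
    simp only [mem_watched]
    exact exists_congr fun w => and_congr_right fun hw => by rw [hpos w hw]
  have hposj := hpos j List.mem_cons_self
  have hag : Agree s s' rest := fun w hw => by
    have h1 : w ≠ m := by rintro rfl; exact hm (List.mem_cons_of_mem _ hw)
    have h2 : w ≠ j := by rintro rfl; exact hj hw
    simp [hs', h1, h2]
  have hkept : ∀ w ∈ rest, s'.D2 w \ s'.D3 w = s.D2 w \ s.D3 w := fun w hw => by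
    rw [(hag w hw).2.2.2.2.1, (hag w hw).2.2.2.2.2]
  have hun : ∀ p, p ∈ uncleared s' (j :: rest) ↔ ∃ w ∈ j :: rest, p ∈ s.D2 w \ s.D3 w := by
    intro p
    rw [mem_uncleared_cons, hD2j, List.exists_mem_cons_iff]
    refine or_congr_right (exists_congr fun w => and_congr_right fun hw => ?_)
    rw [hkept w hw]
  have hsub : uncleared s' (j :: rest) ⊆ uncleared s (m :: j :: rest) := fun p hp =>
    mem_uncleared_cons.2 (Or.inr ((hun p).1 hp))
  obtain ⟨-, g2, g3, g4, g5, g6, g7, g8, -⟩ := hv.2.1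
  refine ⟨?_, ?_, ?_, ?_, ?_, by simp [hchain']⟩
  · rw [hchain']
    refine ⟨⟨hj, by rwa [hposj], by rw [hs']; exact g3, ?_, ?_, by rwa [hag.task_eq], ?_, ?_,
      Or.inl hD3j⟩, hv.2.2.congr hag⟩
    · rw [hag.task_eq, hD2j]
      exact sdiff_subset.trans g4
    · rw [hag.task_eq, hD1j, hD2j, ← hkey, union_assoc, union_sdiff_self]
      exact g5.trans (union_subset_union_right _ subset_union_right)
    · intro r hr
      rw [hposj, show s'.back j = s.back j by rw [hs']] at hr
      rw [hD2j]
      exact (g7 r hr).mono_left sdiff_subset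
    · intro z hz hzw
      rw [hw'] at hzw
      rw [hD2j]
      exact (g8 z hz hzw).diff (hv.2.1.separated_D3 hz hzw)
  · intro w hw
    rw [hchain'] at hw
    have h1 := List.ne_of_not_mem_cons hw
    rw [show s'.D2 w = s.D2 w by simp [hs', h1], show s'.D3 w = s.D3 w by simp [hs', h1]]
    rcases eq_or_ne w m with rfl | hwm
    · exact ⟨hD2, subset_empty_iff.1 (hv.1.D3_subset.trans hD2.subset)⟩
    · exact h2 w (by rw [List.mem_cons, not_or]; exact ⟨hwm, hw⟩)
  · intro w
    rcases eq_or_ne w j with rfl | hwm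
    · rw [hD1j]
      exact union_subset (h3 _) (h3 _)
    · rw [show s'.D1 w = s.D1 w by simp [hs', hwm]]
      exact h3 w
  · intro w
    rw [hchain']
    rcases eq_or_ne w j with rfl | hwm
    · rw [hD1j, disjoint_union_left]
      exact ⟨(h4 _).mono_right hsub, (h4 _).mono_right hsub⟩
    · rw [show s'.D1 w = s.D1 w by simp [hs', hwm]]
      exact (h4 w).mono_right hsub
  · intro p hp hpw
    rw [hcont] at hp
    rw [hchain', hun]
    obtain ⟨γ, hγ, h0, rfl, hγR, hγ0, -, hγw⟩ := exists_path_of_mem_evolve hp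
    have hγB : ∀ t ∈ Icc (0 : ℝ) 1, γ t ∈ P.region ∧ γ t ∉ S.watched s (j :: rest) := by
      refine fun t ht => ⟨hγR t ht, notMem_watched_of_still (fun w hw => ?_) fun w => hγw w t ht⟩
      exact Function.update_of_ne (by rintro rfl; exact hm hw) _ _
    rcases mem_uncleared_cons.1 (hunc h0 hγ0) with h1 | ⟨w, hw, h1⟩
    · rw [hD2] at h1
      exact h1.elim
    · exact ⟨w, hw, hv.2.mem_of_path hw hγ hγB h1⟩

/-- When the last robot has nothing left to clear, there is no place left for unseen evaders. -/
theorem Invariant.finish (h : S.Invariant s) {q' : Plane} (hchain : s.chain = [x])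
    (hD2 : s.D2 x = ∅)
    (hs' : s' = { s with
        pos := update s.pos x q'
        chain := []
        contaminated := S.evolve s.pos (update s.pos x q') s.contaminated }) : S.Invariant s' := by
  have hunc := h.mem_uncleared
  obtain ⟨hv, h2, h3, h4, -, -⟩ := h
  rw [hchain] at hv h2 h4 hunc
  have hchain' : s'.chain = [] := by rw [hs']
  have hD1 : s'.D1 = s.D1 := by rw [hs']
  have hcont : s'.contaminated = ∅ := by
    rw [hs', eq_empty_iff_forall_notMem]
    intro p hp
    obtain ⟨γ, -, h0, -, -, hγ0, -⟩ := exists_path_of_mem_evolve hp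
    simpa [uncleared, hD2] using hunc h0 hγ0
  refine ⟨by rw [hchain']; trivial, fun w _ => ?_, by rwa [hD1], fun w => ?_, ?_, fun _ => ⟨?_, hcont⟩⟩
  · rw [show s'.D2 w = s.D2 w by rw [hs'], show s'.D3 w = s.D3 w by rw [hs']]
    rcases eq_or_ne w x with rfl | hwx
    · exact ⟨hD2, subset_empty_iff.1 (hv.1.D3_subset.trans hD2.subset)⟩
    · exact h2 w (by simpa using hwx)
  · rw [hchain']
    exact disjoint_empty _
  · intro p hp
    rw [hcont] at hp
    exact hp.elim
  · have h1 : P.region ⊆ s.D1 x := by simpa [task, hD2] using hv.1.subset_union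
    rw [hD1]
    exact h1.trans (subset_iUnion s.D1 x)

theorem Invariant.step (h : S.Invariant s) (hs : S.Step s s') : S.Invariant s' := by
  cases hs with
  | wait i rest K hchain hD3 hK => exact h.wait hchain hK rfl
  | answer j m rest q e f hchain hD3 hm => exact h.answer hchain hD3 hm rfl
  | advance i rest q' hchain hD3 hD2 hK hq => exact h.advance hchain hD3 hK hq rfl
  | report m j rest q' hchain hD2 hq => exact h.report hchain hD2 rfl
  | finish i q' hchain hD2 hq => exact h.finish hchain hD2 rfl

end Steps

theorem Invariant.of_isStart {i : ι} (h : S.IsStart i s) : S.Invariant s := by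
  obtain ⟨h1, h2, h3, h4, h5, h6, h7, h8, h9⟩ := h
  refine ⟨?_, ?_, fun w => ?_, fun w => ?_, ?_, by simp [h8]⟩
  · rw [h8]
    refine ⟨⟨List.not_mem_nil, h1 i, h3, ?_, ?_, fun h => absurd rfl h, ?_, ?_, Or.inl (h7 i)⟩, trivial⟩
    · rw [h5]
      exact sdiff_subset
    · rw [h4, h5, union_sdiff_self]
      exact subset_union_right
    · intro r hr
      rw [h2, segment_same, mem_singleton_iff] at hr
      rw [h5, hr, ← h2]
      exact disjoint_sdiff_left
    · intro z hz hzw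
      rw [watched_cons, mem_union, not_or] at hzw
      rw [h5]
      exact Separated.diff_isClosed (Or.inl self_mem_nhdsWithin) (S.isClosed_sight i _) hzw.1
  · intro w hw
    rw [h8, List.mem_singleton] at hw
    exact ⟨(h6 w hw).2, h7 w⟩
  · rcases eq_or_ne w i with rfl | hw
    · rw [h4]
      exact S.sight_subset _ _
    · rw [(h6 w hw).1]
      exact empty_subset _
  · rcases eq_or_ne w i with rfl | hw
    · rw [h4, h8]
      simpa [uncleared, h5] using disjoint_sdiff_right
    · rw [(h6 w hw).1]
      exact empty_disjoint _
  · intro p hp hpw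
    rw [h8, watched_cons, mem_union, not_or] at hpw
    rw [h8, mem_uncleared_cons, h5]
    rw [h9] at hp
    exact Or.inl ⟨hp, hpw.1⟩

end SlidingRobots

namespace SlidingRobots

open OrthoPlane

variable {n : ℕ} [NeZero n] {P : SimpleOrthogonalPolygon n} {ι : Type*} {S : SlidingRobots P ι}
  {s s' : PursuitState ι} {x : ι} {l lower : List ι}

/-! ### The algorithm does not get stuck -/

/-- From its track a robot sees a given point from at most one position. -/
lemma subsingleton_setOf_mem_sight (i : ι) (p : Plane) :
    {q | q ∈ S.track i ∧ p ∈ S.sight i q}.Subsingleton := fun _ hq _ hq' =>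
  S.eq_of_mem_sight hq.1 hq'.1 hq.2 hq'.2

lemma finite_setOf_exists_mem_sight (i : ι) {A : Set Plane} (hA : A.Finite) :
    {q ∈ S.track i | ∃ p ∈ A, p ∈ S.sight i q}.Finite := by
  refine (hA.biUnion fun p _ => (subsingleton_setOf_mem_sight (S := S) i p).finite).subset ?_
  rintro q ⟨hq, p, hp, hpq⟩
  exact mem_biUnion hp ⟨hq, hpq⟩

/-- The finitely many points whose sight can make a position on the track of `i` an event point. -/
def landmarks (S : SlidingRobots P ι) (s : PursuitState ι) (i : ι) : Set Plane :=
  range P.vertex ∪ range s.pos ∪ {S.a i, S.b i}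

lemma finite_landmarks [Finite ι] (i : ι) : (S.landmarks s i).Finite :=
  ((finite_range _).union (finite_range _)).union (toFinite _)

lemma Level.back_mem (h : S.Level s x lower) : s.back x ∈ S.track x :=
  h.ends.segment_eq ▸ left_mem_segment ℝ _ _

lemma Level.goal_mem (h : S.Level s x lower) : s.goal x ∈ S.track x :=
  h.ends.segment_eq ▸ right_mem_segment ℝ _ _

lemma segment_subset_track {i : ι} {q q' : Plane} (hq : q ∈ S.track i) (hq' : q' ∈ S.track i) :
    segment ℝ q q' ⊆ S.track i := (convex_segment _ _).segment_subset hq hq'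

lemma Level.exists_isMoveBack [Finite ι] (h : S.Level s x lower) : ∃ q', S.IsMoveBack s x q' := by
  have hfin : {q ∈ segment ℝ (s.pos x) (s.back x) | q = s.back x ∨ S.SeesWaiting s x q}.Finite := by
    refine ((finite_singleton (s.back x)).union
      (finite_setOf_exists_mem_sight (S := S) x (finite_range s.pos))).subset ?_
    rintro q ⟨hq, rfl | ⟨w, -, -, hw⟩⟩
    · exact Or.inl rfl
    · exact Or.inr ⟨segment_subset_track h.pos_mem h.back_mem hq, _, mem_range_self w, hw⟩
  obtain ⟨q', ⟨h1, h2⟩, h3⟩ := exists_min_image _ (dist (s.pos x)) hfin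
    ⟨s.back x, right_mem_segment ℝ _ _, Or.inl rfl⟩
  refine ⟨q', h1, h2, fun r hr hrq hw => ?_⟩
  have h4 := h3 r ⟨(convex_segment _ _).segment_subset (left_mem_segment ℝ _ _) h1 hr, Or.inr hw⟩
  exact h4.not_gt (dist_lt_of_mem_segment hr hrq)

lemma Level.exists_isNextEvent [Finite ι] (h : S.Level s x lower) (hD2 : s.D2 x ≠ ∅)
    (hK : ∀ K, ¬ S.IsPocket s x K) : ∃ q', S.IsNextEvent s x q' := by
  have hgoal : s.goal x ≠ s.pos x := by
    intro hg
    obtain ⟨z, hz⟩ := nonempty_iff_ne_empty.2 hD2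
    obtain ⟨p, hp, r, hr, hpr⟩ := h.exists_mem_sight hK hz
    rw [hg, segment_same, mem_singleton_iff] at hr
    rw [hr] at hpr
    exact disjoint_left.1 (h.unseen _ (right_mem_segment ℝ _ _))
      (connectedComponentIn_subset _ _ hp) hpr
  have hfin : {q ∈ segment ℝ (s.pos x) (s.goal x) | q ≠ s.pos x ∧ S.IsEventPoint s x q}.Finite := by
    refine (finite_setOf_exists_mem_sight (S := S) x (finite_landmarks (S := S) (s := s) x)).subset ?_
    rintro q ⟨hq, -, hev⟩
    have hqt := segment_subset_track h.pos_mem h.goal_mem hq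
    refine ⟨hqt, ?_⟩
    rcases hev with ⟨k, -, hk⟩ | ⟨w, -, -, hw⟩ | hq
    · exact ⟨_, Or.inl (Or.inl (mem_range_self k)), hk⟩
    · exact ⟨_, Or.inl (Or.inr (mem_range_self w)), hw⟩
    · exact ⟨q, Or.inr hq, S.mem_sight_self hqt⟩
  have hgoal' : S.IsEventPoint s x (s.goal x) := by
    rcases h.ends with ⟨-, h⟩ | ⟨-, h⟩
    · exact Or.inr (Or.inr (Or.inr h))
    · exact Or.inr (Or.inr (Or.inl h))
  obtain ⟨q', ⟨h1, h2, h3⟩, h4⟩ := exists_min_image _ (dist (s.pos x)) hfin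
    ⟨s.goal x, right_mem_segment ℝ _ _, hgoal, hgoal'⟩
  refine ⟨q', h1, h2, h3, fun r hr hev => ?_⟩
  have hr' := openSegment_subset_segment ℝ _ _ hr
  have h5 : r ≠ s.pos x := by
    rintro rfl
    exact h2.symm (left_mem_openSegment_iff.1 hr)
  have h6 : r ≠ q' := by
    rintro rfl
    exact h2.symm (right_mem_openSegment_iff.1 hr)
  exact (h4 r ⟨(convex_segment _ _).segment_subset (left_mem_segment ℝ _ _) h1 hr', h5, hev⟩).not_gt
    (dist_lt_of_mem_segment hr' h6)

lemma Step.chain_ne_nil [DecidableEq ι] (hs : S.Step s s') : s.chain ≠ [] := by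
  cases hs <;> simp [*]

/-- As long as some robot is in charge, some step is possible. -/
theorem Invariant.exists_step [Finite ι] [DecidableEq ι] (hS : ⋃ i, S.visibilityPolygon i = P.region)
    (h : S.Invariant s) (hne : s.chain ≠ []) : ∃ s', S.Step s s' := by
  obtain ⟨x, rest, hchain⟩ := List.exists_cons_of_ne_nil hne
  have hv := h.valid
  rw [hchain] at hv
  by_cases hD3 : s.D3 x = ∅
  · by_cases hD2 : s.D2 x = ∅
    · obtain ⟨q', hq⟩ := hv.1.exists_isMoveBack
      cases rest with
      | nil => exact ⟨_, Step.finish s x q' hchain hD2 hq⟩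
      | cons j rest => exact ⟨_, Step.report s x j rest q' hchain hD2 hq⟩
    · by_cases hK : ∃ K, S.IsPocket s x K
      · obtain ⟨K, hK⟩ := hK
        exact ⟨_, Step.wait s x rest K hchain hD3 hK⟩
      · rw [not_exists] at hK
        obtain ⟨q', hq⟩ := hv.1.exists_isNextEvent hD2 hK
        exact ⟨_, Step.advance s x rest q' hchain hD3 hD2 hK hq⟩
  · obtain ⟨p, hp⟩ := nonempty_iff_ne_empty.2 hD3
    have hpR : p ∈ P.region := (hv.task_subset_region : s.D3 x ⊆ _) hp
    rw [← hS, mem_iUnion] at hpR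
    obtain ⟨m, hm⟩ := hpR
    exact ⟨_, Step.answer s x m rest (S.a m) (S.a m) (S.b m) hchain hD3
      ⟨⟨p, hm, hp⟩, Or.inl ⟨rfl, rfl⟩, Or.inl rfl⟩⟩

end SlidingRobots

namespace SlidingRobots

open OrthoPlane

variable {n : ℕ} [NeZero n] {P : SimpleOrthogonalPolygon n} {ι : Type*} (S : SlidingRobots P ι)

/-! ### Termination -/

/-- The event points that robot `x` still has before it on its way to its goal, if the robots that
wait are those of `lower`. -/
def eventsAhead (s : PursuitState ι) (x : ι) (lower : List ι) : Set Plane :=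
  {q ∈ segment ℝ (s.pos x) (s.goal x) | q ≠ s.pos x ∧
    ((∃ k, P.IsReflex k ∧ P.vertex k ∈ S.sight x q) ∨ (∃ w ∈ lower, s.pos w ∈ S.sight x q) ∨
      q = S.a x ∨ q = S.b x)}

/-- The pieces of what robot `x` still has to clear. -/
def pieces (s : PursuitState ι) (x : ι) : Set (Set Plane) :=
  {K | ∃ p ∈ s.D2 x, K = connectedComponentIn (s.D2 x) p}

open Classical in
/-- What decreases, in the lexicographic order, while robot `x` works above the same robots `lower`:
the number of event points ahead, the number of pieces to be cleared, and a flag that is lowered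
when it starts to wait. -/
noncomputable def progress (s : PursuitState ι) (x : ι) (lower : List ι) : ℕ ×ₗ ℕ ×ₗ ℕ :=
  toLex ((S.eventsAhead s x lower).ncard, toLex ((pieces s x).ncard, if s.D3 x = ∅ then 1 else 0))

/-- The progress of the robot at height `k` above the bottom of the chain, `⊤` if there is none. -/
noncomputable def progressAt (s : PursuitState ι) : List ι → ℕ → WithTop (ℕ ×ₗ ℕ ×ₗ ℕ)
  | [], _ => ⊤
  | x :: lower, k => if k = lower.length then (S.progress s x lower : WithTop (ℕ ×ₗ ℕ ×ₗ ℕ))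
      else progressAt s lower k

/-- The progress of all robots of the chain, from the bottom to the top. -/
noncomputable def totalProgress [Fintype ι] (s : PursuitState ι) :
    Lex (Fin (Fintype.card ι) → WithTop (ℕ ×ₗ ℕ ×ₗ ℕ)) :=
  toLex fun k => S.progressAt s s.chain k

variable {S} {s s' : PursuitState ι} {x : ι} {l lower : List ι}

lemma progressAt_cons_length : S.progressAt s (x :: lower) lower.length = S.progress s x lower := by
  simp [progressAt]

lemma progressAt_cons_of_lt {k : ℕ} (hk : k < lower.length) :
    S.progressAt s (x :: lower) k = S.progressAt s lower k := by
  simp [progressAt, hk.ne]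

lemma progressAt_eq_top {k : ℕ} (hk : l.length ≤ k) : S.progressAt s l k = ⊤ := by
  induction l with
  | nil => rfl
  | cons x lower ih =>
    rw [List.length_cons] at hk
    rw [progressAt, if_neg (by omega), ih (by omega)]

lemma eventsAhead_congr (h : Agree s s' lower) (hp : s'.pos x = s.pos x) (hg : s'.goal x = s.goal x) :
    S.eventsAhead s' x lower = S.eventsAhead s x lower := by
  have h1 : ∀ q, (∃ w ∈ lower, s'.pos w ∈ S.sight x q) ↔ ∃ w ∈ lower, s.pos w ∈ S.sight x q :=
    fun q => exists_congr fun w => and_congr_right fun hw => by rw [(h w hw).1]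
  simp only [eventsAhead, hp, hg, h1]

lemma progressAt_congr (h : Agree s s' l) (k : ℕ) : S.progressAt s' l k = S.progressAt s l k := by
  induction l with
  | nil => rfl
  | cons x lower ih =>
    obtain ⟨h1, h2, -, -, h5, h6⟩ := h x List.mem_cons_self
    rw [progressAt, progressAt, ih h.tail, progress, progress, eventsAhead_congr h.tail h1 h2, pieces,
      pieces, h5, h6]

lemma Level.finite_eventsAhead [Finite ι] (h : S.Level s x lower) :
    (S.eventsAhead s x lower).Finite := by
  refine (finite_setOf_exists_mem_sight (S := S) x (finite_landmarks (S := S) (s := s) x)).subset ?_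
  rintro q ⟨hq, -, hev⟩
  have hqt := segment_subset_track h.pos_mem h.goal_mem hq
  refine ⟨hqt, ?_⟩
  rcases hev with ⟨k, -, hk⟩ | ⟨w, -, hw⟩ | hq
  · exact ⟨_, Or.inl (Or.inl (mem_range_self k)), hk⟩
  · exact ⟨_, Or.inl (Or.inr (mem_range_self w)), hw⟩
  · exact ⟨q, Or.inr hq, S.mem_sight_self hqt⟩

lemma Valid.finite_pieces (h : S.Valid s (x :: lower)) : (pieces s x).Finite := by
  have hsub : s.D2 x ⊆ P.region := h.1.D2_subset.trans h.2.task_subset_region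
  exact finite_components P.isRegion.isTame (isTame_watched (S := S) (s := s) (l := x :: lower))
    (fun p hp => ⟨hsub hp, disjoint_left.1 h.disjoint_watched hp⟩)
    fun z hz => h.1.separated z hz.1 hz.2

/-- The removal of a piece leaves the other pieces as they are. -/
lemma pieces_diff_subset {D : Set Plane} (hD : s'.D2 x = s.D2 x \ D) (hK : D ∈ pieces s x) :
    pieces s' x ⊆ pieces s x \ {D} := by
  obtain ⟨p, hp, rfl⟩ := hK
  rintro _ ⟨p', hp', rfl⟩
  rw [hD] at hp' ⊢
  have hne : connectedComponentIn (s.D2 x) p' ≠ connectedComponentIn (s.D2 x) p := fun h =>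
    hp'.2 (h ▸ mem_connectedComponentIn hp'.1)
  have heq : connectedComponentIn (s.D2 x \ connectedComponentIn (s.D2 x) p) p' =
      connectedComponentIn (s.D2 x) p' := by
    refine subset_antisymm (connectedComponentIn_mono _ sdiff_subset) ?_
    refine isPreconnected_connectedComponentIn.subset_connectedComponentIn
      (mem_connectedComponentIn hp'.1) fun z hz => ⟨connectedComponentIn_subset _ _ hz, fun hz' => ?_⟩
    exact hne ((connectedComponentIn_eq hz).trans (connectedComponentIn_eq hz').symm)
  rw [heq]
  exact ⟨⟨p', hp'.1, rfl⟩, hne⟩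

/-- The lexicographic order compares the lowest robots first. -/
lemma totalProgress_lt [Fintype ι] {k : ℕ} (hk : k < Fintype.card ι)
    (h1 : ∀ k' < k, S.progressAt s' s'.chain k' = S.progressAt s s.chain k')
    (h2 : S.progressAt s' s'.chain k < S.progressAt s s.chain k) :
    S.totalProgress s' < S.totalProgress s :=
  ⟨⟨k, hk⟩, fun k' hk' => h1 k' hk', h2⟩

/-- Each step that leaves some robot in charge makes progress. -/
theorem Invariant.totalProgress_lt [Fintype ι] [DecidableEq ι] (h : S.Invariant s)
    (hs : S.Step s s') (hne : s'.chain ≠ []) : S.totalProgress s' < S.totalProgress s := by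
  have hv' := (h.step hs).valid
  have hcard : ∀ (y : ι) (l : List ι), s'.chain = y :: l → l.length < Fintype.card ι := by
    intro y l hl
    have := hv'.nodup.length_le_card
    rw [hl, List.length_cons] at this
    omega
  have hv := h.valid
  cases hs with
  | wait i rest K hchain hD3 hK =>
    -- The flag is lowered; events and pieces are unchanged.
    rw [hchain] at hv
    refine SlidingRobots.totalProgress_lt (hcard _ _ hchain) ?_ ?_ <;> dsimp only <;> rw [hchain]
    · intro k hk
      rw [progressAt_cons_of_lt hk, progressAt_cons_of_lt hk]
      refine progressAt_congr (fun w hw => ?_) k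
      have : w ≠ i := by rintro rfl; exact hv.1.notMem hw
      simp [this]
    · rw [progressAt_cons_length, progressAt_cons_length, WithTop.coe_lt_coe, progress, progress,
        Prod.Lex.toLex_lt_toLex]
      refine Or.inr ⟨congrArg ncard (eventsAhead_congr (fun w hw => ?_) rfl rfl), ?_⟩
      rotate_left
      · refine Prod.Lex.toLex_lt_toLex.2 (Or.inr ⟨rfl, ?_⟩)
        simp [hD3, hK.nonempty.ne_empty]
      · have : w ≠ i := by rintro rfl; exact hv.1.notMem hw
        simp [this]
  | answer j m rest q e f hchain hD3 hm =>
    -- A robot appears at a height at which there was none.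
    have hmj := h.notMem_of_canAnswer hchain hm
    refine SlidingRobots.totalProgress_lt (hcard _ _ rfl) ?_ ?_ <;> rw [hchain]
    · intro k hk
      rw [progressAt_cons_of_lt hk]
      refine progressAt_congr (fun w hw => ?_) k
      have : w ≠ m := by rintro rfl; exact hmj hw
      simp [this]
    · rw [progressAt_cons_length, progressAt_eq_top (l := j :: rest) le_rfl]
      exact WithTop.coe_lt_top _
  | advance i rest q' hchain hD3 hD2 hK hq =>
    -- The new position is no longer ahead.
    rw [hchain] at hv
    have hx := hv.1.notMem
    refine SlidingRobots.totalProgress_lt (hcard _ _ hchain) ?_ ?_ <;> dsimp only <;> rw [hchain]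
    · intro k hk
      rw [progressAt_cons_of_lt hk, progressAt_cons_of_lt hk]
      refine progressAt_congr (fun w hw => ?_) k
      have : w ≠ i := by rintro rfl; exact hv.1.notMem hw
      simp [this]
    · rw [progressAt_cons_length, progressAt_cons_length, WithTop.coe_lt_coe, progress, progress,
        Prod.Lex.toLex_lt_toLex]
      refine Or.inl (ncard_lt_ncard ?_ hv.1.finite_eventsAhead)
      obtain ⟨h1, h2, h3, -⟩ := hq
      have hpos : ∀ w ∈ rest, Function.update s.pos i q' w = s.pos w := fun w hw =>
        Function.update_of_ne (by rintro rfl; exact hx hw) _ _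
      rw [ssubset_iff_of_subset]
      · refine ⟨q', ⟨h1, h2, h3.imp_right (Or.imp_left ?_)⟩, fun h => ?_⟩
        · rintro ⟨w, hw1, hw2, hw3⟩
          refine ⟨w, ?_, hw3⟩
          by_contra hw
          exact hw2 (h.idle w (by simp [hchain, hw, hw1])).2
        · exact h.2.1 (by simp)
      · rintro r ⟨hr1, hr2, hr3⟩
        simp only [Function.update_self] at hr1 hr2
        refine ⟨(convex_segment _ _).segment_subset h1 (right_mem_segment ℝ _ _) hr1, ?_,
          hr3.imp_right (Or.imp_left ?_)⟩
        · rintro rfl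
          have e1 := dist_add_dist_of_mem_segment h1
          have e2 := dist_add_dist_of_mem_segment hr1
          rw [dist_comm q'] at e2
          have e3 := dist_pos.2 h2
          rw [dist_comm] at e3
          linarith
        · rintro ⟨w, hw, hws⟩
          exact ⟨w, hw, hpos w hw ▸ hws⟩
  | report m j rest q' hchain hD2 hq =>
    -- The robot `j` has one piece less to clear, and the events ahead of it are the same.
    have hkey := h.D2_diff_D1 hchain hD2
    rw [hchain] at hv
    have hj : j ∉ rest := hv.2.1.notMem
    have hmj : j ≠ m := by rintro rfl; exact hv.1.notMem List.mem_cons_self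
    refine SlidingRobots.totalProgress_lt (k := rest.length) (hcard _ _ rfl) ?_ ?_ <;>
      dsimp only <;> rw [hchain]
    · intro k hk
      rw [progressAt_cons_of_lt hk, progressAt_cons_of_lt (hk.trans (by simp)),
        progressAt_cons_of_lt hk]
      refine progressAt_congr (fun w hw => ?_) k
      have h1 : w ≠ m := by rintro rfl; exact hv.1.notMem (List.mem_cons_of_mem _ hw)
      have h2 : w ≠ j := by rintro rfl; exact hj hw
      simp [h1, h2]
    · rw [progressAt_cons_length, progressAt_cons_of_lt (lower := j :: rest) (by simp),
        progressAt_cons_length, WithTop.coe_lt_coe, progress, progress,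
        Prod.Lex.toLex_lt_toLex]
      refine Or.inr ⟨congrArg ncard (eventsAhead_congr (fun w hw => ?_) (by simp [hmj]) rfl), ?_⟩
      rotate_left
      · refine Prod.Lex.toLex_lt_toLex.2 (Or.inl ?_)
        have hpiece : s.D3 j ∈ pieces s j :=
          (hv.2.1.pocket.resolve_left (hv.1.nonempty (List.cons_ne_nil _ _)).ne_empty).1
        refine ncard_lt_ncard (ssubset_of_subset_of_ssubset
          (pieces_diff_subset (D := s.D3 j) (by simp [hkey]) hpiece) ?_) hv.2.finite_pieces
        exact sdiff_singleton_ssubset.2 hpiece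
      · have h1 : w ≠ m := by rintro rfl; exact hv.1.notMem (List.mem_cons_of_mem _ hw)
        have h2 : w ≠ j := by rintro rfl; exact hj hw
        simp [h1, h2]
  | finish i q' hchain hD2 hq => exact absurd rfl hne

end SlidingRobots

open SlidingRobots in
theorem mainTheorem3 {n : ℕ} [NeZero n] (P : SimpleOrthogonalPolygon n)
    {ι : Type*} [Fintype ι] [DecidableEq ι] (S : SlidingRobots P ι)
    (hS : ⋃ i, S.visibilityPolygon i = P.region)
    (i : ι) (s₀ : PursuitState ι) (hs₀ : S.IsStart i s₀) :
    (¬ ∃ run : ℕ → PursuitState ι, run 0 = s₀ ∧ ∀ t, S.Step (run t) (run (t + 1))) ∧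
    (∀ s, Relation.ReflTransGen S.Step s₀ s → (∀ s', ¬ S.Step s s') →
      SlidingRobots.Terminated (P := P) s ∧ s.contaminated = ∅) := by
  have h0 := Invariant.of_isStart hs₀
  constructor
  · rintro ⟨run, hrun0, hrun⟩
    have hinv : ∀ t, S.Invariant (run t) := by
      intro t
      induction t with
      | zero => rwa [hrun0]
      | succ t ih => exact ih.step (hrun t)
    exact (wellFounded_iff_isEmpty_descending_chain.1
      (wellFounded_lt (α := Lex (Fin (Fintype.card ι) → WithTop (ℕ ×ₗ ℕ ×ₗ ℕ))))).false
      ⟨fun t => S.totalProgress (run t), fun t =>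
        (hinv t).totalProgress_lt (hrun t) (hrun (t + 1)).chain_ne_nil⟩
  · intro s hs hstuck
    have hinv : S.Invariant s := by
      clear hstuck
      induction hs with
      | refl => exact h0
      | tail _ h ih => exact ih.step h
    have hchain : s.chain = [] := by
      by_contra hne
      obtain ⟨s', hs'⟩ := hinv.exists_step hS hne
      exact hstuck s' hs'
    have hidle := fun w => hinv.idle w (by simp [hchain])
    obtain ⟨h1, h2⟩ := hinv.finished hchain
    exact ⟨⟨fun w => (hidle w).2, fun w => (hidle w).1,
      subset_antisymm (iUnion_subset hinv.D1_subset) h1⟩, h2⟩
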